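/- A real or $\mathbb R^n$-valued Lévy process is a process $(X(t))_{t\ge 0}$ with $X(0)=0$ a.s. that has stationary and independent increments and is stochastically continuous. Let $U$ be a separable real Banach space with dual $U^*$ and let $(\Omega,\mathcal F,P)$ be a probability space with a filtration $(\mathcal F_t)_{t\ge 0}$. Let $L=(L(t))_{t\ge 0}$ be a weakly cylindrical Lévy process in $U$: each $L(t):U^*\to L^0(\Omega,\mathcal F,P)$ is linear, $L(t)a$ is $\mathcal F_t$-measurable, and $(L(t)a_1,\dots,L(t)a_n)_{t\ge 0}$ is a Lévy process in $\mathbb R^n$ for all $n$ and $a_1,\dots,a_n\in U^*$. Assume that $L$ is weakly càdlàg (for every $a\in U^*$ the process $L(\cdot)a$ has càdlàg paths a.s.) and of weak order $2$ ($E|L(t)a|^2<\infty$ for all $t\ge0$, $a\in U^*$). For $a\in U^*$, $t\ge 0$ and Borel $B\subseteq\mathbb R\setminus\{0\}$ put $$N_a(t,B)=\sum_{0\le s\le t}\mathbf 1_B(\Delta L(s)a),\qquad \nu_a(B)=E[N_a(1,B)],\qquad \tilde N_a(t,B)=N_a(t,B)-t\,\nu_a(B),$$ and let $$M_2(t)a=\int_{\mathbb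 R\setminus\{0\}}\beta\,\tilde N_a(t,d\beta)=\lim_{\varepsilon\downarrow 0}\int_{|\beta|>\varepsilon}\beta\,\tilde N_a(t,d\beta)\in L^2(\Omega,\mathcal F,P).$$ Assume that $M_2$ is strong, i.e. its covariance operator maps $U^*$ to $U$: there is $Q_2:U^*\to U$ with $\langle Q_2a,b\rangle=E[(M_2(1)a)(M_2(1)b)]$ for all $a,b\in U^*$. Then: (i) For all $t\ge 0$ and $a\in U^*$ the limit defining $M_2(t)a$ exists in $L^2(\Omega,\mathcal F,P)$. (ii) There exist a real Hilbert space $H$ with an orthonormal basis $(e_k)_{k\in\mathbb N}$, a bounded linear operator $F:H\to U$, and square integrable, pairwise uncorrelated real càdlàg Lévy processes $(m_k)_{k\in\mathbb N}$ (that is, $\operatorname{Cov}(m_k(s),m_l(t))=0$ for all $s,t\ge0$ and $k\ne l$) such that $$M_2(t)a=\sum_{k}\langle Fe_k,a\rangle\,m_k(t)\quad\text{in }L^2(\Omega,\mathcal F,P)\text{, unconditionally, for all }t\ge 0,\ a\in U^*.\qquad(*)$$ (iii) Let $H_{Q_2}$ be the reproducing kernel Hilbert space of $Q_2$: the Hilbert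 space continuously embedded in $U$ by an injection $i:H_{Q_2}\to U$ that contains $Q_2(U^*)$ as a dense subset and satisfies $[Q_2a,Q_2b]_{H_{Q_2}}=\langle Q_2a,b\rangle$. This space exists, and it has a countable (finite or infinite) orthonormal basis $(e_k)_k$ of the form $i e_k=Q_2a_k$ with $a_k\in U^*$, such that there are square integrable, pairwise uncorrelated real càdlàg Lévy processes $m_k$ with $m_k(t)=M_2(t)a_k$ a.s. for every $t\ge0$ and $(*)$ holds with $F=i$. -/

import Mathlib

open MeasureTheory ProbabilityTheory Filter Topology
open scoped NNReal ENNReal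

universe u v

namespace CylLevy

noncomputable section

/-- Right-continuous with left limits at every time `t ≥ 0` (no condition from the left at `0`,
where `𝓝[<] 0 = ⊥`). -/
def IsCadlag (f : ℝ≥0 → ℝ) : Prop :=
  ∀ t, ContinuousWithinAt f (Set.Ici t) t ∧ ∃ l, Tendsto f (𝓝[<] t) (𝓝 l)

/-- Lévy process: starts at zero almost surely, has independent and stationary increments, and is
stochastically continuous. No path regularity is part of the definition. -/
structure IsLevyProcess {Ω : Type*} [MeasurableSpace Ω] (P : Measure Ω) {E : Type*}
    [NormedAddCommGroup E] [MeasurableSpace E] (X : ℝ≥0 → Ω → E) : Prop where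
  aemeasurable : ∀ t, AEMeasurable (X t) P
  zero : ∀ᵐ ω ∂P, X 0 ω = 0
  indep : HasIndepIncrements X P
  stationary : ∀ s h, IdentDistrib (X (s + h) - X s) (X h - X 0) P P
  stochCont : ∀ t, TendstoInMeasure P X (𝓝 t) (X t)

/-! ### Cylindrical processes -/

section Cylindrical

variable {Ω : Type v} {mΩ : MeasurableSpace Ω} {U : Type u} [NormedAddCommGroup U]
  [NormedSpace ℝ U]

/-- A cylindrical process, given by representatives `L t a : Ω → ℝ` of the random variables: for
every `t`, the map `a ↦ [L t a]` is a linear map from the dual of `U` to `L⁰(Ω, P)`. -/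
structure IsCylindricalProcess (P : Measure Ω) (L : ℝ≥0 → StrongDual ℝ U → Ω → ℝ) : Prop where
  aemeasurable : ∀ t a, AEMeasurable (L t a) P
  map_add : ∀ t a b, L t (a + b) =ᵐ[P] L t a + L t b
  map_smul : ∀ t (c : ℝ) a, L t (c • a) =ᵐ[P] c • L t a

/-- Weakly cylindrical Lévy process: a cylindrical process adapted to `𝓕` all of whose
finite-dimensional projections are Lévy processes in `ℝⁿ`. -/
structure IsWeaklyCylindricalLevyProcess (P : Measure Ω) (𝓕 : Filtration ℝ≥0 mΩ)
    (L : ℝ≥0 → StrongDual ℝ U → Ω → ℝ) : Prop extends IsCylindricalProcess P L where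
  adapted : ∀ t a, AEStronglyMeasurable[𝓕 t] (L t a) P
  levy : ∀ (n : ℕ) (a : Fin n → StrongDual ℝ U),
    IsLevyProcess P (fun t ω (i : Fin n) => L t (a i) ω)

/-- Weakly càdlàg: for each `a`, almost all paths of `L(·)a` are càdlàg. -/
def IsWeaklyCadlag (P : Measure Ω) (L : ℝ≥0 → StrongDual ℝ U → Ω → ℝ) : Prop :=
  ∀ a, ∀ᵐ ω ∂P, IsCadlag (fun t => L t a ω)

/-- Weak order `2`: `E |L(t)a|² < ∞` for all `t` and `a`. -/
def IsWeakOrderTwo (P : Measure Ω) (L : ℝ≥0 → StrongDual ℝ U → Ω → ℝ) : Prop :=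
  ∀ t a, MemLp (L t a) 2 P

end Cylindrical

/-! ### Jumps and the compensated Poisson integral of a real process -/

/-- The jump `Δf(s) = f(s) - f(s-)`; it is `0` at `s = 0`. -/
def jump (f : ℝ≥0 → ℝ) (s : ℝ≥0) : ℝ := f s - Function.leftLim f s

/-- The counting measure `N(t, ·)` of the nonzero jumps of the path `f` during `[0, t]`:
`N(t, B) = ∑_{0 ≤ s ≤ t} 1_B(Δf(s))` for `B ⊆ ℝ ∖ {0}`, and `N(t, {0}) = 0`. -/
def jumpMeasure (f : ℝ≥0 → ℝ) (t : ℝ≥0) : Measure ℝ :=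
  Measure.sum fun s : {s : ℝ≥0 // s ≤ t ∧ jump f s ≠ 0} => Measure.dirac (jump f s)

section Jumps

variable {Ω : Type v} [MeasurableSpace Ω]

/-- The Lévy measure `ν(B) = E[N(1, B)]`. -/
def levyMeasure (P : Measure Ω) (X : ℝ≥0 → Ω → ℝ) : Measure ℝ :=
  P.bind fun ω => jumpMeasure (fun s => X s ω) 1

/-- `∫_{|β| > ε} β Ñ(t, dβ)`, where `Ñ(t, dβ) = N(t, dβ) - t ν(dβ)`. -/
def truncatedJumpIntegral (P : Measure Ω) (X : ℝ≥0 → Ω → ℝ) (ε : ℝ) (t : ℝ≥0) (ω : Ω) : ℝ :=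
  (∫ β in {β : ℝ | ε < |β|}, β ∂(jumpMeasure (fun s => X s ω) t))
    - t * ∫ β in {β : ℝ | ε < |β|}, β ∂(levyMeasure P X)

/-- `Y = ∫_{ℝ∖{0}} β Ñ(t, dβ)`: `Y` is the limit in `L²(Ω, P)`, as `ε ↓ 0`, of the integrals over
`{|β| > ε}`. -/
def IsCompensatedJumpIntegral (P : Measure Ω) (X : ℝ≥0 → Ω → ℝ) (t : ℝ≥0) (Y : Lp ℝ 2 P) : Prop :=
  Tendsto (fun ε : ℝ => eLpNorm (fun ω => truncatedJumpIntegral P X ε t ω - Y ω) 2 P)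
    (𝓝[>] 0) (𝓝 0)

open Classical in
/-- The element `∫_{ℝ∖{0}} β Ñ(t, dβ)` of `L²(Ω, P)` (and `0` if the `L²`-limit did not exist). -/
def compensatedJumpIntegral (P : Measure Ω) (X : ℝ≥0 → Ω → ℝ) (t : ℝ≥0) : Lp ℝ 2 P :=
  if h : ∃ Y, IsCompensatedJumpIntegral P X t Y then h.choose else 0

variable {U : Type u} [NormedAddCommGroup U] [NormedSpace ℝ U]

/-- `M₂(t)a = ∫_{ℝ∖{0}} β Ñ_a(t, dβ)`, where `Ñ_a` is built from the jumps of `L(·)a`. -/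
def M₂ (P : Measure Ω) (L : ℝ≥0 → StrongDual ℝ U → Ω → ℝ) (t : ℝ≥0) (a : StrongDual ℝ U) :
    Lp ℝ 2 P :=
  compensatedJumpIntegral P (fun s => L s a) t

/-- `Q : U* → U` is the covariance operator of `M₂`: `⟨Qa, b⟩ = E[(M₂(1)a)(M₂(1)b)]`. The process
`M₂` is strong when such a `U`-valued `Q` exists. -/
def IsCovarianceOperator (P : Measure Ω) (L : ℝ≥0 → StrongDual ℝ U → Ω → ℝ)
    (Q : StrongDual ℝ U → U) : Prop :=
  ∀ a b : StrongDual ℝ U, b (Q a) = ∫ ω, M₂ P L 1 a ω * M₂ P L 1 b ω ∂P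

/-- `M₂` is strong: its covariance operator maps `U*` to `U`. -/
def IsStrong (P : Measure Ω) (L : ℝ≥0 → StrongDual ℝ U → Ω → ℝ) : Prop :=
  ∃ Q : StrongDual ℝ U → U, IsCovarianceOperator P L Q

/-- `H`, embedded in `U` by `i`, is the reproducing kernel Hilbert space of `Q`: a Hilbert subspace
of `U` that contains `Q(U*)` as a dense subset and satisfies `[Qa, Qb]_H = ⟨Qa, b⟩`. -/
structure IsReproducingKernelHilbertSpace {H : Type*} [NormedAddCommGroup H]
    [InnerProductSpace ℝ H] [CompleteSpace H] (Q : StrongDual ℝ U → U) (i : H →L[ℝ] U) : Prop where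
  injective : Function.Injective i
  range_subset : ∀ a, ∃ h, i h = Q a
  dense : Dense {h : H | ∃ a, i h = Q a}
  inner_eq : ∀ (a b : StrongDual ℝ U) (h k : H), i h = Q a → i k = Q b → inner ℝ h k = b (Q a)

/-- The `m k` are pairwise uncorrelated square integrable real càdlàg Lévy processes with
`M₂(t)a = ∑ₖ ⟨F eₖ, a⟩ mₖ(t)` in `L²(Ω, P)` for all `t` and `a` (unconditionally, in particular
along the partial sums of an enumeration). -/
structure IsSeriesRepresentation {ι H : Type*} [NormedAddCommGroup H] [InnerProductSpace ℝ H]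
    (P : Measure Ω) (L : ℝ≥0 → StrongDual ℝ U → Ω → ℝ) (e : HilbertBasis ι ℝ H)
    (F : H →L[ℝ] U) (m : ι → ℝ≥0 → Ω → ℝ) : Prop where
  levy : ∀ k, IsLevyProcess P (m k)
  cadlag : ∀ k ω, IsCadlag (fun t => m k t ω)
  memLp : ∀ k t, MemLp (m k t) 2 P
  uncorrelated : ∀ k l, k ≠ l → ∀ s t, cov[m k s, m l t; P] = 0
  hasSum : ∀ (t : ℝ≥0) (a : StrongDual ℝ U),
    HasSum (fun k => a (F (e k)) • (memLp k t).toLp (m k t)) (M₂ P L t a)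

end Jumps

end

end CylLevy

open CylLevy

/-!
Finitely many coordinates `L(·)a₁, …, L(·)aₙ` have a common measurable càdlàg version `Z` with
values in Euclidean space. For a continuous `g` vanishing near `0`, the jump sums
`∑_{s < r ≤ t} g(ΔZ(r))` are limits of sums of `g` over the increments of `Z` along fine grids. They
therefore inherit measurability, stationarity and independence over disjoint intervals, and their
variance is at most `E ∑ g(ΔZ(r))²`; the energy bound for `E ∑ ‖ΔZ(r)‖²` makes everything
integrable. Hence the compensated jump sums over `|β| > ε` are Cauchy in `L²` as `ε ↓ 0`. Their
limit `M₂(t)a` is linear in `a`, is a centred process with stationary uncorrelated increments, and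
by Doob's maximal inequality it has a càdlàg version.

It follows that `E[(M₂(s)a)(M₂(t)b)] = min(s, t) ⟨Q₂a, b⟩`, so everything about the expansion is
decided at time `1`. There `a ↦ M₂(1)a` factorizes `Q₂` through the closure `H` of its range, and
the adjoint of `U* → H` embeds `H` in `U` because `Q₂` takes values in `U`. This is the reproducing
kernel Hilbert space. Since `U` is separable, Gram–Schmidt yields a countable orthonormal basis of
`H` consisting of images of functionals `aₖ`, and Fourier expansion in this basis is the series.
-/

namespace CylLevy

/-! ### Jumps of càdlàg paths -/

section Paths

variable {E : Type*} [NormedAddCommGroup E] {f : ℝ≥0 → E} {s t : ℝ≥0}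

/-- Càdlàg paths in a normed space; for `E = ℝ` this unfolds to `IsCadlag`. -/
def IsCadlagPath (f : ℝ≥0 → E) : Prop :=
  ∀ t, ContinuousWithinAt f (Set.Ici t) t ∧ ∃ l, Tendsto f (𝓝[<] t) (𝓝 l)

/-- The jump `f(r) - f(r-)` of a path in a normed space, equal to `0` at `r = 0`; for `E = ℝ` this
unfolds to `jump`. -/
noncomputable def pathJump (f : ℝ≥0 → E) (r : ℝ≥0) : E := f r - Function.leftLim f r

/-- The sum of `g` over the jumps of `f` during `(s, t]`. It is meant for functions `g` that vanish
near `0`, for which only finitely many terms are nonzero. -/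
noncomputable def jumpSum (g : E → ℝ) (f : ℝ≥0 → E) (s t : ℝ≥0) : ℝ :=
  ∑' r, (Set.Ioc s t).indicator (fun r => g (pathJump f r)) r

/-- The points of the uniform partition of `[s, t]` into `n` intervals. -/
noncomputable def grid (s t : ℝ≥0) (n i : ℕ) : ℝ≥0 := s + (i / n) * (t - s)

/-- The sum of `g` over the increments of `f` along the uniform partition of `[s, t]` into `n`
intervals. -/
noncomputable def gridSum (g : E → ℝ) (f : ℝ≥0 → E) (s t : ℝ≥0) (n : ℕ) : ℝ :=
  ∑ i ∈ Finset.range n, g (f (grid s t n (i + 1)) - f (grid s t n i))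

lemma leftLim_zero (f : ℝ≥0 → E) : Function.leftLim f 0 = f 0 := leftLim_eq_of_isBot isBot_bot

lemma pathJump_zero (f : ℝ≥0 → E) : pathJump f 0 = 0 := by rw [pathJump, leftLim_zero, sub_self]

lemma IsCadlagPath.tendsto_nhdsGE (hf : IsCadlagPath f) (r : ℝ≥0) :
    Tendsto f (𝓝[≥] r) (𝓝 (f r)) :=
  (hf r).1

lemma IsCadlagPath.tendsto_nhdsLT (hf : IsCadlagPath f) (r : ℝ≥0) :
    Tendsto f (𝓝[<] r) (𝓝 (Function.leftLim f r)) :=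
  tendsto_leftLim_of_tendsto (hf r).2

lemma IsCadlagPath.tendsto_sub_pathJump (hf : IsCadlagPath f) {r : ℝ≥0} {α : Type*} {l : Filter α}
    {u v : α → ℝ≥0} (hu : Tendsto u l (𝓝[<] r)) (hv : Tendsto v l (𝓝[≥] r)) :
    Tendsto (fun x => f (v x) - f (u x)) l (𝓝 (pathJump f r)) :=
  ((hf.tendsto_nhdsGE r).comp hv).sub ((hf.tendsto_nhdsLT r).comp hu)

lemma IsCadlagPath.leftLim_mem (hf : IsCadlagPath f) {C : Set E} (hC : IsClosed C) {u : ℝ≥0}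
    (h : ∀ᶠ v in 𝓝 u, f v ∈ C) : Function.leftLim f u ∈ C := by
  rcases eq_or_ne u 0 with rfl | hu
  · simpa only [leftLim_zero] using h.self_of_nhds
  · have : (𝓝[<] u).NeBot := nhdsLT_neBot_of_exists_lt ⟨0, pos_iff_ne_zero.2 hu⟩
    exact hC.mem_of_tendsto (hf.tendsto_nhdsLT u) (h.filter_mono nhdsWithin_le_nhds)

lemma IsCadlagPath.tendsto_leftLim (hf : IsCadlagPath f) {S : Set ℝ≥0} (hS : IsOpen S) {x : ℝ≥0}
    {y : E} (h : Tendsto f (𝓝[S] x) (𝓝 y)) : Tendsto (Function.leftLim f) (𝓝[S] x) (𝓝 y) := by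
  refine (closed_nhds_basis y).tendsto_right_iff.2 fun C ⟨hCy, hC⟩ => ?_
  filter_upwards [eventually_eventually_nhdsWithin.2 (h.eventually hCy), self_mem_nhdsWithin]
    with u hu huS
  exact hf.leftLim_mem hC (hS.nhdsWithin_eq huS ▸ hu)

lemma IsCadlagPath.tendsto_pathJump_nhdsNE (hf : IsCadlagPath f) (x : ℝ≥0) :
    Tendsto (pathJump f) (𝓝[≠] x) (𝓝 0) := by
  have one_sided {S : Set ℝ≥0} (hS : IsOpen S) {y : E} (h : Tendsto f (𝓝[S] x) (𝓝 y)) :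
      Tendsto (pathJump f) (𝓝[S] x) (𝓝 0) := by
    have := h.sub (hf.tendsto_leftLim hS h)
    rwa [sub_self] at this
  rw [← nhdsLT_sup_nhdsGT, tendsto_sup]
  exact ⟨one_sided isOpen_Iio (hf.tendsto_nhdsLT x), one_sided isOpen_Ioi
    ((hf.tendsto_nhdsGE x).mono_left (nhdsWithin_mono x Set.Ioi_subset_Ici_self))⟩

lemma IsCadlagPath.finite_setOf_pathJump_notMem (hf : IsCadlagPath f) {V : Set E}
    (hV : V ∈ 𝓝 (0 : E)) (s t : ℝ≥0) : {r ∈ Set.Ioc s t | pathJump f r ∉ V}.Finite := by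
  by_contra hinf
  obtain ⟨x, -, hx⟩ := Set.Infinite.exists_accPt_of_subset_isCompact hinf
    (isCompact_Icc (a := s) (b := t)) fun r hr => Set.Ioc_subset_Icc_self hr.1
  refine accPt_iff_frequently_nhdsNE.1 hx ?_
  filter_upwards [(hf.tendsto_pathJump_nhdsNE x).eventually hV] with r hr hr' using hr'.2 hr

lemma jumpSum_eq_sum {g : E → ℝ} {R : Finset ℝ≥0} (hR : ↑R ⊆ Set.Ioc s t)
    (h : ∀ r ∈ Set.Ioc s t, r ∉ R → g (pathJump f r) = 0) :
    jumpSum g f s t = ∑ r ∈ R, g (pathJump f r) := by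
  have hzero (r : ℝ≥0) (hr : r ∉ R) : (Set.Ioc s t).indicator (fun r => g (pathJump f r)) r = 0 :=
    Set.indicator_apply_eq_zero.2 fun hr' => h r hr' hr
  rw [jumpSum, tsum_eq_sum hzero]
  exact Finset.sum_congr rfl fun r hr => Set.indicator_of_mem (hR hr) _

lemma IsCadlagPath.exists_finset_pathJump_mem (hf : IsCadlagPath f) {V : Set E}
    (hV : V ∈ 𝓝 (0 : E)) (s t : ℝ≥0) :
    ∃ R : Finset ℝ≥0, ↑R ⊆ Set.Ioc s t ∧ ∀ r ∈ Set.Ioc s t, r ∉ R → pathJump f r ∈ V := by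
  have hfin := hf.finite_setOf_pathJump_notMem hV s t
  refine ⟨hfin.toFinset, fun r hr => (hfin.mem_toFinset.1 hr).1, fun r hr hrR => ?_⟩
  by_contra hrV
  exact hrR (hfin.mem_toFinset.2 ⟨hr, hrV⟩)

/-- Otherwise a jump of norm greater than `ε / 2` lies between `u` and `v`. -/
lemma IsCadlagPath.exists_mesh (hf : IsCadlagPath f) {ε : ℝ} (hε : 0 < ε) (s t : ℝ≥0) :
    ∃ δ > 0, ∀ u v, s ≤ u → u ≤ v → v ≤ t → dist v u < δ →
      (∀ r ∈ Set.Ioc u v, ‖pathJump f r‖ ≤ ε / 2) → ‖f v - f u‖ ≤ ε := by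
  have near (r : ℝ≥0) : ∃ W, r ∈ W ∧ IsOpen W ∧ (∀ u ∈ W, r ≤ u → dist (f u) (f r) < ε / 4) ∧
      ∀ u ∈ W, u < r → dist (f u) (Function.leftLim f r) < ε / 4 := by
    have hright := eventually_nhdsWithin_iff.1
      (Metric.tendsto_nhds.1 (hf.tendsto_nhdsGE r) (ε / 4) (by positivity))
    have hleft := eventually_nhdsWithin_iff.1
      (Metric.tendsto_nhds.1 (hf.tendsto_nhdsLT r) (ε / 4) (by positivity))
    obtain ⟨W, hW, hWo, hrW⟩ := eventually_nhds_iff.1 (hright.and hleft)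
    exact ⟨W, hrW, hWo, fun u hu => (hW u hu).1, fun u hu => (hW u hu).2⟩
  choose W hrW hWo hright hleft using near
  obtain ⟨δ, hδ, hsub⟩ := lebesgue_number_lemma_of_metric (isCompact_Icc (a := s) (b := t))
    hWo fun r _ => Set.mem_iUnion.2 ⟨r, hrW r⟩
  refine ⟨δ, hδ, fun u v hsu huv hvt hd hjump => ?_⟩
  obtain ⟨r, hr⟩ := hsub u ⟨hsu, huv.trans hvt⟩
  have hu : u ∈ W r := hr (Metric.mem_ball_self hδ)
  have hv : v ∈ W r := hr hd
  rw [← dist_eq_norm]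
  rcases le_or_gt r u with hru | hur
  · linarith [dist_triangle_right (f v) (f u) (f r), hright r u hu hru,
      hright r v hv (hru.trans huv)]
  rcases lt_or_ge v r with hvr | hrv
  · linarith [dist_triangle_right (f v) (f u) (Function.leftLim f r), hleft r u hu hur,
      hleft r v hv hvr]
  · have hJ : dist (f r) (Function.leftLim f r) ≤ ε / 2 := by
      simpa only [dist_eq_norm, pathJump] using hjump r ⟨hur, hrv⟩
    linarith [dist_triangle4_right (f v) (f u) (f r) (Function.leftLim f r), hleft r u hu hur,
      hright r v hv hrv]

end Paths

section Grid

variable {s t : ℝ≥0}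

lemma grid_zero (s t : ℝ≥0) (n : ℕ) : grid s t n 0 = s := by simp [grid]

lemma grid_self (h : s ≤ t) {n : ℕ} (hn : n ≠ 0) : grid s t n n = t := by
  rw [grid, div_self (Nat.cast_ne_zero.2 hn), one_mul, add_tsub_cancel_of_le h]

lemma grid_succ (s t : ℝ≥0) (n i : ℕ) : grid s t n (i + 1) = grid s t n i + (t - s) / n := by
  simp only [grid]; push_cast; ring

lemma grid_mono (s t : ℝ≥0) (n : ℕ) : Monotone (grid s t n) :=
  monotone_nat_of_le_succ fun i => by rw [grid_succ]; exact le_self_add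

lemma dist_grid_succ (s t : ℝ≥0) (n i : ℕ) :
    dist (grid s t n (i + 1)) (grid s t n i) = (t - s : ℝ≥0) / n := by
  rw [grid_succ, NNReal.dist_eq, NNReal.coe_add, add_sub_cancel_left, NNReal.abs_eq,
    NNReal.coe_div, NNReal.coe_natCast]

lemma exists_mem_Ioc_grid (h : s ≤ t) {n : ℕ} (hn : n ≠ 0) {r : ℝ≥0} (hr : r ∈ Set.Ioc s t) :
    ∃ i < n, r ∈ Set.Ioc (grid s t n i) (grid s t n (i + 1)) := by
  have hunion := (grid_mono s t n).biUnion_Ico_Ioc_map_succ 0 n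
  rw [grid_zero, grid_self h hn] at hunion
  obtain ⟨i, hi, hri⟩ := Set.mem_iUnion₂.1 (hunion ▸ hr)
  exact ⟨i, hi.2, hri⟩

lemma eq_of_mem_Ioc_grid {n i j : ℕ} {r : ℝ≥0}
    (hi : r ∈ Set.Ioc (grid s t n i) (grid s t n (i + 1)))
    (hj : r ∈ Set.Ioc (grid s t n j) (grid s t n (j + 1))) : i = j := by
  by_contra hij
  exact Set.disjoint_left.1 ((grid_mono s t n).pairwise_disjoint_on_Ioc_succ hij) hi hj

lemma tendsto_mesh (s t : ℝ≥0) :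
    Tendsto (fun n : ℕ => ((t - s : ℝ≥0) : ℝ) / n) atTop (𝓝 0) :=
  tendsto_const_div_atTop_nhds_zero_nat _

variable {r : ℝ≥0} {k : ℕ → ℕ}

lemma tendsto_grid_nhdsLT
    (hk : ∀ᶠ n in atTop, r ∈ Set.Ioc (grid s t n (k n)) (grid s t n (k n + 1))) :
    Tendsto (fun n => grid s t n (k n)) atTop (𝓝[<] r) := by
  refine tendsto_nhdsWithin_iff.2 ⟨?_, hk.mono fun n hn => hn.1⟩
  refine tendsto_iff_dist_tendsto_zero.2 (squeeze_zero' (by simp) ?_ (tendsto_mesh s t))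
  filter_upwards [hk] with n hn
  rw [← dist_grid_succ s t n (k n), dist_comm (grid s t n (k n + 1))]
  exact Real.dist_left_le_of_mem_uIcc
    (Set.mem_uIcc_of_le (NNReal.coe_le_coe.2 hn.1.le) (NNReal.coe_le_coe.2 hn.2))

lemma tendsto_grid_succ_nhdsGE
    (hk : ∀ᶠ n in atTop, r ∈ Set.Ioc (grid s t n (k n)) (grid s t n (k n + 1))) :
    Tendsto (fun n => grid s t n (k n + 1)) atTop (𝓝[≥] r) := by
  refine tendsto_nhdsWithin_iff.2 ⟨?_, hk.mono fun n hn => hn.2⟩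
  refine tendsto_iff_dist_tendsto_zero.2 (squeeze_zero' (by simp) ?_ (tendsto_mesh s t))
  filter_upwards [hk] with n hn
  rw [← dist_grid_succ s t n (k n), dist_comm, dist_comm (grid _ _ _ (k n + 1))]
  exact Real.dist_right_le_of_mem_uIcc
    (Set.mem_uIcc_of_le (NNReal.coe_le_coe.2 hn.1.le) (NNReal.coe_le_coe.2 hn.2))

lemma exists_gridIndex (h : s ≤ t) : ∃ k : ℕ → ℝ≥0 → ℕ, ∀ n ≠ 0, ∀ r ∈ Set.Ioc s t,
    k n r < n ∧ r ∈ Set.Ioc (grid s t n (k n r)) (grid s t n (k n r + 1)) := by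
  have hex (n : ℕ) (hn : n ≠ 0) (r : ℝ≥0) (hr : r ∈ Set.Ioc s t) := exists_mem_Ioc_grid h hn hr
  choose! k hk using hex
  exact ⟨k, hk⟩

lemma eventually_injOn_gridIndex {k : ℕ → ℝ≥0 → ℕ} {R : Finset ℝ≥0}
    (hk : ∀ r ∈ R, ∀ᶠ n in atTop, r ∈ Set.Ioc (grid s t n (k n r)) (grid s t n (k n r + 1))) :
    ∀ᶠ n in atTop, Set.InjOn (k n) R := by
  have hsep : ∀ᶠ n in atTop, ∀ r ∈ R, ∀ r' ∈ R, r < r' → grid s t n (k n r + 1) < r' := by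
    simp only [eventually_all_finset, eventually_imp_distrib_left]
    intro r hr r' _ hrr'
    exact ((tendsto_grid_succ_nhdsGE (hk r hr)).mono_right nhdsWithin_le_nhds).eventually_lt_const
      hrr'
  filter_upwards [hsep, (eventually_all_finset R).2 hk] with n hn hkn r hr r' hr' he
  rcases lt_trichotomy r r' with h | h | h
  · exact absurd (hn r hr r' hr' h) (not_lt.2 (he ▸ (hkn r' hr').2))
  · exact h
  · exact absurd (hn r' hr' r hr h) (not_lt.2 (he ▸ (hkn r hr).2))

end Grid

section GridSum

variable {E : Type*} [NormedAddCommGroup E] {f : ℝ≥0 → E} {g : E → ℝ} {s t : ℝ≥0}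

lemma IsCadlagPath.tendsto_sum_gridIndex (hf : IsCadlagPath f) (hg : Continuous g)
    {k : ℕ → ℝ≥0 → ℕ} {R : Finset ℝ≥0}
    (hk : ∀ r ∈ R, ∀ᶠ n in atTop, r ∈ Set.Ioc (grid s t n (k n r)) (grid s t n (k n r + 1))) :
    Tendsto (fun n => ∑ r ∈ R, g (f (grid s t n (k n r + 1)) - f (grid s t n (k n r)))) atTop
      (𝓝 (∑ r ∈ R, g (pathJump f r))) :=
  tendsto_finsetSum R fun r hr => (hg.tendsto _).comp <|
    hf.tendsto_sub_pathJump (tendsto_grid_nhdsLT (hk r hr)) (tendsto_grid_succ_nhdsGE (hk r hr))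

lemma IsCadlagPath.tendsto_gridSum (hf : IsCadlagPath f) (hg : Continuous g)
    (hg0 : ∀ᶠ x in 𝓝 0, g x = 0) (hst : s ≤ t) :
    Tendsto (gridSum g f s t) atTop (𝓝 (jumpSum g f s t)) := by
  obtain ⟨ε, hε, hball⟩ := Metric.nhds_basis_closedBall.eventually_iff.1 hg0
  have hgε (x : E) (hx : ‖x‖ ≤ ε) : g x = 0 := hball (mem_closedBall_zero_iff.2 hx)
  obtain ⟨R, hRsub, hR⟩ := hf.exists_finset_pathJump_mem
    (Metric.closedBall_mem_nhds 0 (half_pos hε)) s t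
  simp only [mem_closedBall_zero_iff] at hR
  obtain ⟨k, hk⟩ := exists_gridIndex hst
  have hkR (r : ℝ≥0) (hr : r ∈ R) :
      ∀ᶠ n in atTop, r ∈ Set.Ioc (grid s t n (k n r)) (grid s t n (k n r + 1)) :=
    (eventually_ne_atTop 0).mono fun n hn => (hk n hn r (hRsub hr)).2
  obtain ⟨δ, hδ, hmesh⟩ := hf.exists_mesh hε s t
  rw [jumpSum_eq_sum hRsub fun r hr hrR => hgε _ ((hR r hr hrR).trans (half_le_self hε.le))]
  refine (hf.tendsto_sum_gridIndex hg hkR).congr' ?_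
  filter_upwards [eventually_injOn_gridIndex hkR, (tendsto_mesh s t).eventually_lt_const hδ,
    eventually_ne_atTop 0] with n hinj hnδ hn
  refine Finset.sum_of_injOn (k n) hinj
    (fun r hr => Finset.mem_coe.2 (Finset.mem_range.2 (hk n hn r (hRsub hr)).1)) ?_ fun _ _ => rfl
  intro i hi hik
  have hst' : s ≤ grid s t n i ∧ grid s t n (i + 1) ≤ t :=
    ⟨(grid_zero s t n).ge.trans (grid_mono s t n i.zero_le),
      (grid_mono s t n (Finset.mem_range.1 hi)).trans (grid_self hst hn).le⟩
  refine hgε _ (hmesh _ _ hst'.1 (grid_mono s t n i.le_succ) hst'.2 ?_ fun r hr => ?_)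
  · rwa [dist_grid_succ]
  · have hrst : r ∈ Set.Ioc s t := ⟨hst'.1.trans_lt hr.1, hr.2.trans hst'.2⟩
    exact hR r hrst fun hrR => hik ⟨r, hrR, eq_of_mem_Ioc_grid (hk n hn r hrst).2 hr⟩

end GridSum

/-! ### Almost sure limits of random variables -/

section Limits

variable {Ω : Type*} {mΩ : MeasurableSpace Ω} {P : Measure Ω}

lemma iIndepFun_curry {ι : Type*} {κ : ι → Type*} {𝓧 : (i : ι) → κ i → Type*}
    {m𝓧 : ∀ i j, MeasurableSpace (𝓧 i j)} {X : (i : ι) → (j : κ i) → Ω → 𝓧 i j}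
    (hX : ∀ i j, Measurable (X i j)) (h : iIndepFun (fun (p : (i : ι) × κ i) => X p.1 p.2) P) :
    iIndepFun (fun i ω j => X i j ω) P := by
  have := h.isProbabilityMeasure
  have (i : ι) (j : κ i) : IsProbabilityMeasure (P.map (X i j)) :=
    Measure.isProbabilityMeasure_map (hX i j).aemeasurable
  have hcurry : MeasurableEquiv.piCurry 𝓧 ∘ (fun ω p => X p.1 p.2 ω) = fun ω i j => X i j ω := rfl
  have hrow (i : ι) : iIndepFun (X i) P :=
    h.precomp (g := fun j : κ i => (⟨i, j⟩ : (i : ι) × κ i)) sigma_mk_injective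
  rw [iIndepFun_iff_map_fun_eq_infinitePi_map (by fun_prop), ← hcurry,
    ← Measure.map_map (by fun_prop) (by fun_prop),
    (iIndepFun_iff_map_fun_eq_infinitePi_map (by fun_prop)).1 h,
    Measure.infinitePi_map_piCurry fun i j => P.map (X i j)]
  congrm Measure.infinitePi fun i => ?_
  exact ((iIndepFun_iff_map_fun_eq_infinitePi_map (hX i)).1 (hrow i)).symm

lemma identDistrib_of_tendsto_ae {E : Type*} [TopologicalSpace E]
    [TopologicalSpace.PseudoMetrizableSpace E] [MeasurableSpace E] [BorelSpace E]
    [IsProbabilityMeasure P] {Y Y' : ℕ → Ω → E} {Z Z' : Ω → E}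
    (hid : ∀ n, IdentDistrib (Y n) (Y' n) P P)
    (h : ∀ᵐ ω ∂P, Tendsto (fun n => Y n ω) atTop (𝓝 (Z ω)))
    (h' : ∀ᵐ ω ∂P, Tendsto (fun n => Y' n ω) atTop (𝓝 (Z' ω))) : IdentDistrib Z Z' P P := by
  have hY (n : ℕ) := (hid n).aemeasurable_fst
  have hY' (n : ℕ) := (hid n).aemeasurable_snd
  have hZ := aemeasurable_of_tendsto_metrizable_ae' hY h
  have hZ' := aemeasurable_of_tendsto_metrizable_ae' hY' h'
  have hlim := tendstoInDistribution_of_ae_tendsto hY hZ h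
  have hlim' := (tendstoInDistribution_of_ae_tendsto hY' hZ' h').tendsto
  refine ⟨hZ, hZ', tendstoInDistribution_unique Y hlim ⟨hY, hZ', hlim'.congr fun n => ?_⟩⟩
  exact Subtype.ext (hid n).map_eq.symm

lemma tendsto_charFun_map_of_tendsto_ae {E : Type*} [NormedAddCommGroup E] [InnerProductSpace ℝ E]
    [FiniteDimensional ℝ E] [MeasurableSpace E] [BorelSpace E] [IsProbabilityMeasure P]
    {Y : ℕ → Ω → E} {Z : Ω → E} (hY : ∀ n, AEMeasurable (Y n) P)
    (h : ∀ᵐ ω ∂P, Tendsto (fun n => Y n ω) atTop (𝓝 (Z ω))) (t : E) :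
    Tendsto (fun n => charFun (P.map (Y n)) t) atTop (𝓝 (charFun (P.map Z) t)) :=
  ProbabilityMeasure.tendsto_iff_tendsto_charFun.1 (tendstoInDistribution_of_ae_tendsto hY
    (aemeasurable_of_tendsto_metrizable_ae' hY h) h).tendsto t

lemma iIndepFun_of_tendsto_ae_of_finite {ι : Type*} [Finite ι] {Y : ℕ → ι → Ω → ℝ}
    {Z : ι → Ω → ℝ} (hY : ∀ n i, AEMeasurable (Y n i) P) (hind : ∀ n, iIndepFun (Y n) P)
    (h : ∀ i, ∀ᵐ ω ∂P, Tendsto (fun n => Y n i ω) atTop (𝓝 (Z i ω))) : iIndepFun Z P := by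
  have := (hind 0).isProbabilityMeasure
  have := Fintype.ofFinite ι
  have hZ (i : ι) : AEMeasurable (Z i) P :=
    aemeasurable_of_tendsto_metrizable_ae' (fun n => hY n i) (h i)
  rw [iIndepFun_iff_charFun_pi hZ]
  intro t
  have hjoint : Tendsto (fun n => charFun (P.map fun ω => WithLp.toLp 2 (Y n · ω)) t) atTop
      (𝓝 (charFun (P.map fun ω => WithLp.toLp 2 (Z · ω)) t)) := by
    refine tendsto_charFun_map_of_tendsto_ae (fun n => by fun_prop) ?_ t
    filter_upwards [ae_all_iff.2 h] with ω hω
    exact ((PiLp.continuous_toLp 2 _).tendsto _).comp (tendsto_pi_nhds.2 hω)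
  have hprod : Tendsto (fun n => ∏ i, charFun (P.map (Y n i)) (t i)) atTop
      (𝓝 (∏ i, charFun (P.map (Z i)) (t i))) :=
    tendsto_finsetProd _ fun i _ => tendsto_charFun_map_of_tendsto_ae (fun n => hY n i) (h i) _
  exact tendsto_nhds_unique hjoint
    (hprod.congr fun n => ((iIndepFun_iff_charFun_pi (hY n)).1 (hind n) t).symm)

lemma iIndepFun_of_tendsto_ae {ι : Type*} {Y : ℕ → ι → Ω → ℝ} {Z : ι → Ω → ℝ}
    (hY : ∀ n i, AEMeasurable (Y n i) P) (hind : ∀ n, iIndepFun (Y n) P)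
    (h : ∀ i, ∀ᵐ ω ∂P, Tendsto (fun n => Y n i ω) atTop (𝓝 (Z i ω))) : iIndepFun Z P :=
  iIndepFun_iff_finset.2 fun s => iIndepFun_of_tendsto_ae_of_finite (Y := fun n (i : s) => Y n i)
    (fun n i => hY n i) (fun n => iIndepFun_iff_finset.1 (hind n) s) fun i => h i

lemma memLp_two_of_lintegral_sq_lt_top {Y : Ω → ℝ} (hY : AEStronglyMeasurable Y P)
    (h : ∫⁻ ω, ENNReal.ofReal (Y ω ^ 2) ∂P < ∞) : MemLp Y 2 P :=
  (memLp_two_iff_integrable_sq hY).2 ⟨hY.pow 2,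
    (hasFiniteIntegral_iff_ofReal (ae_of_all _ fun ω => sq_nonneg (Y ω))).2 h⟩

lemma ofReal_integral_sq {Y : Ω → ℝ} (hY : MemLp Y 2 P) :
    ENNReal.ofReal (∫ ω, Y ω ^ 2 ∂P) = ∫⁻ ω, ENNReal.ofReal (Y ω ^ 2) ∂P :=
  ofReal_integral_eq_lintegral_ofReal hY.integrable_sq (ae_of_all _ fun ω => sq_nonneg (Y ω))

section Fatou

variable {Y : ℕ → Ω → ℝ} {Z : Ω → ℝ} {c : ℕ → ℝ} {b : ℝ}

lemma lintegral_sq_le_of_tendsto_ae (hY : ∀ n, MemLp (Y n) 2 P)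
    (h : ∀ᵐ ω ∂P, Tendsto (fun n => Y n ω) atTop (𝓝 (Z ω)))
    (hc : ∀ n, ∫ ω, Y n ω ^ 2 ∂P ≤ c n) (hcb : Tendsto c atTop (𝓝 b)) :
    ∫⁻ ω, ENNReal.ofReal (Z ω ^ 2) ∂P ≤ ENNReal.ofReal b := calc
  ∫⁻ ω, ENNReal.ofReal (Z ω ^ 2) ∂P
      = ∫⁻ ω, liminf (fun n => ENNReal.ofReal (Y n ω ^ 2)) atTop ∂P := lintegral_congr_ae <|
        h.mono fun ω hω => (ENNReal.tendsto_ofReal (hω.pow 2)).liminf_eq.symm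
  _ ≤ liminf (fun n => ∫⁻ ω, ENNReal.ofReal (Y n ω ^ 2) ∂P) atTop :=
    lintegral_liminf_le' fun n => ((hY n).1.aemeasurable.pow_const 2).ennreal_ofReal
  _ ≤ liminf (fun n => ENNReal.ofReal (c n)) atTop := liminf_le_liminf <| .of_forall fun n =>
    (ofReal_integral_sq (hY n)).symm.trans_le (ENNReal.ofReal_le_ofReal (hc n))
  _ = ENNReal.ofReal b := (ENNReal.tendsto_ofReal hcb).liminf_eq

lemma memLp_two_of_tendsto_ae (hY : ∀ n, MemLp (Y n) 2 P)
    (h : ∀ᵐ ω ∂P, Tendsto (fun n => Y n ω) atTop (𝓝 (Z ω)))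
    (hc : ∀ n, ∫ ω, Y n ω ^ 2 ∂P ≤ c n) (hcb : Tendsto c atTop (𝓝 b)) : MemLp Z 2 P :=
  memLp_two_of_lintegral_sq_lt_top
    (aestronglyMeasurable_of_tendsto_ae atTop (fun n => (hY n).1) h)
    ((lintegral_sq_le_of_tendsto_ae hY h hc hcb).trans_lt ENNReal.ofReal_lt_top)

lemma integral_sq_le_of_tendsto_ae (hY : ∀ n, MemLp (Y n) 2 P)
    (h : ∀ᵐ ω ∂P, Tendsto (fun n => Y n ω) atTop (𝓝 (Z ω)))
    (hc : ∀ n, ∫ ω, Y n ω ^ 2 ∂P ≤ c n) (hcb : Tendsto c atTop (𝓝 b)) :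
    ∫ ω, Z ω ^ 2 ∂P ≤ b := by
  have hb : 0 ≤ b := ge_of_tendsto' hcb fun n => (integral_nonneg fun ω => sq_nonneg _).trans (hc n)
  rw [← ENNReal.ofReal_le_ofReal_iff hb, ofReal_integral_sq (memLp_two_of_tendsto_ae hY h hc hcb)]
  exact lintegral_sq_le_of_tendsto_ae hY h hc hcb

end Fatou

lemma abs_le_min_abs_add_sq_div {K : ℝ} (hK : 0 < K) (w : ℝ) : |w| ≤ min |w| K + w ^ 2 / K := by
  rcases le_total |w| K with h | h
  · rw [min_eq_left h]
    exact le_add_of_nonneg_right (by positivity)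
  · have : |w| ≤ w ^ 2 / K := by rw [le_div_iff₀ hK, ← sq_abs]; nlinarith [abs_nonneg w]
    exact this.trans (le_add_of_nonneg_left (le_min (abs_nonneg w) hK.le))

section L2Bounded

variable [IsProbabilityMeasure P] {Y : ℕ → Ω → ℝ} {Z : Ω → ℝ} {C : ℝ}

lemma tendsto_integral_abs_of_tendsto_zero_ae (hY : ∀ n, MemLp (Y n) 2 P)
    (h : ∀ᵐ ω ∂P, Tendsto (fun n => Y n ω) atTop (𝓝 0)) (hC : ∀ n, ∫ ω, Y n ω ^ 2 ∂P ≤ C) :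
    Tendsto (fun n => ∫ ω, |Y n ω| ∂P) atTop (𝓝 0) := by
  have hmin (K : ℝ) (hK : 0 < K) : Tendsto (fun n => ∫ ω, min |Y n ω| K ∂P) atTop (𝓝 0) := by
    rw [← integral_zero Ω ℝ (μ := P)]
    refine tendsto_integral_of_dominated_convergence (fun _ => K)
      (fun n => (hY n).1.norm.inf aestronglyMeasurable_const) (integrable_const K)
      (fun n => ae_of_all _ fun ω => ?_) (h.mono fun ω hω => ?_)
    · rw [Real.norm_of_nonneg (le_min (abs_nonneg _) hK.le)]
      exact min_le_right _ _
    · simpa only [abs_zero, min_eq_left hK.le] using hω.abs.min (tendsto_const_nhds (x := K))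
  have hle (K : ℝ) (hK : 0 < K) (n : ℕ) :
      ∫ ω, |Y n ω| ∂P ≤ ∫ ω, min |Y n ω| K ∂P + C / K := calc
    ∫ ω, |Y n ω| ∂P ≤ ∫ ω, (min |Y n ω| K + Y n ω ^ 2 / K) ∂P := by
      refine integral_mono ((hY n).integrable one_le_two).abs ?_ fun ω =>
        abs_le_min_abs_add_sq_div hK (Y n ω)
      exact (((hY n).integrable one_le_two).abs.inf (integrable_const K)).add
        ((hY n).integrable_sq.div_const K)
    _ = ∫ ω, min |Y n ω| K ∂P + (∫ ω, Y n ω ^ 2 ∂P) / K := by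
      rw [← integral_div]
      exact integral_add (((hY n).integrable one_le_two).abs.inf (integrable_const K))
        ((hY n).integrable_sq.div_const K)
    _ ≤ ∫ ω, min |Y n ω| K ∂P + C / K := by gcongr; exact hC n
  refine tendsto_order.2 ⟨fun a ha => .of_forall fun n =>
    ha.trans_le (integral_nonneg fun ω => abs_nonneg _), fun η hη => ?_⟩
  obtain ⟨K, hKη, hK⟩ : ∃ K : ℝ, C / K < η / 2 ∧ 0 < K :=
    (((tendsto_const_nhds.div_atTop tendsto_id).eventually_lt_const (half_pos hη)).and
      (eventually_gt_atTop 0)).exists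
  filter_upwards [(hmin K hK).eventually_lt_const (half_pos hη)] with n hn
  linarith [hle K hK n]

lemma tendsto_integral_of_integral_sq_le (hY : ∀ n, MemLp (Y n) 2 P)
    (h : ∀ᵐ ω ∂P, Tendsto (fun n => Y n ω) atTop (𝓝 (Z ω)))
    (hC : ∀ n, ∫ ω, Y n ω ^ 2 ∂P ≤ C) :
    Tendsto (fun n => ∫ ω, Y n ω ∂P) atTop (𝓝 (∫ ω, Z ω ∂P)) := by
  have hZ := memLp_two_of_tendsto_ae hY h hC tendsto_const_nhds
  have hZC := integral_sq_le_of_tendsto_ae hY h hC tendsto_const_nhds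
  have hsq (n : ℕ) : ∫ ω, (Y n ω - Z ω) ^ 2 ∂P ≤ 4 * C := calc
    ∫ ω, (Y n ω - Z ω) ^ 2 ∂P ≤ ∫ ω, (2 * Y n ω ^ 2 + 2 * Z ω ^ 2) ∂P :=
      integral_mono ((hY n).sub hZ).integrable_sq
        (((hY n).integrable_sq.const_mul 2).add (hZ.integrable_sq.const_mul 2))
        fun ω => by nlinarith [sq_nonneg (Y n ω + Z ω)]
    _ = 2 * ∫ ω, Y n ω ^ 2 ∂P + 2 * ∫ ω, Z ω ^ 2 ∂P := by
      rw [integral_add ((hY n).integrable_sq.const_mul 2) (hZ.integrable_sq.const_mul 2),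
        integral_const_mul, integral_const_mul]
    _ ≤ 4 * C := by linarith [hC n]
  have habs := tendsto_integral_abs_of_tendsto_zero_ae (fun n => (hY n).sub hZ)
    (h.mono fun ω hω => tendsto_sub_nhds_zero_iff.2 hω) hsq
  refine tendsto_iff_dist_tendsto_zero.2 (squeeze_zero (fun n => dist_nonneg) (fun n => ?_) habs)
  rw [Real.dist_eq, ← integral_sub ((hY n).integrable one_le_two) (hZ.integrable one_le_two)]
  exact abs_integral_le_integral_abs

lemma integral_sq_le_of_variance_le {X : Ω → ℝ} {v m : ℝ} (hX : MemLp X 2 P) (hv : Var[X; P] ≤ v)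
    (hm : |∫ ω, X ω ∂P| ≤ m) : ∫ ω, X ω ^ 2 ∂P ≤ v + m ^ 2 := by
  rw [variance_eq_sub hX] at hv
  simp only [Pi.pow_apply] at hv
  linarith [sq_abs (∫ ω, X ω ∂P), pow_le_pow_left₀ (abs_nonneg _) hm 2]

lemma variance_le_of_tendsto_ae {v : ℕ → ℝ} {b : ℝ} (hY : ∀ n, MemLp (Y n) 2 P)
    (h : ∀ᵐ ω ∂P, Tendsto (fun n => Y n ω) atTop (𝓝 (Z ω)))
    (hE : Tendsto (fun n => ∫ ω, Y n ω ∂P) atTop (𝓝 (∫ ω, Z ω ∂P)))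
    (hv : ∀ n, Var[Y n; P] ≤ v n) (hvb : Tendsto v atTop (𝓝 b)) : Var[Z; P] ≤ b := by
  rw [variance_eq_integral
    (aestronglyMeasurable_of_tendsto_ae atTop (fun n => (hY n).1) h).aemeasurable]
  refine integral_sq_le_of_tendsto_ae (Y := fun n ω => Y n ω - ∫ ω, Y n ω ∂P)
    (fun n => (hY n).sub (memLp_const _)) (h.mono fun ω hω => hω.sub hE) (fun n => ?_) hvb
  rw [← variance_eq_integral (hY n).1.aemeasurable]
  exact hv n

end L2Bounded

end Limits

lemma eq_mul_of_additive_of_bounded {φ : ℝ≥0 → ℝ} {C : ℝ} (hadd : ∀ s t, φ (s + t) = φ s + φ t)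
    (hC : ∀ t ≤ 1, |φ t| ≤ C) (t : ℝ≥0) : φ t = t * φ 1 := by
  have hnat (n : ℕ) (s : ℝ≥0) : φ (n * s) = n * φ s := by
    let φhom : ℝ≥0 →+ ℝ := ⟨⟨φ, by simpa using hadd 0 0⟩, hadd⟩
    simpa only [nsmul_eq_mul] using! map_nsmul φhom n s
  have hbdd (n : ℕ) : n • |φ t - t * φ 1| ≤ 2 * C := by
    obtain ⟨r, hr⟩ := exists_add_of_le (Nat.floor_le (zero_le : 0 ≤ (n : ℝ≥0) * t))
    have hlt := (Nat.lt_floor_add_one ((n : ℝ≥0) * t)).le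
    generalize ⌊(n : ℝ≥0) * t⌋₊ = k at hr hlt
    have hr1 : r ≤ 1 := le_of_add_le_add_left (hr ▸ hlt)
    have hφ : n * φ t = k * φ 1 + φ r := by rw [← hnat, hr, hadd, ← hnat, mul_one]
    have hrR : (n : ℝ) * t = k + r := by exact_mod_cast hr
    have hr1R : (r : ℝ) ≤ 1 := by exact_mod_cast hr1
    calc n • |φ t - t * φ 1| = |φ r - r * φ 1| := by
          rw [nsmul_eq_mul, ← Nat.abs_cast, ← abs_mul]
          congr 1
          linear_combination hφ - φ 1 * hrR
      _ ≤ |φ r| + r * |φ 1| := by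
          rw [← NNReal.abs_eq r, ← abs_mul, NNReal.abs_eq]
          exact abs_sub _ _
      _ ≤ 2 * C := by
          linarith [hC r hr1, hC 1 le_rfl, mul_le_of_le_one_left (abs_nonneg (φ 1)) hr1R]
  by_contra hne
  obtain ⟨n, hn⟩ := exists_lt_nsmul (abs_pos.2 (sub_ne_zero.2 hne)) (2 * C)
  exact absurd (hbdd n) (not_le.2 hn)

section JumpSum

variable {E : Type*} [NormedAddCommGroup E] {f : ℝ≥0 → E} {g h : E → ℝ} {s t u : ℝ≥0}

/-- The sum of `‖Δf(r)‖²` over `s < r ≤ t`. -/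
noncomputable def sqJumps (f : ℝ≥0 → E) (s t : ℝ≥0) : ℝ≥0∞ :=
  ∑' r, (Set.Ioc s t).indicator (fun r => ENNReal.ofReal (‖pathJump f r‖ ^ 2)) r

lemma sqJumps_mono {s' t' : ℝ≥0} (hs : s' ≤ s) (ht : t ≤ t') : sqJumps f s t ≤ sqJumps f s' t' :=
  ENNReal.tsum_le_tsum fun _ => Set.indicator_le_indicator_of_subset
    (Set.Ioc_subset_Ioc hs ht) (fun _ => zero_le) _

lemma IsCadlagPath.summable_jumps (hf : IsCadlagPath f) (hg : ∀ᶠ x in 𝓝 0, g x = 0)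
    (s t : ℝ≥0) : Summable ((Set.Ioc s t).indicator fun r => g (pathJump f r)) := by
  refine summable_of_hasFiniteSupport ((hf.finite_setOf_pathJump_notMem hg s t).subset ?_)
  intro r hr
  rw [Function.mem_support, Set.indicator_apply_ne_zero] at hr
  exact hr

lemma IsCadlagPath.jumpSum_linear (hf : IsCadlagPath f) (hg : ∀ᶠ x in 𝓝 0, g x = 0)
    (hh : ∀ᶠ x in 𝓝 0, h x = 0) (a b : ℝ) (s t : ℝ≥0) :
    jumpSum (fun x => a * g x + b * h x) f s t = a * jumpSum g f s t + b * jumpSum h f s t := by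
  simp only [jumpSum, Set.indicator_add, Set.indicator_const_mul]
  rw [Summable.tsum_add ((hf.summable_jumps hg s t).mul_left a)
    ((hf.summable_jumps hh s t).mul_left b), tsum_mul_left, tsum_mul_left]

lemma IsCadlagPath.jumpSum_add_jumpSum (hf : IsCadlagPath f) (hg : ∀ᶠ x in 𝓝 0, g x = 0)
    (hst : s ≤ t) (htu : t ≤ u) : jumpSum g f s t + jumpSum g f t u = jumpSum g f s u := by
  rw [jumpSum, jumpSum, jumpSum,
    ← (hf.summable_jumps hg s t).tsum_add (hf.summable_jumps hg t u),
    ← Set.Ioc_union_Ioc_eq_Ioc hst htu,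
    Set.indicator_union_of_disjoint (Set.Ioc_disjoint_Ioc_of_le le_rfl)]

lemma jumpSum_self (g : E → ℝ) (f : ℝ≥0 → E) (s : ℝ≥0) : jumpSum g f s s = 0 := by
  simp only [jumpSum, Set.Ioc_self, Set.indicator_empty, tsum_zero]

lemma IsCadlagPath.tendsto_jumpSum (hf : IsCadlagPath f) {G : ℕ → E → ℝ}
    (hG : ∀ᶠ x in 𝓝 0, ∀ k, G k x = 0) (hlim : ∀ x, Tendsto (fun k => G k x) atTop (𝓝 (g x)))
    (s t : ℝ≥0) : Tendsto (fun k => jumpSum (G k) f s t) atTop (𝓝 (jumpSum g f s t)) := by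
  obtain ⟨R, hRsub, hR⟩ := hf.exists_finset_pathJump_mem hG s t
  have hg (r : ℝ≥0) (hr : r ∈ Set.Ioc s t) (hrR : r ∉ R) : g (pathJump f r) = 0 :=
    tendsto_nhds_unique (hlim _) (tendsto_const_nhds.congr fun k => (hR r hr hrR k).symm)
  rw [jumpSum_eq_sum hRsub hg]
  simp_rw [fun k => jumpSum_eq_sum hRsub fun r hr hrR => hR r hr hrR k]
  exact tendsto_finsetSum R fun r _ => hlim _

lemma enorm_jumpSum_le {C : ℝ≥0} (hg : ∀ x, |g x| ≤ C * ‖x‖ ^ 2) :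
    ‖jumpSum g f s t‖ₑ ≤ C * sqJumps f s t := by
  rw [sqJumps, ← ENNReal.tsum_mul_left]
  refine enorm_tsum_le_tsum_enorm.trans (ENNReal.tsum_le_tsum fun r => ?_)
  rw [enorm_indicator_eq_indicator_enorm]
  by_cases hr : r ∈ Set.Ioc s t
  · rw [Set.indicator_of_mem hr, Set.indicator_of_mem hr, ← ENNReal.ofReal_coe_nnreal,
      ← ENNReal.ofReal_mul C.coe_nonneg, Real.enorm_eq_ofReal_abs]
    exact ENNReal.ofReal_le_ofReal (hg _)
  · rw [Set.indicator_of_notMem hr, Set.indicator_of_notMem hr, mul_zero]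

lemma summable_sq_norm_pathJump (h : sqJumps f s t ≠ ∞) :
    Summable ((Set.Ioc s t).indicator fun r => ‖pathJump f r‖ ^ 2) := by
  refine (ENNReal.summable_toReal h).congr fun r => ?_
  by_cases hr : r ∈ Set.Ioc s t
  · rw [Set.indicator_of_mem hr, Set.indicator_of_mem hr, ENNReal.toReal_ofReal (sq_nonneg _)]
  · rw [Set.indicator_of_notMem hr, Set.indicator_of_notMem hr, ENNReal.toReal_zero]

lemma tendsto_jumpSum_zero {ι : Type*} {l : Filter ι} {h : ι → E → ℝ} {C : ℝ}
    (hsq : sqJumps f s t ≠ ∞) (hh : ∀ᶠ i in l, ∀ x, |h i x| ≤ C * ‖x‖ ^ 2)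
    (hlim : ∀ x, Tendsto (fun i => h i x) l (𝓝 0)) :
    Tendsto (fun i => jumpSum (h i) f s t) l (𝓝 0) := by
  rw [← tsum_zero (α := ℝ) (β := ℝ≥0)]
  refine tendsto_tsum_of_dominated_convergence
    ((summable_sq_norm_pathJump hsq).mul_left C) (fun r => ?_) (hh.mono fun i hi r => ?_)
  all_goals by_cases hr : r ∈ Set.Ioc s t
  · simpa only [Set.indicator_of_mem hr] using hlim _
  · simpa only [Set.indicator_of_notMem hr] using tendsto_const_nhds
  · simpa only [Set.indicator_of_mem hr] using! hi _
  · simp only [Set.indicator_of_notMem hr, norm_zero, mul_zero, le_refl]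

lemma IsCadlagPath.sqJumps_le_liminf (hf : IsCadlagPath f) (hst : s ≤ t) :
    sqJumps f s t ≤
      liminf (fun n => ENNReal.ofReal (gridSum (fun x => ‖x‖ ^ 2) f s t n)) atTop := by
  classical
  refine ENNReal.summable.tsum_le_of_sum_le fun R' => ?_
  set R := R'.filter (· ∈ Set.Ioc s t)
  have hRsub (r : ℝ≥0) (hr : r ∈ R) : r ∈ Set.Ioc s t := (Finset.mem_filter.1 hr).2
  obtain ⟨k, hk⟩ := exists_gridIndex hst
  have hkR (r : ℝ≥0) (hr : r ∈ R) :
      ∀ᶠ n in atTop, r ∈ Set.Ioc (grid s t n (k n r)) (grid s t n (k n r + 1)) :=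
    (eventually_ne_atTop 0).mono fun n hn => (hk n hn r (hRsub r hr)).2
  have hcont : Continuous fun x : E => ‖x‖ ^ 2 := by fun_prop
  have hsum : ∑ r ∈ R', (Set.Ioc s t).indicator (fun r => ENNReal.ofReal (‖pathJump f r‖ ^ 2)) r
      = ENNReal.ofReal (∑ r ∈ R, ‖pathJump f r‖ ^ 2) := by
    rw [ENNReal.ofReal_sum_of_nonneg fun r _ => sq_nonneg _, Finset.sum_filter]
    exact Finset.sum_congr rfl fun r _ => Set.indicator_apply _ _ _
  rw [hsum, ← (ENNReal.tendsto_ofReal (hf.tendsto_sum_gridIndex hcont hkR)).liminf_eq]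
  refine liminf_le_liminf ?_
  filter_upwards [eventually_injOn_gridIndex hkR, eventually_ne_atTop 0] with n hinj hn
  refine ENNReal.ofReal_le_ofReal ?_
  rw [← Finset.sum_image (f := fun i => ‖f (grid s t n (i + 1)) - f (grid s t n i)‖ ^ 2) hinj]
  refine Finset.sum_le_sum_of_subset_of_nonneg (fun i hi => ?_) fun i _ _ => sq_nonneg _
  obtain ⟨r, hr, rfl⟩ := Finset.mem_image.1 hi
  exact Finset.mem_range.2 (hk n hn r (hRsub r hr)).1

end JumpSum

section IndependentSums

variable {Ω : Type*} {mΩ : MeasurableSpace Ω} {P : Measure Ω}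

lemma submartingale_sq_of_martingale [IsFiniteMeasure P] {𝒢 : Filtration ℕ mΩ} {f : ℕ → Ω → ℝ}
    (hf : Martingale f 𝒢 P) (h2 : ∀ n, MemLp (f n) 2 P) :
    Submartingale (fun n ω => f n ω ^ 2) 𝒢 P := by
  refine submartingale_nat (fun n => (hf.stronglyAdapted n).pow 2)
    (fun n => (h2 n).integrable_sq) fun n => ?_
  filter_upwards [(even_two.convexOn_pow (𝕜 := ℝ)).map_condExp_le_univ (𝒢.le n)
      (continuous_pow 2).lowerSemicontinuous ((h2 (n + 1)).integrable one_le_two)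
      (h2 (n + 1)).integrable_sq, hf.condExp_ae_eq n.le_succ] with ω hω hmart
  rw [← hmart]
  exact hω

lemma martingale_sum_of_iIndepFun {ξ : ℕ → Ω → ℝ} (hind : iIndepFun ξ P)
    (hm : ∀ i, StronglyMeasurable (ξ i)) (h1 : ∀ i, Integrable (ξ i) P)
    (h0 : ∀ i, ∫ ω, ξ i ω ∂P = 0) :
    Martingale (fun n ω => ∑ i ∈ Finset.range (n + 1), ξ i ω) (Filtration.natural ξ hm) P := by
  have := hind.isProbabilityMeasure
  have hadapted (n : ℕ) : StronglyMeasurable[Filtration.natural ξ hm n]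
      fun ω => ∑ i ∈ Finset.range (n + 1), ξ i ω :=
    Finset.stronglyMeasurable_fun_sum _ fun i hi =>
      (Filtration.stronglyAdapted_natural hm i).mono
        ((Filtration.natural ξ hm).mono (Finset.mem_range_succ_iff.1 hi))
  refine martingale_of_condExp_sub_eq_zero_nat hadapted
    (fun n => integrable_finsetSum _ fun i _ => h1 i) fun n => ?_
  have hincr : (fun ω => ∑ i ∈ Finset.range (n + 1 + 1), ξ i ω) -
      (fun ω => ∑ i ∈ Finset.range (n + 1), ξ i ω) = ξ (n + 1) := by
    funext ω
    simp only [Pi.sub_apply, Finset.sum_range_succ _ (n + 1), add_sub_cancel_left]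
  rw [hincr]
  filter_upwards [hind.condExp_natural_ae_eq_of_lt hm n.lt_succ_self] with ω hω
  rw [hω, h0, Pi.zero_apply]

lemma kolmogorov_maximal {ξ : ℕ → Ω → ℝ} (hind : iIndepFun ξ P)
    (hm : ∀ i, StronglyMeasurable (ξ i)) (h2 : ∀ i, MemLp (ξ i) 2 P)
    (h0 : ∀ i, ∫ ω, ξ i ω ∂P = 0) (n : ℕ) {c : ℝ} (hc : 0 < c) :
    P.real {ω | ∃ k ≤ n, c ≤ |∑ i ∈ Finset.range (k + 1), ξ i ω|} ≤
      (∫ ω, (∑ i ∈ Finset.range (n + 1), ξ i ω) ^ 2 ∂P) / c ^ 2 := by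
  have := hind.isProbabilityMeasure
  have hS (k : ℕ) : MemLp (fun ω => ∑ i ∈ Finset.range (k + 1), ξ i ω) 2 P :=
    memLp_finsetSum _ fun i _ => h2 i
  have hsub := submartingale_sq_of_martingale
    (martingale_sum_of_iIndepFun hind hm (fun i => (h2 i).integrable one_le_two) h0) hS
  have hdoob := maximal_ineq hsub (fun _ _ => sq_nonneg _) (ε := ⟨c ^ 2, sq_nonneg c⟩) n
  have hset : {ω | ∃ k ≤ n, c ≤ |∑ i ∈ Finset.range (k + 1), ξ i ω|} =
      {ω | c ^ 2 ≤ (Finset.range (n + 1)).sup' Finset.nonempty_range_add_one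
        fun k => (∑ i ∈ Finset.range (k + 1), ξ i ω) ^ 2} := by
    ext ω
    simp only [Set.mem_ofPred_eq, Finset.le_sup'_iff, Finset.mem_range_succ_iff,
      sq_le_sq, abs_of_pos hc]
  rw [le_div_iff₀' (pow_pos hc 2), hset]
  refine (ENNReal.ofReal_le_ofReal_iff (integral_nonneg fun ω => sq_nonneg _)).1 ?_
  rw [ENNReal.ofReal_mul (sq_nonneg c), ofReal_measureReal, ENNReal.ofReal_eq_coe_nnreal]
  exact hdoob.trans <| ENNReal.ofReal_le_ofReal <|
    setIntegral_le_integral (hS n).integrable_sq (ae_of_all _ fun ω => sq_nonneg _)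

lemma sum_integral_norm_sq_le {E : Type*} [NormedAddCommGroup E] [InnerProductSpace ℝ E]
    [CompleteSpace E] [MeasurableSpace E] [BorelSpace E] {ξ : ℕ → Ω → E} {m : E}
    (hind : iIndepFun ξ P) (h2 : ∀ i, MemLp (ξ i) 2 P) (hm : ∀ i, ∫ ω, ξ i ω ∂P = m) (n : ℕ) :
    ∑ i ∈ Finset.range n, ∫ ω, ‖ξ i ω‖ ^ 2 ∂P ≤
      ∫ ω, ‖∑ i ∈ Finset.range n, ξ i ω‖ ^ 2 ∂P := by
  have := hind.isProbabilityMeasure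
  have h1 (i : ℕ) : Integrable (ξ i) P := (h2 i).integrable one_le_two
  have hcross (i j : ℕ) (hij : i ≠ j) : 0 ≤ ∫ ω, inner ℝ (ξ i ω) (ξ j ω) ∂P :=
    ((hind.indepFun hij).integral_bilin (h1 i) (h1 j) (innerSL ℝ)).symm ▸ by
      rw [hm, hm]
      exact real_inner_self_nonneg
  have hint (i j : ℕ) : Integrable (fun ω => inner ℝ (ξ i ω) (ξ j ω)) P := by
    rcases eq_or_ne i j with rfl | hij
    · simpa only [real_inner_self_eq_norm_sq] using (h2 i).norm.integrable_sq
    · exact (hind.indepFun hij).integrable_bilin (h1 i) (h1 j) (innerSL ℝ)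
  calc ∑ i ∈ Finset.range n, ∫ ω, ‖ξ i ω‖ ^ 2 ∂P
      = ∑ i ∈ Finset.range n, ∫ ω, inner ℝ (ξ i ω) (ξ i ω) ∂P := by
        simp only [real_inner_self_eq_norm_sq]
    _ ≤ ∑ i ∈ Finset.range n, ∑ j ∈ Finset.range n, ∫ ω, inner ℝ (ξ i ω) (ξ j ω) ∂P := by
        refine Finset.sum_le_sum fun i hi =>
          Finset.single_le_sum (f := fun j => ∫ ω, inner ℝ (ξ i ω) (ξ j ω) ∂P) (fun j _ => ?_) hi
        rcases eq_or_ne i j with rfl | hij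
        · exact integral_nonneg fun ω => real_inner_self_nonneg
        · exact hcross i j hij
    _ = ∫ ω, ‖∑ i ∈ Finset.range n, ξ i ω‖ ^ 2 ∂P := by
        simp only [← real_inner_self_eq_norm_sq, sum_inner, inner_sum]
        rw [integral_finsetSum _ fun j _ => integrable_finsetSum _ fun i _ => hint i j,
          Finset.sum_comm]
        exact Finset.sum_congr rfl fun j _ => (integral_finsetSum _ fun i _ => hint i j).symm

end IndependentSums

/-! ### Jump functionals of square integrable Lévy processes -/

section JumpTest

variable {E : Type*} [NormedAddCommGroup E] {g h : E → ℝ} {C : ℝ≥0}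

/-- The functions `g` for which `∑ g (ΔZ(r))` is a measurable functional of a càdlàg process `Z`,
being a limit of limits of sums over partitions: pointwise limits of continuous functions that
vanish on a common neighbourhood of `0`. Indicators of open sets away from `0` are included. -/
def IsJumpTest (g : E → ℝ) : Prop :=
  ∃ G : ℕ → E → ℝ, (∀ k, Continuous (G k)) ∧ (∀ᶠ x in 𝓝 0, ∀ k, G k x = 0) ∧
    ∀ x, Tendsto (fun k => G k x) atTop (𝓝 (g x))

lemma IsJumpTest.of_continuous (hg : Continuous g) (h0 : ∀ᶠ x in 𝓝 0, g x = 0) : IsJumpTest g :=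
  ⟨fun _ => g, fun _ => hg, h0.mono fun _ hx _ => hx, fun _ => tendsto_const_nhds⟩

lemma IsJumpTest.eventually_eq_zero (hg : IsJumpTest g) : ∀ᶠ x in 𝓝 0, g x = 0 := by
  obtain ⟨G, -, h0, hlim⟩ := hg
  filter_upwards [h0] with x hx
  exact tendsto_nhds_unique (hlim x) (tendsto_const_nhds.congr fun k => (hx k).symm)

lemma IsJumpTest.comp (hg : IsJumpTest g) {φ : ℝ → ℝ} (hφ : Continuous φ) (h0 : φ 0 = 0) :
    IsJumpTest fun x => φ (g x) := by
  obtain ⟨G, hc, hG, hlim⟩ := hg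
  exact ⟨fun k x => φ (G k x), fun k => hφ.comp (hc k),
    hG.mono fun x hx k => (congrArg φ (hx k)).trans h0, fun x => (hφ.tendsto _).comp (hlim x)⟩

lemma IsJumpTest.linear (hg : IsJumpTest g) (hh : IsJumpTest h) (a b : ℝ) :
    IsJumpTest fun x => a * g x + b * h x := by
  obtain ⟨G, hGc, hG, hGlim⟩ := hg
  obtain ⟨H, hHc, hH, hHlim⟩ := hh
  refine ⟨fun k x => a * G k x + b * H k x,
    fun k => ((hGc k).const_mul a).add ((hHc k).const_mul b), ?_,
    fun x => ((hGlim x).const_mul a).add ((hHlim x).const_mul b)⟩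
  filter_upwards [hG, hH] with x hGx hHx k
  rw [hGx, hHx, mul_zero, mul_zero, add_zero]

lemma IsJumpTest.exists_bounded_approx (hg : IsJumpTest g) (hC : ∀ x, |g x| ≤ C * ‖x‖) :
    ∃ G : ℕ → E → ℝ, (∀ k, Continuous (G k)) ∧ (∀ᶠ x in 𝓝 0, ∀ k, G k x = 0) ∧
      (∀ k x, |G k x| ≤ min (C * ‖x‖) k) ∧ ∀ x, Tendsto (fun k => G k x) atTop (𝓝 (g x)) := by
  obtain ⟨G, hc, hG, hlim⟩ := hg
  have hM (k : ℕ) (x : E) : 0 ≤ min (C * ‖x‖) k := le_min (by positivity) k.cast_nonneg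
  refine ⟨fun k x => max (-min (C * ‖x‖) k) (min (G k x) (min (C * ‖x‖) k)), fun k => ?_, ?_,
    fun k x => abs_le.2 ⟨le_max_left _ _, max_le (by linarith [hM k x]) (min_le_right _ _)⟩,
    fun x => ?_⟩
  · have := hc k
    fun_prop
  · filter_upwards [hG] with x hx k
    rw [hx, min_eq_left (hM k x), max_eq_right (neg_nonpos.2 (hM k x))]
  · have hmin : Tendsto (fun k : ℕ => min (C * ‖x‖) k) atTop (𝓝 (C * ‖x‖)) :=
      tendsto_const_nhds.congr' <| (eventually_ge_atTop ⌈C * ‖x‖⌉₊).mono fun k hk =>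
        (min_eq_left (Nat.ceil_le.1 hk)).symm
    have hgx : max (-(C * ‖x‖)) (min (g x) (C * ‖x‖)) = g x := by
      rw [min_eq_left (abs_le.1 (hC x)).2, max_eq_right (abs_le.1 (hC x)).1]
    exact hgx ▸ hmin.neg.max ((hlim x).min hmin)

lemma exists_abs_le_mul_sq_norm {ι : Type*} {G : ι → E → ℝ} (h0 : ∀ᶠ x in 𝓝 0, ∀ k, G k x = 0)
    (hC : ∀ k x, |G k x| ≤ C * ‖x‖) : ∃ K : ℝ≥0, ∀ k x, |G k x| ≤ K * ‖x‖ ^ 2 := by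
  obtain ⟨ε, hε, h0⟩ := Metric.eventually_nhds_iff.1 h0
  lift ε to ℝ≥0 using hε.le
  refine ⟨C / ε, fun k x => ?_⟩
  rcases lt_or_ge ‖x‖ ε with hx | hx
  · rw [h0 ((dist_zero_right x).trans_lt hx), abs_zero]
    positivity
  · calc |G k x| ≤ C * ‖x‖ := hC k x
      _ ≤ C * ‖x‖ * (‖x‖ / ε) := le_mul_of_one_le_right (by positivity) ((one_le_div hε).2 hx)
      _ = (C / ε : ℝ≥0) * ‖x‖ ^ 2 := by
          rw [NNReal.coe_div]
          ring

lemma abs_sq_le_mul_sq_norm (hC : ∀ x, |g x| ≤ C * ‖x‖) (x : E) :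
    |g x ^ 2| ≤ (C ^ 2 : ℝ≥0) * ‖x‖ ^ 2 := by
  rw [abs_pow, NNReal.coe_pow, ← mul_pow]
  exact pow_le_pow_left₀ (abs_nonneg _) (hC x) 2

/-- The random variable `∑_{s < r ≤ t} g (ΔZ(r))`. -/
noncomputable def jumpFunctional {Ω : Type*} (Z : ℝ≥0 → Ω → E) (g : E → ℝ) (s t : ℝ≥0) (ω : Ω) :
    ℝ := jumpSum g (fun u => Z u ω) s t

lemma abs_jumpFunctional_le_of_sqJumps_le {Ω : Type*} {Z : ℝ≥0 → Ω → E} {s t b : ℝ≥0} {ω : Ω}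
    (hC : ∀ x, |g x| ≤ C * ‖x‖ ^ 2) (h : sqJumps (fun u => Z u ω) s t ≤ b) :
    |jumpFunctional Z g s t ω| ≤ C * b := by
  have : ‖jumpFunctional Z g s t ω‖ₑ ≤ (C * b : ℝ≥0) :=
    (enorm_jumpSum_le hC).trans (by rw [ENNReal.coe_mul]; gcongr)
  exact_mod_cast enorm_le_coe.1 this

end JumpTest

section Regular

variable {Ω : Type*} {mΩ : MeasurableSpace Ω} {P : Measure Ω}
variable {E : Type*} [NormedAddCommGroup E] [MeasurableSpace E]

/-- A square integrable Lévy process all of whose paths are càdlàg. -/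
structure IsRegularLevy (P : Measure Ω) (Z : ℝ≥0 → Ω → E) : Prop where
  levy : IsLevyProcess P Z
  measurable : ∀ t, Measurable (Z t)
  cadlag : ∀ ω, IsCadlagPath (fun t => Z t ω)
  memLp : ∀ t, MemLp (Z t) 2 P

variable {Z : ℝ≥0 → Ω → E} {g : E → ℝ} {s t : ℝ≥0} {C : ℝ≥0}

lemma IsRegularLevy.iIndepFun_increments (hZ : IsRegularLevy P Z) (s t : ℝ≥0) (n : ℕ) :
    iIndepFun (fun i ω => Z (grid s t n (i + 1)) ω - Z (grid s t n i) ω) P :=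
  hZ.levy.indep.nat (grid_mono s t n)

lemma IsRegularLevy.identDistrib_increments (hZ : IsRegularLevy P Z) (s t : ℝ≥0) (n i : ℕ) :
    IdentDistrib (fun ω => Z (grid s t n (i + 1)) ω - Z (grid s t n i) ω)
      (Z ((t - s) / n) - Z 0) P P := by
  rw [grid_succ]
  exact hZ.levy.stationary _ _

lemma IsRegularLevy.integrable_gridSum_sq_norm (hZ : IsRegularLevy P Z) (s t : ℝ≥0) (n : ℕ) :
    Integrable (fun ω => gridSum (fun x => ‖x‖ ^ 2) (fun u => Z u ω) s t n) P :=
  integrable_finsetSum _ fun _ _ =>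
    ((hZ.memLp _).sub (hZ.memLp _)).integrable_norm_pow two_ne_zero

variable [OpensMeasurableSpace E] [MeasurableSub₂ E]

lemma IsRegularLevy.memLp_comp_sub (hZ : IsRegularLevy P Z) (hg : Continuous g)
    (hC : ∀ x, |g x| ≤ C * ‖x‖) (u v : ℝ≥0) : MemLp (fun ω => g (Z u ω - Z v ω)) 2 P :=
  ((hZ.memLp u).sub (hZ.memLp v)).of_le_mul
    (hg.measurable.comp ((hZ.measurable u).sub (hZ.measurable v))).aestronglyMeasurable
    (ae_of_all _ fun _ => hC _)

lemma IsRegularLevy.memLp_gridSum (hZ : IsRegularLevy P Z) (hg : Continuous g)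
    (hC : ∀ x, |g x| ≤ C * ‖x‖) (s t : ℝ≥0) (n : ℕ) :
    MemLp (fun ω => gridSum g (fun u => Z u ω) s t n) 2 P :=
  memLp_finsetSum _ fun _ _ => hZ.memLp_comp_sub hg hC _ _

lemma IsRegularLevy.measurable_gridSum (hZ : IsRegularLevy P Z) (hg : Continuous g)
    (s t : ℝ≥0) (n : ℕ) : Measurable fun ω => gridSum g (fun u => Z u ω) s t n :=
  Finset.measurable_fun_sum _ fun _ _ =>
    hg.measurable.comp ((hZ.measurable _).sub (hZ.measurable _))

lemma IsRegularLevy.measurable_jumpFunctional (hZ : IsRegularLevy P Z) (hg : IsJumpTest g)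
    (hst : s ≤ t) : Measurable (jumpFunctional Z g s t) := by
  obtain ⟨G, hc, hG, hlim⟩ := hg
  refine measurable_of_tendsto_metrizable (fun k => ?_)
    (tendsto_pi_nhds.2 fun ω => (hZ.cadlag ω).tendsto_jumpSum hG hlim s t)
  exact measurable_of_tendsto_metrizable (hZ.measurable_gridSum (hc k) s t)
    (tendsto_pi_nhds.2 fun ω => (hZ.cadlag ω).tendsto_gridSum (hc k) (hG.mono fun _ h => h k) hst)

end Regular

section Energy

variable {Ω : Type*} {mΩ : MeasurableSpace Ω} {P : Measure Ω}
variable {E : Type*} [NormedAddCommGroup E] [InnerProductSpace ℝ E] [CompleteSpace E]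
  [MeasurableSpace E] [BorelSpace E]
variable {Z : ℝ≥0 → Ω → E} {g : E → ℝ} {s t : ℝ≥0} {C : ℝ≥0}

lemma IsRegularLevy.integral_gridSum_sq_norm_le (hZ : IsRegularLevy P Z) (hst : s ≤ t) (n : ℕ) :
    ∫ ω, gridSum (fun x => ‖x‖ ^ 2) (fun u => Z u ω) s t n ∂P ≤ ∫ ω, ‖Z t ω - Z s ω‖ ^ 2 ∂P := by
  rcases eq_or_ne n 0 with rfl | hn
  · simpa [gridSum] using integral_nonneg fun ω => sq_nonneg ‖Z t ω - Z s ω‖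
  have hmem (i : ℕ) : MemLp (fun ω => Z (grid s t n (i + 1)) ω - Z (grid s t n i) ω) 2 P :=
    (hZ.memLp _).sub (hZ.memLp _)
  have hsum (ω : Ω) : ∑ i ∈ Finset.range n, (Z (grid s t n (i + 1)) ω - Z (grid s t n i) ω) =
      Z t ω - Z s ω := by
    rw [Finset.sum_range_sub (fun i => Z (grid s t n i) ω), grid_self hst hn, grid_zero]
  simp only [gridSum]
  rw [integral_finsetSum _ fun i _ => (hmem i).integrable_norm_pow two_ne_zero]
  simp_rw [← hsum]
  exact sum_integral_norm_sq_le (hZ.iIndepFun_increments s t n) hmem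
    (fun i => (hZ.identDistrib_increments s t n i).integral_eq) n

lemma IsRegularLevy.abs_integral_gridSum_le (hZ : IsRegularLevy P Z) (hst : s ≤ t)
    (hC : ∀ x, |g x| ≤ C * ‖x‖ ^ 2) (n : ℕ) :
    |∫ ω, gridSum g (fun u => Z u ω) s t n ∂P| ≤ C * ∫ ω, ‖Z t ω - Z s ω‖ ^ 2 ∂P := calc
  |∫ ω, gridSum g (fun u => Z u ω) s t n ∂P|
      ≤ ∫ ω, C * gridSum (fun x => ‖x‖ ^ 2) (fun u => Z u ω) s t n ∂P := by
        refine norm_integral_le_of_norm_le (G := ℝ)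
          ((hZ.integrable_gridSum_sq_norm s t n).const_mul C) (ae_of_all _ fun ω => ?_)
        rw [gridSum, gridSum, Finset.mul_sum]
        exact norm_sum_le_of_le _ fun i _ => hC _
  _ ≤ C * ∫ ω, ‖Z t ω - Z s ω‖ ^ 2 ∂P := by
        rw [integral_const_mul]
        exact mul_le_mul_of_nonneg_left (hZ.integral_gridSum_sq_norm_le hst n) C.coe_nonneg

variable [SecondCountableTopology E]

lemma IsRegularLevy.exists_integrable_sqJumps_le (hZ : IsRegularLevy P Z) (hst : s ≤ t) :
    ∃ b : Ω → ℝ≥0, Integrable (fun ω => (b ω : ℝ)) P ∧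
      ∀ᵐ ω ∂P, sqJumps (fun u => Z u ω) s t ≤ b ω := by
  set q : Ω → ℝ≥0∞ := fun ω =>
    liminf (fun n => ENNReal.ofReal (gridSum (fun x => ‖x‖ ^ 2) (fun u => Z u ω) s t n)) atTop
  have hm (n : ℕ) : Measurable fun ω =>
      ENNReal.ofReal (gridSum (fun x => ‖x‖ ^ 2) (fun u => Z u ω) s t n) :=
    (hZ.measurable_gridSum (by fun_prop) s t n).ennreal_ofReal
  have hqm : Measurable q := .liminf hm
  have hq : ∫⁻ ω, q ω ∂P ≠ ∞ := by
    refine ((lintegral_liminf_le hm).trans (liminf_le_of_le (by isBoundedDefault)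
      fun c hc => ?_)).trans_lt (ENNReal.ofReal_lt_top (r := ∫ ω, ‖Z t ω - Z s ω‖ ^ 2 ∂P)) |>.ne
    obtain ⟨n, hn⟩ := hc.exists
    refine hn.trans ?_
    rw [← ofReal_integral_eq_lintegral_ofReal (hZ.integrable_gridSum_sq_norm s t n)
      (ae_of_all _ fun ω => Finset.sum_nonneg fun i _ => sq_nonneg _)]
    exact ENNReal.ofReal_le_ofReal (hZ.integral_gridSum_sq_norm_le hst n)
  refine ⟨fun ω => (q ω).toNNReal, integrable_toReal_of_lintegral_ne_top hqm.aemeasurable hq, ?_⟩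
  filter_upwards [ae_lt_top hqm hq] with ω hω
  rw [ENNReal.coe_toNNReal hω.ne]
  exact (hZ.cadlag ω).sqJumps_le_liminf hst

lemma IsRegularLevy.integrable_jumpFunctional (hZ : IsRegularLevy P Z) (hst : s ≤ t)
    (hg : IsJumpTest g) (hC : ∀ x, |g x| ≤ C * ‖x‖ ^ 2) :
    Integrable (jumpFunctional Z g s t) P := by
  obtain ⟨b, hb, h⟩ := hZ.exists_integrable_sqJumps_le hst
  exact (hb.const_mul C).mono' (hZ.measurable_jumpFunctional hg hst).aestronglyMeasurable
    (h.mono fun ω hω => abs_jumpFunctional_le_of_sqJumps_le hC hω)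

lemma IsRegularLevy.tendsto_integral_jumpFunctional_zero (hZ : IsRegularLevy P Z) (hst : s ≤ t)
    {ι : Type*} {l : Filter ι} [l.IsCountablyGenerated] {h : ι → E → ℝ}
    (hh : ∀ᶠ i in l, IsJumpTest (h i)) (hC : ∀ᶠ i in l, ∀ x, |h i x| ≤ C * ‖x‖ ^ 2)
    (hlim : ∀ x, Tendsto (fun i => h i x) l (𝓝 0)) :
    Tendsto (fun i => ∫ ω, jumpFunctional Z (h i) s t ω ∂P) l (𝓝 0) := by
  obtain ⟨b, hb, hsq⟩ := hZ.exists_integrable_sqJumps_le hst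
  rw [← integral_zero Ω ℝ (μ := P)]
  refine tendsto_integral_filter_of_dominated_convergence (fun ω => C * b ω)
    (hh.mono fun i hi => (hZ.measurable_jumpFunctional hi hst).aestronglyMeasurable)
    (hC.mono fun i hi => hsq.mono fun ω hω => abs_jumpFunctional_le_of_sqJumps_le hi hω)
    (hb.const_mul _) (hsq.mono fun ω hω => ?_)
  exact tendsto_jumpSum_zero (hω.trans_lt ENNReal.coe_lt_top).ne hC hlim

lemma IsRegularLevy.tendsto_integral_jumpFunctional (hZ : IsRegularLevy P Z) (hst : s ≤ t)
    {G : ℕ → E → ℝ} (hG : ∀ k, IsJumpTest (G k)) (h0 : ∀ᶠ x in 𝓝 0, ∀ k, G k x = 0)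
    (hC : ∀ k x, |G k x| ≤ C * ‖x‖ ^ 2) (hlim : ∀ x, Tendsto (fun k => G k x) atTop (𝓝 (g x))) :
    Tendsto (fun k => ∫ ω, jumpFunctional Z (G k) s t ω ∂P) atTop
      (𝓝 (∫ ω, jumpFunctional Z g s t ω ∂P)) := by
  obtain ⟨b, hb, hsq⟩ := hZ.exists_integrable_sqJumps_le hst
  exact tendsto_integral_of_dominated_convergence (fun ω => C * b ω)
    (fun k => (hZ.measurable_jumpFunctional (hG k) hst).aestronglyMeasurable) (hb.const_mul _)
    (fun k => hsq.mono fun ω hω => abs_jumpFunctional_le_of_sqJumps_le (hC k) hω)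
    (ae_of_all _ fun ω => (hZ.cadlag ω).tendsto_jumpSum h0 hlim s t)

end Energy

section GridVariance

variable {Ω : Type*} {mΩ : MeasurableSpace Ω} {P : Measure Ω} [IsProbabilityMeasure P]
variable {E : Type*} [NormedAddCommGroup E] [MeasurableSpace E] [OpensMeasurableSpace E]
  [MeasurableSub₂ E]
variable {Z : ℝ≥0 → Ω → E} {g : E → ℝ} {C : ℝ≥0}

lemma IsRegularLevy.variance_gridSum_le (hZ : IsRegularLevy P Z) (hg : Continuous g)
    (hC : ∀ x, |g x| ≤ C * ‖x‖) (s t : ℝ≥0) (n : ℕ) :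
    Var[fun ω => gridSum g (fun u => Z u ω) s t n; P] ≤
      ∫ ω, gridSum (fun x => g x ^ 2) (fun u => Z u ω) s t n ∂P := by
  have hm (i : ℕ) : MemLp (fun ω => g (Z (grid s t n (i + 1)) ω - Z (grid s t n i) ω)) 2 P :=
    hZ.memLp_comp_sub hg hC _ _
  have hind := (hZ.iIndepFun_increments s t n).comp (fun _ => g) fun _ => hg.measurable
  calc Var[fun ω => gridSum g (fun u => Z u ω) s t n; P]
      = ∑ i ∈ Finset.range n,
          Var[fun ω => g (Z (grid s t n (i + 1)) ω - Z (grid s t n i) ω); P] := by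
        rw [← IndepFun.variance_sum (fun i _ => hm i) fun i _ j _ hij => hind.indepFun hij]
        congr with ω
        rw [gridSum, Finset.sum_apply]
    _ ≤ ∑ i ∈ Finset.range n, ∫ ω, g (Z (grid s t n (i + 1)) ω - Z (grid s t n i) ω) ^ 2 ∂P :=
        Finset.sum_le_sum fun i _ => variance_le_expectation_sq (hm i).1
    _ = ∫ ω, gridSum (fun x => g x ^ 2) (fun u => Z u ω) s t n ∂P :=
        (integral_finsetSum _ fun i _ => (hm i).integrable_sq).symm

end GridVariance

section Variance

variable {Ω : Type*} {mΩ : MeasurableSpace Ω} {P : Measure Ω} [IsProbabilityMeasure P]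
variable {E : Type*} [NormedAddCommGroup E] [InnerProductSpace ℝ E] [CompleteSpace E]
  [SecondCountableTopology E] [MeasurableSpace E] [BorelSpace E]
variable {Z : ℝ≥0 → Ω → E} {g : E → ℝ} {s t : ℝ≥0} {C B : ℝ≥0}

lemma IsRegularLevy.exists_integral_sq_gridSum_le (hZ : IsRegularLevy P Z) (hst : s ≤ t)
    (hg : Continuous g) (h0 : ∀ᶠ x in 𝓝 0, g x = 0) (hC : ∀ x, |g x| ≤ C * ‖x‖) :
    ∃ K, ∀ n, ∫ ω, gridSum g (fun u => Z u ω) s t n ^ 2 ∂P ≤ K := by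
  obtain ⟨K, hK⟩ := exists_abs_le_mul_sq_norm (ι := Unit) (h0.mono fun _ h _ => h) fun _ => hC
  exact ⟨_, fun n => integral_sq_le_of_variance_le (hZ.memLp_gridSum hg hC s t n)
    ((hZ.variance_gridSum_le hg hC s t n).trans <| (le_abs_self _).trans <|
      hZ.abs_integral_gridSum_le hst (abs_sq_le_mul_sq_norm hC) n)
    (hZ.abs_integral_gridSum_le hst (hK ()) n)⟩

lemma IsRegularLevy.memLp_jumpFunctional_of_continuous (hZ : IsRegularLevy P Z) (hst : s ≤ t)
    (hg : Continuous g) (h0 : ∀ᶠ x in 𝓝 0, g x = 0) (hC : ∀ x, |g x| ≤ C * ‖x‖) :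
    MemLp (jumpFunctional Z g s t) 2 P := by
  obtain ⟨K, hK⟩ := hZ.exists_integral_sq_gridSum_le hst hg h0 hC
  exact memLp_two_of_tendsto_ae (hZ.memLp_gridSum hg hC s t)
    (ae_of_all _ fun ω => (hZ.cadlag ω).tendsto_gridSum hg h0 hst) hK tendsto_const_nhds

lemma IsRegularLevy.tendsto_integral_gridSum (hZ : IsRegularLevy P Z) (hst : s ≤ t)
    (hg : Continuous g) (h0 : ∀ᶠ x in 𝓝 0, g x = 0) (hC : ∀ x, |g x| ≤ C * ‖x‖) :
    Tendsto (fun n => ∫ ω, gridSum g (fun u => Z u ω) s t n ∂P) atTop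
      (𝓝 (∫ ω, jumpFunctional Z g s t ω ∂P)) := by
  obtain ⟨K, hK⟩ := hZ.exists_integral_sq_gridSum_le hst hg h0 hC
  exact tendsto_integral_of_integral_sq_le (hZ.memLp_gridSum hg hC s t)
    (ae_of_all _ fun ω => (hZ.cadlag ω).tendsto_gridSum hg h0 hst) hK

lemma IsRegularLevy.variance_jumpFunctional_le_of_continuous (hZ : IsRegularLevy P Z)
    (hst : s ≤ t) (hg : Continuous g) (h0 : ∀ᶠ x in 𝓝 0, g x = 0) (hC : ∀ x, |g x| ≤ C * ‖x‖)
    (hB : ∀ x, |g x| ≤ B) :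
    Var[jumpFunctional Z g s t; P] ≤ ∫ ω, jumpFunctional Z (fun x => g x ^ 2) s t ω ∂P := by
  have hsq (x : E) : |g x ^ 2| ≤ (B * C : ℝ≥0) * ‖x‖ := by
    rw [abs_pow, sq, NNReal.coe_mul, mul_assoc]
    exact mul_le_mul (hB x) (hC x) (abs_nonneg _) B.coe_nonneg
  have h0sq : ∀ᶠ x in 𝓝 0, g x ^ 2 = 0 := h0.mono fun x hx => by rw [hx, sq, zero_mul]
  exact variance_le_of_tendsto_ae (hZ.memLp_gridSum hg hC s t)
    (ae_of_all _ fun ω => (hZ.cadlag ω).tendsto_gridSum hg h0 hst)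
    (hZ.tendsto_integral_gridSum hst hg h0 hC) (hZ.variance_gridSum_le hg hC s t)
    (hZ.tendsto_integral_gridSum hst (hg.pow 2) h0sq hsq)

lemma IsRegularLevy.memLp_and_variance_jumpFunctional_le (hZ : IsRegularLevy P Z) (hst : s ≤ t)
    (hg : IsJumpTest g) (hC : ∀ x, |g x| ≤ C * ‖x‖) :
    MemLp (jumpFunctional Z g s t) 2 P ∧
      Var[jumpFunctional Z g s t; P] ≤ ∫ ω, jumpFunctional Z (fun x => g x ^ 2) s t ω ∂P := by
  obtain ⟨G, hc, h0, hG, hlim⟩ := hg.exists_bounded_approx hC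
  have hGC (k : ℕ) (x : E) : |G k x| ≤ C * ‖x‖ := (hG k x).trans (min_le_left _ _)
  have hGk (k : ℕ) (x : E) : |G k x| ≤ (k : ℝ≥0) := (hG k x).trans (min_le_right _ _)
  have h0k (k : ℕ) : ∀ᶠ x in 𝓝 0, G k x = 0 := h0.mono fun _ h => h k
  have h0sq : ∀ᶠ x in 𝓝 0, ∀ k, G k x ^ 2 = 0 :=
    h0.mono fun x hx k => by rw [hx, sq, zero_mul]
  obtain ⟨K, hK⟩ := exists_abs_le_mul_sq_norm h0 hGC
  have hmem (k : ℕ) := hZ.memLp_jumpFunctional_of_continuous hst (hc k) (h0k k) (hGC k)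
  have hlimae : ∀ᵐ ω ∂P, Tendsto (fun k => jumpFunctional Z (G k) s t ω) atTop
      (𝓝 (jumpFunctional Z g s t ω)) :=
    ae_of_all _ fun ω => (hZ.cadlag ω).tendsto_jumpSum h0 hlim s t
  have hvar (k : ℕ) :=
    hZ.variance_jumpFunctional_le_of_continuous hst (hc k) (h0k k) (hGC k) (hGk k)
  have hE := hZ.tendsto_integral_jumpFunctional hst (fun k => .of_continuous (hc k) (h0k k)) h0 hK
    hlim
  have hEsq := hZ.tendsto_integral_jumpFunctional hst
    (fun k => .of_continuous ((hc k).pow 2) (h0sq.mono fun _ h => h k)) h0sq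
    (fun k => abs_sq_le_mul_sq_norm (hGC k)) (fun x => (hlim x).pow 2)
  exact ⟨memLp_two_of_tendsto_ae hmem hlimae
    (fun k => integral_sq_le_of_variance_le (hmem k) (hvar k) le_rfl) (hEsq.add (hE.abs.pow 2)),
    variance_le_of_tendsto_ae hmem hlimae hE hvar hEsq⟩

end Variance

section RowGrid

/-- The points of the uniform partitions of the intervals `[τ j, τ (j + 1)]` into `n` pieces, in a
row, so that a single monotone sequence carries all the partitions. -/
noncomputable def rowGrid (τ : ℕ → ℝ≥0) (n k : ℕ) : ℝ≥0 :=
  grid (τ (k / n)) (τ (k / n + 1)) n (k % n)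

variable {τ : ℕ → ℝ≥0} {n : ℕ}

lemma rowGrid_mul_add (j : ℕ) {i : ℕ} (hi : i < n) :
    rowGrid τ n (j * n + i) = grid (τ j) (τ (j + 1)) n i := by
  rw [rowGrid, mul_comm, Nat.mul_add_mod, Nat.mod_eq_of_lt hi,
    Nat.mul_add_div (i.zero_le.trans_lt hi), Nat.div_eq_of_lt hi, add_zero]

lemma rowGrid_mul_add_succ (hτ : Monotone τ) (j : ℕ) {i : ℕ} (hi : i < n) :
    rowGrid τ n (j * n + i + 1) = grid (τ j) (τ (j + 1)) n (i + 1) := by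
  rcases (Nat.succ_le_of_lt hi).lt_or_eq with hi' | rfl
  · exact rowGrid_mul_add j hi'
  · rw [add_assoc, ← Nat.succ_mul, ← add_zero (j.succ * _), rowGrid_mul_add _ (Nat.succ_pos i),
      grid_zero, grid_self (hτ j.le_succ) i.succ_ne_zero]

lemma rowGrid_mono (hτ : Monotone τ) (hn : 0 < n) : Monotone (rowGrid τ n) := by
  refine monotone_nat_of_le_succ fun k => ?_
  rw [← Nat.div_add_mod' k n, rowGrid_mul_add _ (Nat.mod_lt k hn),
    rowGrid_mul_add_succ hτ _ (Nat.mod_lt k hn)]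
  exact grid_mono _ _ _ (Nat.le_succ _)

end RowGrid

section Stationarity

variable {Ω : Type*} {mΩ : MeasurableSpace Ω} {P : Measure Ω}
variable {E : Type*} [NormedAddCommGroup E] [MeasurableSpace E] [OpensMeasurableSpace E]
variable {Z : ℝ≥0 → Ω → E} {g : E → ℝ}

lemma IsRegularLevy.identDistrib_gridSum (hZ : IsRegularLevy P Z) (hg : Continuous g)
    (s h : ℝ≥0) (n : ℕ) :
    IdentDistrib (fun ω => gridSum g (fun u => Z u ω) s (s + h) n)
      (fun ω => gridSum g (fun u => Z u ω) 0 h n) P P := by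
  refine (IdentDistrib.pi (fun i => ?_) (hZ.iIndepFun_increments s (s + h) n)
    (hZ.iIndepFun_increments 0 h n)).comp (u := fun v : ℕ → E => ∑ i ∈ Finset.range n, g (v i))
    (Finset.measurable_fun_sum _ fun i _ => hg.measurable.comp (measurable_pi_apply i))
  have hlen : s + h - s = h - 0 := by rw [add_tsub_cancel_left, tsub_zero]
  refine (hZ.identDistrib_increments s (s + h) n i).trans ?_
  rw [hlen]
  exact (hZ.identDistrib_increments 0 h n i).symm

variable [IsProbabilityMeasure P]

lemma IsRegularLevy.identDistrib_jumpFunctional (hZ : IsRegularLevy P Z) (hg : IsJumpTest g)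
    (s h : ℝ≥0) :
    IdentDistrib (jumpFunctional Z g s (s + h)) (jumpFunctional Z g 0 h) P P := by
  obtain ⟨G, hc, h0, hlim⟩ := hg
  have h0k (k : ℕ) : ∀ᶠ x in 𝓝 0, G k x = 0 := h0.mono fun _ h => h k
  refine identDistrib_of_tendsto_ae (Y := fun k => jumpFunctional Z (G k) s (s + h))
    (Y' := fun k => jumpFunctional Z (G k) 0 h) (fun k => ?_)
    (ae_of_all _ fun ω => (hZ.cadlag ω).tendsto_jumpSum h0 hlim _ _)
    (ae_of_all _ fun ω => (hZ.cadlag ω).tendsto_jumpSum h0 hlim _ _)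
  exact identDistrib_of_tendsto_ae (hZ.identDistrib_gridSum (hc k) s h)
    (ae_of_all _ fun ω => (hZ.cadlag ω).tendsto_gridSum (hc k) (h0k k) le_self_add)
    (ae_of_all _ fun ω => (hZ.cadlag ω).tendsto_gridSum (hc k) (h0k k) zero_le)

end Stationarity

section Independence

variable {Ω : Type*} {mΩ : MeasurableSpace Ω} {P : Measure Ω}
variable {E : Type*} [NormedAddCommGroup E] [MeasurableSpace E] [OpensMeasurableSpace E]
  [MeasurableSub₂ E]
variable {Z : ℝ≥0 → Ω → E}

lemma IsRegularLevy.iIndepFun_gridSum (hZ : IsRegularLevy P Z) {τ : ℕ → ℝ≥0} (hτ : Monotone τ)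
    {g : ℕ → E → ℝ} (hg : ∀ j, Continuous (g j)) (n : ℕ) [NeZero n] :
    iIndepFun (fun j ω => gridSum (g j) (fun u => Z u ω) (τ j) (τ (j + 1)) n) P := by
  let e := (Equiv.sigmaEquivProd ℕ (Fin n)).trans (Nat.divModEquiv n).symm
  have hinc := (hZ.levy.indep.nat (rowGrid_mono hτ (NeZero.pos n))).precomp e.injective
  have hrows := iIndepFun_curry (X := fun (j : ℕ) (i : Fin n) ω =>
    Z (rowGrid τ n (e ⟨j, i⟩ + 1)) ω - Z (rowGrid τ n (e ⟨j, i⟩)) ω)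
    (fun _ _ => (hZ.measurable _).sub (hZ.measurable _)) hinc
  convert! hrows.comp (fun j v => ∑ i, g j (v i)) (fun j =>
    Finset.measurable_fun_sum _ fun i _ => (hg j).measurable.comp (measurable_pi_apply i))
    using 2 with j
  funext ω
  rw [gridSum, Finset.sum_range]
  refine Finset.sum_congr rfl fun i _ => ?_
  rw [← rowGrid_mul_add_succ hτ j i.2, ← rowGrid_mul_add j i.2]
  rfl

lemma IsRegularLevy.iIndepFun_jumpFunctional (hZ : IsRegularLevy P Z) {τ : ℕ → ℝ≥0}
    (hτ : Monotone τ) {g : ℕ → E → ℝ} (hg : ∀ j, IsJumpTest (g j)) :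
    iIndepFun (fun j => jumpFunctional Z (g j) (τ j) (τ (j + 1))) P := by
  choose G hc h0 hlim using hg
  have h0k (j k : ℕ) : ∀ᶠ x in 𝓝 0, G j k x = 0 := (h0 j).mono fun _ h => h k
  refine iIndepFun_of_tendsto_ae (Y := fun k j => jumpFunctional Z (G j k) (τ j) (τ (j + 1)))
    (fun k j => (hZ.measurable_jumpFunctional (.of_continuous (hc j k) (h0k j k))
      (hτ j.le_succ)).aemeasurable) (fun k => ?_)
    fun j => ae_of_all _ fun ω => (hZ.cadlag ω).tendsto_jumpSum (h0 j) (hlim j) _ _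
  exact iIndepFun_of_tendsto_ae
    (Y := fun n j ω => gridSum (G j k) (fun u => Z u ω) (τ j) (τ (j + 1)) (n + 1))
    (fun n j => (hZ.measurable_gridSum (hc j k) _ _ _).aemeasurable)
    (fun n => hZ.iIndepFun_gridSum hτ (fun j => hc j k) (n + 1)) fun j => ae_of_all _ fun ω =>
      ((hZ.cadlag ω).tendsto_gridSum (hc j k) (h0k j k) (hτ j.le_succ)).comp
        (tendsto_add_atTop_nat 1)

end Independence

section Expectation

variable {Ω : Type*} {mΩ : MeasurableSpace Ω} {P : Measure Ω} [IsProbabilityMeasure P]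
variable {E : Type*} [NormedAddCommGroup E] [InnerProductSpace ℝ E] [CompleteSpace E]
  [SecondCountableTopology E] [MeasurableSpace E] [BorelSpace E]
variable {Z : ℝ≥0 → Ω → E} {g : E → ℝ} {C : ℝ≥0}

lemma IsRegularLevy.integral_jumpFunctional (hZ : IsRegularLevy P Z) (hg : IsJumpTest g)
    (hC : ∀ x, |g x| ≤ C * ‖x‖ ^ 2) (t : ℝ≥0) :
    ∫ ω, jumpFunctional Z g 0 t ω ∂P = t * ∫ ω, jumpFunctional Z g 0 1 ω ∂P := by
  obtain ⟨b, hb, hsq⟩ := hZ.exists_integrable_sqJumps_le (zero_le : (0 : ℝ≥0) ≤ 1)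
  refine eq_mul_of_additive_of_bounded (φ := fun t => ∫ ω, jumpFunctional Z g 0 t ω ∂P)
    (C := ∫ ω, C * b ω ∂P) (fun s h => ?_) (fun t ht => ?_) t
  · rw [← (hZ.identDistrib_jumpFunctional hg s h).integral_eq, ← integral_add
      (hZ.integrable_jumpFunctional zero_le hg hC) (hZ.integrable_jumpFunctional le_self_add hg hC)]
    exact integral_congr_ae (ae_of_all _ fun ω =>
      ((hZ.cadlag ω).jumpSum_add_jumpSum hg.eventually_eq_zero zero_le le_self_add).symm)
  · exact norm_integral_le_of_norm_le (G := ℝ) (hb.const_mul C) <| hsq.mono fun ω hω =>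
      abs_jumpFunctional_le_of_sqJumps_le hC ((sqJumps_mono le_rfl ht).trans hω)

end Expectation

/-! ### Approximation of linear functionals by truncations -/

section Truncation

variable {E : Type*} [NormedAddCommGroup E]

/-- Jump test functions of linear growth: those whose jump functionals are square integrable. -/
def IsLinearTest (g : E → ℝ) : Prop :=
  IsJumpTest g ∧ ∃ C : ℝ≥0, ∀ x, |g x| ≤ C * ‖x‖

/-- Approximation of `f` by jump test functions which converge pointwise and grow linearly, with a
common constant. It makes the compensated jump functionals converge in `L²`. -/
structure TestApprox {ι : Type*} (g : ι → E → ℝ) (l : Filter ι) (f : E → ℝ) : Prop where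
  isJumpTest : ∀ᶠ i in l, IsJumpTest (g i)
  bound : ∃ C : ℝ≥0, ∀ᶠ i in l, ∀ x, |g i x| ≤ C * ‖x‖
  tendsto : ∀ x, Tendsto (fun i => g i x) l (𝓝 (f x))

variable {ι ι' : Type*} {l : Filter ι} {l' : Filter ι'} {g h : ι → E → ℝ} {f k : E → ℝ}

lemma abs_linear_le {f k : E → ℝ} {C D : ℝ≥0} {x : E} (hf : |f x| ≤ C * ‖x‖)
    (hk : |k x| ≤ D * ‖x‖) (a b : ℝ) :
    |a * f x + b * k x| ≤ (‖a‖₊ * C + ‖b‖₊ * D : ℝ≥0) * ‖x‖ := by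
  rw [NNReal.coe_add, NNReal.coe_mul, NNReal.coe_mul, coe_nnnorm, coe_nnnorm, add_mul, mul_assoc,
    mul_assoc]
  exact norm_add_le_of_le ((norm_mul_le _ _).trans (mul_le_mul_of_nonneg_left hf (norm_nonneg a)))
    ((norm_mul_le _ _).trans (mul_le_mul_of_nonneg_left hk (norm_nonneg b)))

lemma IsLinearTest.linear (hf : IsLinearTest f) (hk : IsLinearTest k) (a b : ℝ) :
    IsLinearTest fun x => a * f x + b * k x := by
  obtain ⟨hf, C, hC⟩ := hf
  obtain ⟨hk, D, hD⟩ := hk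
  exact ⟨hf.linear hk a b, _, fun x => abs_linear_le (hC x) (hD x) a b⟩

lemma TestApprox.isLinearTest (hg : TestApprox g l f) : ∀ᶠ i in l, IsLinearTest (g i) := by
  obtain ⟨C, hC⟩ := hg.bound
  filter_upwards [hg.isJumpTest, hC] with i hi hCi using ⟨hi, C, hCi⟩

lemma TestApprox.linear (hg : TestApprox g l f) (hh : TestApprox h l k) (a b : ℝ) :
    TestApprox (fun i x => a * g i x + b * h i x) l fun x => a * f x + b * k x where
  isJumpTest := (hg.isJumpTest.and hh.isJumpTest).mono fun _ hi => hi.1.linear hi.2 a b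
  bound := by
    obtain ⟨C, hC⟩ := hg.bound
    obtain ⟨D, hD⟩ := hh.bound
    exact ⟨_, (hC.and hD).mono fun i hi x => abs_linear_le (hi.1 x) (hi.2 x) a b⟩
  tendsto x := ((hg.tendsto x).const_mul a).add ((hh.tendsto x).const_mul b)

lemma TestApprox.comp_tendsto (hg : TestApprox g l f) {u : ι' → ι} (hu : Tendsto u l' l) :
    TestApprox (fun i => g (u i)) l' f where
  isJumpTest := hu.eventually hg.isJumpTest
  bound := hg.bound.imp fun _ hC => hu.eventually hC
  tendsto x := (hg.tendsto x).comp hu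

/-- Truncation of the values of modulus at most `ε`. -/
noncomputable def trunc (ε y : ℝ) : ℝ := if ε < |y| then y else 0

lemma trunc_zero (ε : ℝ) : trunc ε 0 = 0 := ite_self 0

lemma abs_trunc_le (ε y : ℝ) : |trunc ε y| ≤ |y| := by
  rw [trunc]
  split_ifs
  exacts [le_rfl, abs_zero.trans_le (abs_nonneg y)]

lemma tendsto_trunc (y : ℝ) : Tendsto (fun ε => trunc ε y) (𝓝[>] 0) (𝓝 y) := by
  rcases eq_or_ne y 0 with rfl | hy
  · simp only [trunc_zero, tendsto_const_nhds]
  · refine tendsto_const_nhds.congr' ?_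
    filter_upwards [nhdsWithin_le_nhds (gt_mem_nhds (abs_pos.2 hy))] with ε hε
    exact (if_pos hε).symm

lemma tendsto_mul_clamp_trunc (ε y : ℝ) :
    Tendsto (fun k : ℕ => y * max 0 (min 1 (k * (|y| - ε)))) atTop (𝓝 (trunc ε y)) := by
  rw [trunc]
  refine tendsto_const_nhds.congr' ?_
  split_ifs with h
  · filter_upwards [eventually_ge_atTop ⌈1 / (|y| - ε)⌉₊] with k hk
    have hk1 : 1 ≤ k * (|y| - ε) := (div_le_iff₀ (sub_pos.2 h)).1 (Nat.ceil_le.1 hk)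
    rw [min_eq_left hk1, max_eq_right zero_le_one, mul_one]
  · refine .of_forall fun k => ?_
    dsimp only
    rw [max_eq_left ((min_le_right _ _).trans (mul_nonpos_of_nonneg_of_nonpos k.cast_nonneg
      (sub_nonpos.2 (not_lt.1 h)))), mul_zero]

variable [NormedSpace ℝ E]

lemma isJumpTest_trunc (ℓ : E →L[ℝ] ℝ) {ε : ℝ} (hε : 0 < ε) :
    IsJumpTest fun x => trunc ε (ℓ x) := by
  refine ⟨fun k x => ℓ x * max 0 (min 1 (k * (|ℓ x| - ε))), fun k => by fun_prop, ?_,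
    fun x => tendsto_mul_clamp_trunc ε (ℓ x)⟩
  have hcont : Continuous fun x => |ℓ x| := by fun_prop
  have hsmall : ∀ᶠ x in 𝓝 0, |ℓ x| < ε := hcont.tendsto' 0 0 (by simp) (gt_mem_nhds hε)
  filter_upwards [hsmall] with x hx k
  rw [max_eq_left ((min_le_right _ _).trans (mul_nonpos_of_nonneg_of_nonpos k.cast_nonneg
    (sub_nonpos.2 hx.le))), mul_zero]

lemma testApprox_trunc (ℓ : E →L[ℝ] ℝ) : TestApprox (fun ε x => trunc ε (ℓ x)) (𝓝[>] 0) ℓ where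
  isJumpTest := eventually_mem_nhdsWithin.mono fun _ hε => isJumpTest_trunc ℓ hε
  bound := ⟨‖ℓ‖₊, .of_forall fun _ x => (abs_trunc_le _ _).trans (ℓ.le_opNorm x)⟩
  tendsto x := tendsto_trunc (ℓ x)

lemma isLinearTest_trunc (ℓ : E →L[ℝ] ℝ) {ε : ℝ} (hε : 0 < ε) :
    IsLinearTest fun x => trunc ε (ℓ x) :=
  ⟨isJumpTest_trunc ℓ hε, ‖ℓ‖₊, fun x => (abs_trunc_le _ _).trans (ℓ.le_opNorm x)⟩

end Truncation

/-! ### Compensated jump sums -/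

section CompensatedSum

variable {Ω : Type*} {mΩ : MeasurableSpace Ω} {P : Measure Ω}
variable {E : Type*} [NormedAddCommGroup E] {Z : ℝ≥0 → Ω → E} {g h : E → ℝ} {s t : ℝ≥0}

/-- The compensated jump sum `∑_{s < r ≤ t} g (ΔZ(r)) - E[∑_{s < r ≤ t} g (ΔZ(r))]`. -/
noncomputable def compensatedSum (P : Measure Ω) (Z : ℝ≥0 → Ω → E) (g : E → ℝ) (s t : ℝ≥0)
    (ω : Ω) : ℝ :=
  jumpFunctional Z g s t ω - ∫ ω', jumpFunctional Z g s t ω' ∂P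

open Classical in
/-- The compensated jump sum as an element of `L²(Ω, P)`, and `0` if it is not square
integrable. -/
noncomputable def compensatedSumLp (P : Measure Ω) (Z : ℝ≥0 → Ω → E) (g : E → ℝ) (s t : ℝ≥0) :
    Lp ℝ 2 P :=
  if h : MemLp (compensatedSum P Z g s t) 2 P then h.toLp else 0

lemma compensatedSum_self (P : Measure Ω) (Z : ℝ≥0 → Ω → E) (g : E → ℝ) (s : ℝ≥0) :
    compensatedSum P Z g s s = 0 := by
  funext ω
  simp only [compensatedSum, jumpFunctional, jumpSum_self, integral_zero, sub_zero, Pi.zero_apply]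

variable [MeasurableSpace E] [OpensMeasurableSpace E]

lemma IsRegularLevy.identDistrib_compensatedSum [IsProbabilityMeasure P]
    (hZ : IsRegularLevy P Z) (hg : IsJumpTest g) (s h : ℝ≥0) :
    IdentDistrib (compensatedSum P Z g s (s + h)) (compensatedSum P Z g 0 h) P P := by
  have hid := hZ.identDistrib_jumpFunctional hg s h
  convert! hid.comp (measurable_id.sub_const (∫ ω, jumpFunctional Z g 0 h ω ∂P)) using 2
  rw [← hid.integral_eq]
  rfl

variable [MeasurableSub₂ E]

lemma IsRegularLevy.measurable_compensatedSum (hZ : IsRegularLevy P Z) (hg : IsJumpTest g)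
    (hst : s ≤ t) : Measurable (compensatedSum P Z g s t) :=
  (hZ.measurable_jumpFunctional hg hst).sub_const _

lemma IsRegularLevy.iIndepFun_compensatedSum (hZ : IsRegularLevy P Z) {τ : ℕ → ℝ≥0}
    (hτ : Monotone τ) {g : ℕ → E → ℝ} (hg : ∀ j, IsJumpTest (g j)) :
    iIndepFun (fun j => compensatedSum P Z (g j) (τ j) (τ (j + 1))) P :=
  (hZ.iIndepFun_jumpFunctional hτ hg).comp
    (fun j y => y - ∫ ω, jumpFunctional Z (g j) (τ j) (τ (j + 1)) ω ∂P)
    fun _ => measurable_id.sub_const _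

lemma IsRegularLevy.indepFun_compensatedSum (hZ : IsRegularLevy P Z) (hst : s ≤ t)
    (hg : IsJumpTest g) (hh : IsJumpTest h) :
    IndepFun (compensatedSum P Z g 0 s) (compensatedSum P Z h s t) P := by
  let τ : ℕ → ℝ≥0
    | 0 => 0
    | 1 => s
    | _ => t
  let γ : ℕ → E → ℝ
    | 0 => g
    | _ => h
  have hτ : Monotone τ := monotone_nat_of_le_succ fun
    | 0 => zero_le
    | 1 => hst
    | _ + 2 => le_rfl
  have hγ (j : ℕ) : IsJumpTest (γ j) := match j with
    | 0 => hg
    | _ + 1 => hh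
  have hind := (hZ.iIndepFun_compensatedSum hτ hγ).indepFun (i := 0) (j := 1) zero_ne_one
  exact hind

end CompensatedSum

section CompensatedSumLp

variable {Ω : Type*} {mΩ : MeasurableSpace Ω} {P : Measure Ω} [IsProbabilityMeasure P]
variable {E : Type*} [NormedAddCommGroup E] [InnerProductSpace ℝ E] [CompleteSpace E]
  [SecondCountableTopology E] [MeasurableSpace E] [BorelSpace E]
variable {Z : ℝ≥0 → Ω → E} {g h : E → ℝ} {s t u : ℝ≥0}

lemma IsRegularLevy.memLp_jumpFunctional (hZ : IsRegularLevy P Z) (hst : s ≤ t)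
    (hg : IsLinearTest g) : MemLp (jumpFunctional Z g s t) 2 P :=
  (hZ.memLp_and_variance_jumpFunctional_le hst hg.1 hg.2.choose_spec).1

lemma IsRegularLevy.memLp_compensatedSum (hZ : IsRegularLevy P Z) (hst : s ≤ t)
    (hg : IsLinearTest g) : MemLp (compensatedSum P Z g s t) 2 P :=
  (hZ.memLp_jumpFunctional hst hg).sub (memLp_const _)

lemma IsRegularLevy.compensatedSumLp_eq_toLp (hZ : IsRegularLevy P Z) (hst : s ≤ t)
    (hg : IsLinearTest g) : compensatedSumLp P Z g s t = (hZ.memLp_compensatedSum hst hg).toLp :=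
  dif_pos _

lemma IsRegularLevy.coeFn_compensatedSumLp (hZ : IsRegularLevy P Z) (hst : s ≤ t)
    (hg : IsLinearTest g) : compensatedSumLp P Z g s t =ᵐ[P] compensatedSum P Z g s t :=
  hZ.compensatedSumLp_eq_toLp hst hg ▸ MemLp.coeFn_toLp _

lemma IsRegularLevy.integral_compensatedSum (hZ : IsRegularLevy P Z) (hst : s ≤ t)
    (hg : IsLinearTest g) : ∫ ω, compensatedSum P Z g s t ω ∂P = 0 := by
  simp only [compensatedSum]
  rw [integral_sub ((hZ.memLp_jumpFunctional hst hg).integrable one_le_two)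
    (integrable_const _), integral_const, probReal_univ, one_smul, sub_self]

lemma IsRegularLevy.compensatedSum_linear (hZ : IsRegularLevy P Z) (hst : s ≤ t)
    (hg : IsLinearTest g) (hh : IsLinearTest h) (a b : ℝ) :
    compensatedSum P Z (fun x => a * g x + b * h x) s t =
      a • compensatedSum P Z g s t + b • compensatedSum P Z h s t := by
  have hsum (ω : Ω) : jumpFunctional Z (fun x => a * g x + b * h x) s t ω =
      a * jumpFunctional Z g s t ω + b * jumpFunctional Z h s t ω :=
    (hZ.cadlag ω).jumpSum_linear hg.1.eventually_eq_zero hh.1.eventually_eq_zero a b s t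
  funext ω
  simp only [compensatedSum, hsum, Pi.add_apply, Pi.smul_apply, smul_eq_mul]
  rw [integral_add (((hZ.memLp_jumpFunctional hst hg).integrable one_le_two).const_mul a)
    (((hZ.memLp_jumpFunctional hst hh).integrable one_le_two).const_mul b),
    integral_const_mul, integral_const_mul]
  ring

lemma IsRegularLevy.compensatedSumLp_linear (hZ : IsRegularLevy P Z) (hst : s ≤ t)
    (hg : IsLinearTest g) (hh : IsLinearTest h) (a b : ℝ) :
    compensatedSumLp P Z (fun x => a * g x + b * h x) s t =
      a • compensatedSumLp P Z g s t + b • compensatedSumLp P Z h s t := by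
  rw [hZ.compensatedSumLp_eq_toLp hst hg, hZ.compensatedSumLp_eq_toLp hst hh,
    hZ.compensatedSumLp_eq_toLp hst (hg.linear hh a b), ← MemLp.toLp_const_smul,
    ← MemLp.toLp_const_smul, ← MemLp.toLp_add]
  exact MemLp.toLp_congr _ _ (.of_eq (hZ.compensatedSum_linear hst hg hh a b))

lemma IsRegularLevy.compensatedSum_add_compensatedSum (hZ : IsRegularLevy P Z) (hst : s ≤ t)
    (htu : t ≤ u) (hg : IsLinearTest g) :
    compensatedSum P Z g s t + compensatedSum P Z g t u = compensatedSum P Z g s u := by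
  have hsum (ω : Ω) : jumpFunctional Z g s u ω =
      jumpFunctional Z g s t ω + jumpFunctional Z g t u ω :=
    ((hZ.cadlag ω).jumpSum_add_jumpSum hg.1.eventually_eq_zero hst htu).symm
  funext ω
  simp only [compensatedSum, hsum, Pi.add_apply]
  rw [integral_add ((hZ.memLp_jumpFunctional hst hg).integrable one_le_two)
    ((hZ.memLp_jumpFunctional htu hg).integrable one_le_two)]
  ring

lemma IsRegularLevy.compensatedSumLp_add_compensatedSumLp (hZ : IsRegularLevy P Z) (hst : s ≤ t)
    (htu : t ≤ u) (hg : IsLinearTest g) :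
    compensatedSumLp P Z g s t + compensatedSumLp P Z g t u = compensatedSumLp P Z g s u := by
  rw [hZ.compensatedSumLp_eq_toLp hst hg, hZ.compensatedSumLp_eq_toLp htu hg,
    hZ.compensatedSumLp_eq_toLp (hst.trans htu) hg, ← MemLp.toLp_add]
  exact MemLp.toLp_congr _ _ (.of_eq (hZ.compensatedSum_add_compensatedSum hst htu hg))

lemma norm_sq_Lp_two {Ω : Type*} {mΩ : MeasurableSpace Ω} {P : Measure Ω} (Y : Lp ℝ 2 P) :
    ‖Y‖ ^ 2 = ∫ ω, Y ω ^ 2 ∂P := by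
  rw [← real_inner_self_eq_norm_sq, L2.inner_def]
  simp only [real_inner_self_eq_norm_sq, Real.norm_eq_abs, sq_abs]

lemma IsRegularLevy.norm_sq_compensatedSumLp (hZ : IsRegularLevy P Z) (hst : s ≤ t)
    (hg : IsLinearTest g) :
    ‖compensatedSumLp P Z g s t‖ ^ 2 = Var[jumpFunctional Z g s t; P] := by
  rw [norm_sq_Lp_two, variance_eq_integral (hZ.memLp_jumpFunctional hst hg).1.aemeasurable]
  exact integral_congr_ae ((hZ.coeFn_compensatedSumLp hst hg).mono fun ω hω =>
    congrArg (· ^ 2) hω)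

lemma IsRegularLevy.norm_compensatedSumLp_add_right (hZ : IsRegularLevy P Z)
    (hg : IsLinearTest g) (s h : ℝ≥0) :
    ‖compensatedSumLp P Z g s (s + h)‖ = ‖compensatedSumLp P Z g 0 h‖ := by
  rw [← sq_eq_sq₀ (norm_nonneg _) (norm_nonneg _), hZ.norm_sq_compensatedSumLp le_self_add hg,
    hZ.norm_sq_compensatedSumLp zero_le hg]
  exact (hZ.identDistrib_jumpFunctional hg.1 s h).variance_eq

lemma IsRegularLevy.inner_compensatedSumLp (hZ : IsRegularLevy P Z) (hst : s ≤ t)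
    (hg : IsLinearTest g) (hh : IsLinearTest h) :
    inner ℝ (compensatedSumLp P Z g 0 s) (compensatedSumLp P Z h s t) = 0 := by
  calc inner ℝ (compensatedSumLp P Z g 0 s) (compensatedSumLp P Z h s t)
      = ∫ ω, compensatedSum P Z g 0 s ω * compensatedSum P Z h s t ω ∂P := by
        rw [L2.inner_def]
        refine integral_congr_ae ?_
        filter_upwards [hZ.coeFn_compensatedSumLp zero_le hg, hZ.coeFn_compensatedSumLp hst hh]
          with ω hgω hhω
        rw [hgω, hhω]
        exact mul_comm _ _
    _ = 0 := by
        rw [(hZ.indepFun_compensatedSum hst hg.1 hh.1).integral_fun_mul_eq_mul_integral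
          (hZ.memLp_compensatedSum zero_le hg).1 (hZ.memLp_compensatedSum hst hh).1,
          hZ.integral_compensatedSum zero_le hg, zero_mul]

end CompensatedSumLp

section CompensatedSumLimit

variable {Ω : Type*} {mΩ : MeasurableSpace Ω} {P : Measure Ω} [IsProbabilityMeasure P]
variable {E : Type*} [NormedAddCommGroup E] [InnerProductSpace ℝ E] [CompleteSpace E]
  [SecondCountableTopology E] [MeasurableSpace E] [BorelSpace E]
variable {Z : ℝ≥0 → Ω → E} {s t : ℝ≥0}
variable {ι : Type*} {l : Filter ι} [l.IsCountablyGenerated] {g h : ι → E → ℝ} {f : E → ℝ}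

lemma IsRegularLevy.tendsto_compensatedSumLp_zero (hZ : IsRegularLevy P Z) (hst : s ≤ t)
    (hg : TestApprox g l 0) : Tendsto (fun i => compensatedSumLp P Z (g i) s t) l (𝓝 0) := by
  obtain ⟨C, hC⟩ := hg.bound
  have hsq : Tendsto (fun i => ‖compensatedSumLp P Z (g i) s t‖ ^ 2) l (𝓝 0) := by
    refine squeeze_zero' (.of_forall fun i => sq_nonneg _) ?_
      (hZ.tendsto_integral_jumpFunctional_zero hst (h := fun i x => g i x ^ 2) (C := C ^ 2)
        (hg.isJumpTest.mono fun i hi => hi.comp (continuous_pow 2) (zero_pow two_ne_zero))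
        (hC.mono fun i hi => abs_sq_le_mul_sq_norm hi)
        fun x => by simpa only [Pi.zero_apply, zero_pow two_ne_zero] using (hg.tendsto x).pow 2)
    filter_upwards [hg.isJumpTest, hC] with i hi hCi
    rw [hZ.norm_sq_compensatedSumLp hst ⟨hi, C, hCi⟩]
    exact (hZ.memLp_and_variance_jumpFunctional_le hst hi hCi).2
  rw [tendsto_zero_iff_norm_tendsto_zero]
  simpa only [Real.sqrt_sq (norm_nonneg _), Real.sqrt_zero] using hsq.sqrt

lemma IsRegularLevy.tendsto_compensatedSumLp_sub (hZ : IsRegularLevy P Z) (hst : s ≤ t)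
    (hg : TestApprox g l f) (hh : TestApprox h l f) :
    Tendsto (fun i => compensatedSumLp P Z (g i) s t - compensatedSumLp P Z (h i) s t) l
      (𝓝 0) := by
  have hsub : TestApprox (fun i x => 1 * g i x + -1 * h i x) l 0 := by
    convert! hg.linear hh 1 (-1) using 1
    funext x
    rw [one_mul, neg_one_mul, add_neg_cancel, Pi.zero_apply]
  refine (hZ.tendsto_compensatedSumLp_zero hst hsub).congr' ?_
  filter_upwards [hg.isLinearTest, hh.isLinearTest] with i hgi hhi
  rw [hZ.compensatedSumLp_linear hst hgi hhi, one_smul, neg_one_smul, sub_eq_add_neg]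

lemma IsRegularLevy.exists_tendsto_compensatedSumLp [l.NeBot] (hZ : IsRegularLevy P Z)
    (hst : s ≤ t) (hg : TestApprox g l f) :
    ∃ Y, Tendsto (fun i => compensatedSumLp P Z (g i) s t) l (𝓝 Y) := by
  refine cauchy_map_iff_exists_tendsto.1 (cauchy_map_iff.2 ⟨inferInstance, ?_⟩)
  rw [tendsto_uniformity_iff_dist_tendsto_zero]
  simpa only [dist_eq_norm, norm_zero] using
    (hZ.tendsto_compensatedSumLp_sub hst (hg.comp_tendsto tendsto_fst)
      (hg.comp_tendsto (tendsto_snd (f := l)))).norm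

end CompensatedSumLimit

/-! ### Càdlàg paths of compensated jump sums -/

section CadlagPaths

variable {E : Type*} [NormedAddCommGroup E] {f g : ℝ≥0 → E}

lemma isCadlagPath_of_continuous (hf : Continuous f) : IsCadlagPath f := fun t =>
  ⟨hf.continuousWithinAt, f t, hf.continuousAt.tendsto.mono_left nhdsWithin_le_nhds⟩

lemma IsCadlagPath.sub (hf : IsCadlagPath f) (hg : IsCadlagPath g) :
    IsCadlagPath fun t => f t - g t := fun t =>
  ⟨(hf t).1.sub (hg t).1, _, (hf.tendsto_nhdsLT t).sub (hg.tendsto_nhdsLT t)⟩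

/-- `f` jumps inside the support of `g` nowhere near `t`, except possibly at `t` itself; hence the
jump sum is constant to the right and to the left of `t`. -/
lemma IsCadlagPath.isCadlagPath_jumpSum (hf : IsCadlagPath f) {φ : E → ℝ}
    (hφ : ∀ᶠ x in 𝓝 0, φ x = 0) : IsCadlagPath fun t => jumpSum φ f 0 t := by
  have hconst {s t : ℝ≥0} (h : ∀ r ∈ Set.Ioc s t, φ (pathJump f r) = 0) :
      jumpSum φ f s t = 0 := by
    rw [jumpSum_eq_sum (R := ∅) (by simp) fun r hr _ => h r hr, Finset.sum_empty]
  have hsplit {s t : ℝ≥0} (hst : s ≤ t) (h : ∀ r ∈ Set.Ioc s t, φ (pathJump f r) = 0) :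
      jumpSum φ f 0 t = jumpSum φ f 0 s := by
    rw [← hf.jumpSum_add_jumpSum hφ zero_le hst, hconst h, add_zero]
  intro t
  have hev : ∀ᶠ r in 𝓝[≠] t, φ (pathJump f r) = 0 := (hf.tendsto_pathJump_nhdsNE t).eventually hφ
  constructor
  · obtain ⟨u, htu, hu⟩ := mem_nhdsGT_iff_exists_Ioc_subset.1
      (hev.filter_mono (nhdsWithin_mono t fun r (hr : t < r) => hr.ne'))
    refine tendsto_const_nhds.congr' ?_
    filter_upwards [Icc_mem_nhdsGE htu] with v hv
    exact (hsplit hv.1 fun r hr => hu ⟨hr.1, hr.2.trans hv.2⟩).symm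
  · rcases eq_or_ne t 0 with rfl | ht
    · exact ⟨0, by simp⟩
    obtain ⟨w, hw, hwt⟩ := (mem_nhdsLT_iff_exists_Ioo_subset' (pos_iff_ne_zero.2 ht)).1
      (hev.filter_mono (nhdsWithin_mono t fun r (hr : r < t) => hr.ne))
    refine ⟨jumpSum φ f 0 w, tendsto_const_nhds.congr' ?_⟩
    filter_upwards [Ico_mem_nhdsLT hw] with v hv
    exact (hsplit hv.1 fun r hr => hwt ⟨hr.1, hr.2.trans_lt hv.2⟩).symm

lemma IsCadlagPath.eventually_exists_grid (hf : IsCadlagPath f) {t T : ℝ≥0} (ht : 0 < t)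
    (htT : t ≤ T) {V : Set E} (hV : V ∈ 𝓝 (f t)) :
    ∀ᶠ n in atTop, ∃ k < n, f (grid 0 T n (k + 1)) ∈ V := by
  obtain ⟨k, hk⟩ := exists_gridIndex (zero_le : 0 ≤ T)
  have hkt : ∀ᶠ n in atTop, k n t < n ∧ t ∈ Set.Ioc (grid 0 T n (k n t)) (grid 0 T n (k n t + 1)) :=
    (eventually_ne_atTop 0).mono fun n hn => hk n hn t ⟨ht, htT⟩
  have hlim := (hf.tendsto_nhdsGE t).comp (tendsto_grid_succ_nhdsGE (hkt.mono fun _ h => h.2))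
  filter_upwards [hkt, hlim.eventually hV] with n hn hVn
  exact ⟨k n t, hn.1, hVn⟩

lemma exists_tendsto_of_tendstoUniformlyOnFilter {α ι β : Type*} [UniformSpace β]
    [CompleteSpace β] {p : Filter ι} [p.NeBot] {l : Filter α} {F : ι → α → β} {f : α → β}
    (h : TendstoUniformlyOnFilter F f p l) (hF : ∀ i, ∃ y, Tendsto (F i) l (𝓝 y)) :
    ∃ y, Tendsto f l (𝓝 y) := by
  rcases l.eq_or_neBot with rfl | hl
  · obtain ⟨i⟩ := p.nonempty_of_neBot
    exact ⟨(hF i).choose, tendsto_bot⟩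
  refine CompleteSpace.complete (cauchy_map_iff'.2 fun V hV => ?_)
  change ∀ᶠ q in l ×ˢ l, (f q.1, f q.2) ∈ V
  obtain ⟨W, hW, hsymm, hWV⟩ := comp_comp_symm_mem_uniformity_sets hV
  obtain ⟨i, hi : ∀ᶠ x in l, (f x, F i x) ∈ W⟩ := (h W hW).curry.exists
  obtain ⟨y, hy⟩ := hF i
  have hpair : ∀ᶠ q in l ×ˢ l, (F i q.1, F i q.2) ∈ W :=
    (cauchy_map_iff'.1 hy.cauchy_map).eventually hW
  filter_upwards [hpair, hi.prod_inl l, hi.prod_inr l] with q hq h₁ h₂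
  exact hWV ⟨_, ⟨_, h₁, hq⟩, hsymm.symm _ _ h₂⟩

lemma isCadlagPath_of_tendstoUniformlyOn [CompleteSpace E] {F : ℕ → ℝ≥0 → E}
    (hF : ∀ n, IsCadlagPath (F n)) (hlim : ∀ T, TendstoUniformlyOn F f atTop (Set.Iic T)) :
    IsCadlagPath f := by
  intro t
  have hnhds : TendstoUniformlyOnFilter F f atTop (𝓝 t) :=
    (hlim (t + 1)).tendstoUniformlyOnFilter.mono_right
      (le_principal_iff.2 (Iic_mem_nhds (lt_add_one t)))
  have ht : Tendsto (fun n => F n t) atTop (𝓝 (f t)) := (hlim t).tendsto_at (Set.self_mem_Iic)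
  exact ⟨(hnhds.mono_right nhdsWithin_le_nhds).tendsto_of_eventually_tendsto
      (Eventually.of_forall fun n => (hF n t).1) ht,
    exists_tendsto_of_tendstoUniformlyOnFilter (hnhds.mono_right nhdsWithin_le_nhds)
      fun n => (hF n t).2⟩

lemma isCadlagPath_add_tsum_sub [CompleteSpace E] {y : ℕ → ℝ≥0 → E} (hy : ∀ k, IsCadlagPath (y k))
    {u : ℕ → ℝ} (hu : Summable u)
    (h : ∀ T, ∀ᶠ k in atTop, ∀ t ≤ T, ‖y (k + 1) t - y k t‖ ≤ u k) :
    IsCadlagPath (fun t => y 0 t + ∑' k, (y (k + 1) t - y k t)) ∧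
      ∀ t, Tendsto (fun k => y k t) atTop (𝓝 (y 0 t + ∑' k, (y (k + 1) t - y k t))) := by
  have hunif (T : ℝ≥0) : TendstoUniformlyOn y
      (fun t => y 0 t + ∑' k, (y (k + 1) t - y k t)) atTop (Set.Iic T) := by
    have hdist := Metric.tendstoUniformlyOn_iff.1 (tendstoUniformlyOn_tsum_nat_eventually hu (h T))
    refine Metric.tendstoUniformlyOn_iff.2 fun ε hε => (hdist ε hε).mono fun n hn t ht => ?_
    rw [← add_sub_cancel (y 0 t) (y n t), ← Finset.sum_range_sub (fun k => y k t), dist_add_left]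
    exact hn t ht
  exact ⟨isCadlagPath_of_tendstoUniformlyOn hy hunif,
    fun t => (hunif t).tendsto_at Set.self_mem_Iic⟩

lemma exists_cadlag_tendsto_of_tsum_measure_ne_top [CompleteSpace E] {Ω : Type*}
    {mΩ : MeasurableSpace Ω} {P : Measure Ω} {Y : ℕ → ℝ≥0 → Ω → E}
    (hY : ∀ k ω, IsCadlagPath fun t => Y k t ω) {u : ℕ → ℝ} (hu : Summable u)
    (hP : ∑' k : ℕ, P {ω | ∃ t ≤ (k : ℝ≥0), u k < ‖Y (k + 1) t ω - Y k t ω‖} ≠ ∞) :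
    ∃ m : ℝ≥0 → Ω → E, (∀ ω, IsCadlagPath fun t => m t ω) ∧
      ∀ᵐ ω ∂P, ∀ t, Tendsto (fun k => Y k t ω) atTop (𝓝 (m t ω)) := by
  have hgood : ∀ᵐ ω ∂P, ∃ y : ℝ≥0 → E, IsCadlagPath y ∧
      ∀ t, Tendsto (fun k => Y k t ω) atTop (𝓝 (y t)) := by
    filter_upwards [ae_eventually_notMem hP] with ω hω
    refine ⟨_, isCadlagPath_add_tsum_sub (fun k => hY k ω) hu fun T => ?_⟩
    filter_upwards [hω, (tendsto_natCast_atTop_atTop (R := ℝ≥0)).eventually_ge_atTop T]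
      with k hk hTk t ht
    exact not_lt.1 fun hlt => hk ⟨t, ht.trans hTk, hlt⟩
  have hex (ω : Ω) : ∃ y : ℝ≥0 → E, IsCadlagPath y ∧
      ((∃ y : ℝ≥0 → E, IsCadlagPath y ∧ ∀ t, Tendsto (fun k => Y k t ω) atTop (𝓝 (y t))) →
        ∀ t, Tendsto (fun k => Y k t ω) atTop (𝓝 (y t))) := by
    by_cases h : ∃ y : ℝ≥0 → E, IsCadlagPath y ∧ ∀ t, Tendsto (fun k => Y k t ω) atTop (𝓝 (y t))
    · exact ⟨h.choose, h.choose_spec.1, fun _ => h.choose_spec.2⟩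
    · exact ⟨0, isCadlagPath_of_continuous continuous_zero, fun h' => absurd h' h⟩
  choose y hy hlim using hex
  exact ⟨fun t ω => y ω t, hy, hgood.mono hlim⟩

end CadlagPaths

section MaximalInequality

lemma measure_le_of_eventually_mem {Ω : Type*} {mΩ : MeasurableSpace Ω} {P : Measure Ω}
    {A : ℕ → Set Ω} {S : Set Ω} {b : ℝ≥0∞} (hS : ∀ ω ∈ S, ∀ᶠ n in atTop, ω ∈ A n)
    (hA : ∀ n, P (A n) ≤ b) : P S ≤ b := by
  have hsub : S ⊆ ⋃ N, ⋂ n ≥ N, A n := fun ω hω => by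
    simpa only [Set.mem_iUnion, Set.mem_iInter] using eventually_atTop.1 (hS ω hω)
  refine (measure_mono hsub).trans ?_
  rw [Monotone.measure_iUnion fun N M hNM => Set.biInter_subset_biInter_left
    fun n (hn : M ≤ n) => hNM.trans hn]
  exact iSup_le fun N => (measure_mono (Set.biInter_subset_of_mem le_rfl)).trans (hA N)

variable {Ω : Type*} {mΩ : MeasurableSpace Ω} {P : Measure Ω} [IsProbabilityMeasure P]
variable {E : Type*} [NormedAddCommGroup E] [InnerProductSpace ℝ E] [CompleteSpace E]
  [SecondCountableTopology E] [MeasurableSpace E] [BorelSpace E]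
variable {Z : ℝ≥0 → Ω → E} {g : E → ℝ}

lemma IsRegularLevy.isCadlagPath_compensatedSum (hZ : IsRegularLevy P Z) (hg : IsLinearTest g)
    (ω : Ω) : IsCadlagPath fun t => compensatedSum P Z g 0 t ω := by
  obtain ⟨C, hC⟩ := hg.2
  obtain ⟨K, hK⟩ := exists_abs_le_mul_sq_norm (G := fun _ : Unit => g)
    (hg.1.eventually_eq_zero.mono fun _ hx _ => hx) fun _ => hC
  refine ((hZ.cadlag ω).isCadlagPath_jumpSum hg.1.eventually_eq_zero).sub
    (isCadlagPath_of_continuous ?_)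
  exact (NNReal.continuous_coe.mul continuous_const).congr fun t =>
    (hZ.integral_jumpFunctional hg.1 (hK ()) t).symm

lemma IsRegularLevy.sum_compensatedSum (hZ : IsRegularLevy P Z) (hg : IsLinearTest g)
    {τ : ℕ → ℝ≥0} (hτ : Monotone τ) (n : ℕ) :
    ∑ i ∈ Finset.range n, compensatedSum P Z g (τ i) (τ (i + 1)) =
      compensatedSum P Z g (τ 0) (τ n) := by
  induction n with
  | zero => rw [compensatedSum_self, Finset.sum_range_zero]
  | succ n ih =>
    rw [Finset.sum_range_succ, ih,
      hZ.compensatedSum_add_compensatedSum (hτ n.zero_le) (hτ n.le_succ) hg]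

lemma IsRegularLevy.measure_exists_grid_le (hZ : IsRegularLevy P Z) (hg : IsLinearTest g)
    (T : ℝ≥0) (n : ℕ) {c : ℝ} (hc : 0 < c) :
    P {ω | ∃ k < n, c < |compensatedSum P Z g 0 (grid 0 T n (k + 1)) ω|} ≤
      ENNReal.ofReal (‖compensatedSumLp P Z g 0 T‖ ^ 2 / c ^ 2) := by
  rcases n with - | n
  · simp
  have hmono := grid_mono 0 T (n + 1)
  have hsum (k : ℕ) (ω : Ω) : ∑ i ∈ Finset.range k, compensatedSum P Z g (grid 0 T (n + 1) i)
      (grid 0 T (n + 1) (i + 1)) ω = compensatedSum P Z g 0 (grid 0 T (n + 1) k) ω := by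
    rw [← Finset.sum_apply, hZ.sum_compensatedSum hg hmono, grid_zero]
  have hstep (i : ℕ) := hmono i.le_succ
  have hmax := kolmogorov_maximal (hZ.iIndepFun_compensatedSum hmono fun _ => hg.1)
    (fun i => (hZ.measurable_compensatedSum hg.1 (hstep i)).stronglyMeasurable)
    (fun i => hZ.memLp_compensatedSum (hstep i) hg)
    (fun i => hZ.integral_compensatedSum (hstep i) hg) n hc
  simp only [hsum, grid_self zero_le n.succ_ne_zero] at hmax
  have hnorm : ‖compensatedSumLp P Z g 0 T‖ ^ 2 = ∫ ω, compensatedSum P Z g 0 T ω ^ 2 ∂P :=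
    (norm_sq_Lp_two _).trans
      (integral_congr_ae ((hZ.coeFn_compensatedSumLp zero_le hg).fun_comp (· ^ 2)))
  rw [hnorm]
  refine (ENNReal.le_ofReal_iff_toReal_le (measure_ne_top _ _) (by positivity)).2 ?_
  refine (measureReal_mono ?_).trans hmax
  exact fun ω ⟨k, hk, h⟩ => ⟨k, Nat.lt_succ_iff.1 hk, h.le⟩

/-- By right continuity, a path exceeding the level does so on all sufficiently fine grids. -/
lemma IsRegularLevy.measure_exists_compensatedSum_le (hZ : IsRegularLevy P Z)
    (hg : IsLinearTest g) (T : ℝ≥0) {c : ℝ} (hc : 0 < c) :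
    P {ω | ∃ t ≤ T, c < |compensatedSum P Z g 0 t ω|} ≤
      ENNReal.ofReal (‖compensatedSumLp P Z g 0 T‖ ^ 2 / c ^ 2) := by
  refine measure_le_of_eventually_mem (fun ω ⟨t, htT, ht⟩ => ?_)
    fun n => hZ.measure_exists_grid_le hg T n hc
  have h0 : 0 < t := by
    refine pos_iff_ne_zero.2 fun h => ht.not_ge ?_
    simp [h, compensatedSum_self, hc.le]
  exact (hZ.isCadlagPath_compensatedSum hg ω).eventually_exists_grid h0 htT
    ((isOpen_lt continuous_const continuous_abs).mem_nhds ht)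

end MaximalInequality

/-! ### The `L²`-limit of compensated jump sums as a process -/

section JumpLimit

variable {Ω : Type*} {mΩ : MeasurableSpace Ω} {P : Measure Ω} [IsProbabilityMeasure P]
variable {E : Type*} [NormedAddCommGroup E] [InnerProductSpace ℝ E] [MeasurableSpace E]

/-- `M` is the process of compensated sums of the jumps of `ℓ(Z)`, obtained in `L²(Ω, P)` by
letting the truncation level of the jump sizes tend to `0`. -/
def IsJumpLimit (P : Measure Ω) (Z : ℝ≥0 → Ω → E) (ℓ : E →L[ℝ] ℝ) (M : ℝ≥0 → Lp ℝ 2 P) : Prop :=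
  ∀ t, Tendsto (fun ε => compensatedSumLp P Z (fun x => trunc ε (ℓ x)) 0 t) (𝓝[>] 0) (𝓝 (M t))

variable [CompleteSpace E] [SecondCountableTopology E] [BorelSpace E]
variable {Z : ℝ≥0 → Ω → E} {ℓ ℓ' : E →L[ℝ] ℝ} {M M' : ℝ≥0 → Lp ℝ 2 P} {s t : ℝ≥0}

lemma IsRegularLevy.exists_isJumpLimit (hZ : IsRegularLevy P Z) (ℓ : E →L[ℝ] ℝ) :
    ∃ M, IsJumpLimit P Z ℓ M :=
  Classical.skolem.1 fun _ => hZ.exists_tendsto_compensatedSumLp zero_le (testApprox_trunc ℓ)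

/-- Both sides are limits of compensated sums of test functions approximating the same functional
`a • ℓ + b • ℓ'`. -/
lemma IsJumpLimit.linear {M'' : ℝ≥0 → Lp ℝ 2 P} (hZ : IsRegularLevy P Z)
    (hM : IsJumpLimit P Z ℓ M) (hM' : IsJumpLimit P Z ℓ' M') (a b : ℝ)
    (hM'' : IsJumpLimit P Z (a • ℓ + b • ℓ') M'') (t : ℝ≥0) :
    M'' t = a • M t + b • M' t := by
  have happrox := (testApprox_trunc ℓ).linear (testApprox_trunc ℓ') a b
  have hlim := hZ.tendsto_compensatedSumLp_sub zero_le (t := t)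
    (testApprox_trunc (a • ℓ + b • ℓ')) happrox
  refine sub_eq_zero.1 (tendsto_nhds_unique ((hM'' t).sub (((hM t).const_smul a).add
    ((hM' t).const_smul b))) (hlim.congr' ?_))
  filter_upwards [self_mem_nhdsWithin] with ε hε
  rw [hZ.compensatedSumLp_linear zero_le (isLinearTest_trunc ℓ hε) (isLinearTest_trunc ℓ' hε)]

lemma IsJumpLimit.tendsto_sub (hZ : IsRegularLevy P Z) (hM : IsJumpLimit P Z ℓ M) (hst : s ≤ t) :
    Tendsto (fun ε => compensatedSumLp P Z (fun x => trunc ε (ℓ x)) s t) (𝓝[>] 0)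
      (𝓝 (M t - M s)) := by
  refine ((hM t).sub (hM s)).congr' ?_
  filter_upwards [self_mem_nhdsWithin] with ε hε
  rw [← hZ.compensatedSumLp_add_compensatedSumLp zero_le hst (isLinearTest_trunc ℓ hε),
    add_sub_cancel_left]

lemma IsJumpLimit.inner_sub (hZ : IsRegularLevy P Z) (hM : IsJumpLimit P Z ℓ M)
    (hM' : IsJumpLimit P Z ℓ' M') (hst : s ≤ t) : inner ℝ (M s) (M' t - M' s) = 0 := by
  refine tendsto_nhds_unique ((hM s).inner (hM'.tendsto_sub hZ hst))
    (tendsto_const_nhds.congr' ?_)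
  filter_upwards [self_mem_nhdsWithin] with ε hε
  exact (hZ.inner_compensatedSumLp hst (isLinearTest_trunc ℓ hε) (isLinearTest_trunc ℓ' hε)).symm

lemma IsJumpLimit.norm_sub (hZ : IsRegularLevy P Z) (hM : IsJumpLimit P Z ℓ M) (s h : ℝ≥0) :
    ‖M (s + h) - M s‖ = ‖M h‖ := by
  refine tendsto_nhds_unique (hM.tendsto_sub hZ le_self_add).norm ((hM h).norm.congr' ?_)
  filter_upwards [self_mem_nhdsWithin] with ε hε
  exact (hZ.norm_compensatedSumLp_add_right (isLinearTest_trunc ℓ hε) s h).symm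

lemma IsJumpLimit.norm_sq (hZ : IsRegularLevy P Z) (hM : IsJumpLimit P Z ℓ M) (t : ℝ≥0) :
    ‖M t‖ ^ 2 = t * ‖M 1‖ ^ 2 := by
  have hadd (s h : ℝ≥0) : ‖M (s + h)‖ ^ 2 = ‖M s‖ ^ 2 + ‖M h‖ ^ 2 := by
    have horth := hM.inner_sub hZ hM (le_self_add : s ≤ s + h)
    have hpyth := norm_add_sq_real (M s) (M (s + h) - M s)
    rwa [add_sub_cancel, horth, hM.norm_sub hZ, mul_zero, add_zero] at hpyth
  refine eq_mul_of_additive_of_bounded (φ := fun t => ‖M t‖ ^ 2) (C := ‖M 1‖ ^ 2) hadd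
    (fun s hs => ?_) t
  obtain ⟨h, hh⟩ := exists_add_of_le hs
  rw [abs_of_nonneg (sq_nonneg _), hh, hadd]
  exact le_add_of_nonneg_right (sq_nonneg _)

lemma IsJumpLimit.norm_sub_sq (hZ : IsRegularLevy P Z) (hM : IsJumpLimit P Z ℓ M) (s t : ℝ≥0) :
    ‖M t - M s‖ ^ 2 = dist t s * ‖M 1‖ ^ 2 := by
  wlog hst : s ≤ t generalizing s t
  · rw [norm_sub_rev, dist_comm, this t s (le_of_not_ge hst)]
  obtain ⟨h, rfl⟩ := exists_add_of_le hst
  rw [hM.norm_sub hZ, hM.norm_sq hZ, NNReal.dist_eq, NNReal.coe_add, add_sub_cancel_left,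
    abs_of_nonneg h.coe_nonneg]

lemma IsJumpLimit.continuous (hZ : IsRegularLevy P Z) (hM : IsJumpLimit P Z ℓ M) :
    Continuous M := by
  refine continuous_iff_continuousAt.2 fun t => tendsto_iff_norm_sub_tendsto_zero.2 ?_
  have hsqrt : Tendsto (fun s => √(dist s t * ‖M 1‖ ^ 2)) (𝓝 t) (𝓝 0) := by
    have hcont : Continuous fun s => √(dist s t * ‖M 1‖ ^ 2) := by fun_prop
    simpa using hcont.tendsto t
  refine hsqrt.congr fun s => ?_
  rw [← hM.norm_sub_sq hZ, Real.sqrt_sq (norm_nonneg _)]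

lemma inner_Lp_const_one (Y : Lp ℝ 2 P) : inner ℝ (Lp.const 2 P (1 : ℝ)) Y = ∫ ω, Y ω ∂P := by
  simp [L2.inner_def]

lemma IsJumpLimit.integral_eq_zero (hZ : IsRegularLevy P Z) (hM : IsJumpLimit P Z ℓ M)
    (t : ℝ≥0) : ∫ ω, M t ω ∂P = 0 := by
  rw [← inner_Lp_const_one]
  refine tendsto_nhds_unique (tendsto_const_nhds.inner (hM t)) (tendsto_const_nhds.congr' ?_)
  filter_upwards [self_mem_nhdsWithin] with ε hε
  have hlin := isLinearTest_trunc ℓ hε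
  rw [inner_Lp_const_one, integral_congr_ae (hZ.coeFn_compensatedSumLp zero_le hlin),
    hZ.integral_compensatedSum zero_le hlin]

end JumpLimit

/-! ### A càdlàg Lévy version of the limit process -/

section CadlagVersion

lemma exists_seq_tendsto_dist_le {ι X : Type*} [PseudoMetricSpace X] {l : Filter ι} [l.NeBot]
    [l.IsCountablyGenerated] {F : ℕ → ι → X} {y : ℕ → X} (h : ∀ k, Tendsto (F k) l (𝓝 (y k)))
    {δ : ℕ → ℝ} (hδ : ∀ k, 0 < δ k) {p : ι → Prop} (hp : ∀ᶠ i in l, p i) :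
    ∃ u : ℕ → ι, (∀ k, p (u k)) ∧ Tendsto u atTop l ∧
      ∀ k, dist (F k (u (k + 1))) (F k (u k)) ≤ δ k := by
  obtain ⟨v, hv⟩ := exists_seq_tendsto l
  have hclose (k : ℕ) : ∀ᶠ n in atTop, p (v n) ∧ ∀ n' ≥ n, dist (F k (v n')) (y k) ≤ δ k / 2 :=
    (hv.eventually hp).and (eventually_forall_ge_atTop.2 (((h k).comp hv).eventually
      (Metric.closedBall_mem_nhds _ (half_pos (hδ k)))))
  obtain ⟨φ, hφ, hφδ⟩ := extraction_forall_of_eventually hclose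
  refine ⟨v ∘ φ, fun k => (hφδ k).1, hv.comp hφ.tendsto_atTop, fun k => ?_⟩
  calc dist (F k (v (φ (k + 1)))) (F k (v (φ k)))
      ≤ dist (F k (v (φ (k + 1)))) (y k) + dist (F k (v (φ k))) (y k) :=
        dist_triangle_right _ _ _
    _ ≤ δ k / 2 + δ k / 2 := add_le_add ((hφδ k).2 _ (hφ k.lt_succ_self).le) ((hφδ k).2 _ le_rfl)
    _ = δ k := add_halves _

variable {Ω : Type*} {mΩ : MeasurableSpace Ω} {P : Measure Ω} [IsProbabilityMeasure P]
variable {E : Type*} [NormedAddCommGroup E] [InnerProductSpace ℝ E] [CompleteSpace E]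
  [SecondCountableTopology E] [MeasurableSpace E] [BorelSpace E]
variable {Z : ℝ≥0 → Ω → E} {ℓ : E →L[ℝ] ℝ} {M : ℝ≥0 → Lp ℝ 2 P}

lemma IsRegularLevy.measure_exists_sub_le (hZ : IsRegularLevy P Z) {g h : E → ℝ}
    (hg : IsLinearTest g) (hh : IsLinearTest h) (T : ℝ≥0) {c : ℝ} (hc : 0 < c) :
    P {ω | ∃ t ≤ T, c < ‖compensatedSum P Z g 0 t ω - compensatedSum P Z h 0 t ω‖} ≤
      ENNReal.ofReal (dist (compensatedSumLp P Z g 0 T) (compensatedSumLp P Z h 0 T) ^ 2 /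
        c ^ 2) := by
  have hmax := hZ.measure_exists_compensatedSum_le (hg.linear hh 1 (-1)) T hc
  simp only [hZ.compensatedSumLp_linear zero_le hg hh, hZ.compensatedSum_linear zero_le hg hh,
    one_smul, neg_one_smul, ← sub_eq_add_neg, Pi.sub_apply] at hmax
  rwa [dist_eq_norm]

lemma IsJumpLimit.exists_seq_tsum_measure_ne_top (hZ : IsRegularLevy P Z)
    (hM : IsJumpLimit P Z ℓ M) :
    ∃ ε : ℕ → ℝ, (∀ k, 0 < ε k) ∧ Tendsto ε atTop (𝓝[>] 0) ∧
      ∑' k : ℕ, P {ω | ∃ t ≤ (k : ℝ≥0), (1 / 2 : ℝ) ^ k <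
        ‖compensatedSum P Z (fun x => trunc (ε (k + 1)) (ℓ x)) 0 t ω -
          compensatedSum P Z (fun x => trunc (ε k) (ℓ x)) 0 t ω‖} ≠ ∞ := by
  obtain ⟨ε, hpos, hε, hdist⟩ := exists_seq_tendsto_dist_le (fun k : ℕ => hM k)
    (δ := fun k => (1 / 8) ^ k) (fun k => by positivity) self_mem_nhdsWithin
  have hlin (k : ℕ) := isLinearTest_trunc ℓ (hpos k)
  refine ⟨ε, hpos, hε, ne_top_of_le_ne_top (summable_geometric_of_lt_one (r := 1 / 16)
    (by norm_num) (by norm_num)).tsum_ofReal_ne_top (ENNReal.tsum_le_tsum fun k => ?_)⟩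
  refine (hZ.measure_exists_sub_le (hlin (k + 1)) (hlin k) k (by positivity)).trans
    (ENNReal.ofReal_le_ofReal ((div_le_iff₀ (by positivity)).2 ?_))
  calc _ ≤ ((1 / 8 : ℝ) ^ k) ^ 2 := pow_le_pow_left₀ dist_nonneg (hdist k) 2
    _ = (1 / 16) ^ k * ((1 / 2) ^ k) ^ 2 := by
      simp only [← pow_mul, mul_comm k 2]
      rw [pow_mul, pow_mul, ← mul_pow]
      norm_num

lemma IsRegularLevy.isLevyProcess_of_tendsto_compensatedSum (hZ : IsRegularLevy P Z)
    {g : ℕ → E → ℝ} (hg : ∀ k, IsLinearTest (g k)) {m : ℝ≥0 → Ω → ℝ}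
    (hm : ∀ᵐ ω ∂P, ∀ t, Tendsto (fun k => compensatedSum P Z (g k) 0 t ω) atTop (𝓝 (m t ω)))
    (hcont : ∀ t, TendstoInMeasure P m (𝓝 t) (m t)) : IsLevyProcess P m := by
  have hincr {s t : ℝ≥0} (hst : s ≤ t) : ∀ᵐ ω ∂P,
      Tendsto (fun k => compensatedSum P Z (g k) s t ω) atTop (𝓝 ((m t - m s) ω)) := by
    filter_upwards [hm] with ω hω
    refine ((hω t).sub (hω s)).congr fun k => ?_
    rw [← hZ.compensatedSum_add_compensatedSum zero_le hst (hg k), Pi.add_apply,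
      add_sub_cancel_left]
  have hmeas {s t : ℝ≥0} (hst : s ≤ t) (k : ℕ) : AEMeasurable (compensatedSum P Z (g k) s t) P :=
    (hZ.measurable_compensatedSum (hg k).1 hst).aemeasurable
  refine ⟨fun t => ?_, ?_, ?_, fun s h => ?_, hcont⟩
  · exact aemeasurable_of_tendsto_metrizable_ae' (hmeas zero_le) (hm.mono fun ω h => h t)
  · filter_upwards [hm] with ω hω
    refine tendsto_nhds_unique (hω 0) (tendsto_const_nhds.congr fun k => ?_)
    rw [compensatedSum_self, Pi.zero_apply]
  · refine HasIndepIncrements.of_nat fun τ hτ _ => ?_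
    exact iIndepFun_of_tendsto_ae (Y := fun k i => compensatedSum P Z (g k) (τ i) (τ (i + 1)))
      (fun k i => hmeas (hτ i.le_succ) k)
      (fun k => hZ.iIndepFun_compensatedSum hτ fun _ => (hg k).1) fun i => hincr (hτ i.le_succ)
  · exact identDistrib_of_tendsto_ae (fun k => hZ.identDistrib_compensatedSum (hg k).1 s h)
      (hincr le_self_add) (hincr zero_le)

theorem IsJumpLimit.exists_cadlag_version (hZ : IsRegularLevy P Z) (hM : IsJumpLimit P Z ℓ M) :
    ∃ m : ℝ≥0 → Ω → ℝ, IsLevyProcess P m ∧ (∀ ω, IsCadlag fun t => m t ω) ∧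
      ∀ t, m t =ᵐ[P] M t := by
  obtain ⟨ε, hpos, hε, hsum⟩ := hM.exists_seq_tsum_measure_ne_top hZ
  have hlin (k : ℕ) := isLinearTest_trunc ℓ (hpos k)
  obtain ⟨m, hcadlag, hm⟩ := exists_cadlag_tendsto_of_tsum_measure_ne_top
    (fun k ω => hZ.isCadlagPath_compensatedSum (hlin k) ω) summable_geometric_two hsum
  have hversion (t : ℝ≥0) : m t =ᵐ[P] M t := by
    have hae : TendstoInMeasure P (fun k => compensatedSum P Z (fun x => trunc (ε k) (ℓ x)) 0 t)
        atTop (m t) :=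
      tendstoInMeasure_of_tendsto_ae
        (fun k => (hZ.measurable_compensatedSum (hlin k).1 zero_le).aestronglyMeasurable)
        (hm.mono fun ω h => h t)
    exact tendstoInMeasure_ae_unique hae
      ((tendstoInMeasure_of_tendsto_Lp ((hM t).comp hε)).congr_left fun k =>
        hZ.coeFn_compensatedSumLp zero_le (hlin k))
  refine ⟨m, hZ.isLevyProcess_of_tendsto_compensatedSum hlin hm fun t => ?_, hcadlag, hversion⟩
  exact (tendstoInMeasure_of_tendsto_Lp ((hM.continuous hZ).tendsto t)).congr
    (fun s => (hversion s).symm) (hversion t).symm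

end CadlagVersion

/-! ### The jump measure and the Lévy measure -/

section JumpMeasure

variable {E : Type*} [NormedAddCommGroup E] [NormedSpace ℝ E] {f : ℝ≥0 → E} {ε : ℝ}

lemma IsCadlagPath.jump_clm (hf : IsCadlagPath f) (ℓ : E →L[ℝ] ℝ) (r : ℝ≥0) :
    jump (fun t => ℓ (f t)) r = ℓ (pathJump f r) := by
  rcases eq_zero_or_pos r with rfl | hr
  · rw [pathJump_zero, map_zero]
    exact pathJump_zero fun t => ℓ (f t)
  · have : (𝓝[<] r).NeBot := nhdsLT_neBot_of_exists_lt ⟨0, hr⟩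
    have hlim : Tendsto (fun t => ℓ (f t)) (𝓝[<] r) (𝓝 (ℓ (Function.leftLim f r))) :=
      (ℓ.continuous.tendsto _).comp (hf.tendsto_nhdsLT r)
    rw [jump, leftLim_eq_of_tendsto hlim, pathJump, map_sub]

lemma IsCadlagPath.indicator_comp_jump (hf : IsCadlagPath f) (ℓ : E →L[ℝ] ℝ) {M : Type*} [Zero M]
    {k : ℝ → M} (h0 : k 0 = 0) (t : ℝ≥0) :
    {s : ℝ≥0 | s ≤ t ∧ jump (fun r => ℓ (f r)) s ≠ 0}.indicator
        (fun s => k (jump (fun r => ℓ (f r)) s)) =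
      (Set.Ioc 0 t).indicator fun r => k (ℓ (pathJump f r)) := by
  funext r
  simp only [Set.indicator, hf.jump_clm ℓ, Set.mem_ofPred_eq, Set.mem_Ioc]
  rcases eq_zero_or_pos r with rfl | hr
  · simp only [pathJump_zero, map_zero, ne_eq, not_true_eq_false, and_false, if_false, lt_irrefl,
      false_and]
  · by_cases hj : ℓ (pathJump f r) = 0 <;> simp [hr, hj, h0]

lemma IsCadlagPath.lintegral_jumpMeasure (hf : IsCadlagPath f) (ℓ : E →L[ℝ] ℝ) {k : ℝ → ℝ≥0∞}
    (h0 : k 0 = 0) (t : ℝ≥0) :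
    ∫⁻ y, k y ∂(jumpMeasure (fun s => ℓ (f s)) t) =
      ∑' r, (Set.Ioc 0 t).indicator (fun r => k (ℓ (pathJump f r))) r := by
  rw [jumpMeasure, lintegral_sum_measure, ← hf.indicator_comp_jump ℓ h0]
  simp only [lintegral_dirac]
  exact tsum_subtype {s : ℝ≥0 | s ≤ t ∧ jump (fun r => ℓ (f r)) s ≠ 0}
    fun s => k (jump (fun r => ℓ (f r)) s)

lemma IsCadlagPath.integrable_jumpMeasure (hf : IsCadlagPath f) (ℓ : E →L[ℝ] ℝ) {k : ℝ → ℝ}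
    (hk : Measurable k) (hv : ∀ᶠ x in 𝓝 0, k (ℓ x) = 0) (t : ℝ≥0) :
    Integrable k (jumpMeasure (fun s => ℓ (f s)) t) := by
  have h0 : k 0 = 0 := by simpa only [map_zero] using hv.self_of_nhds
  refine ⟨hk.aestronglyMeasurable, ?_⟩
  rw [HasFiniteIntegral, hf.lintegral_jumpMeasure ℓ (by rw [h0, enorm_zero])]
  simpa only [ofReal_norm, enorm_indicator_eq_indicator_enorm] using
    (hf.summable_jumps hv 0 t).norm.tsum_ofReal_lt_top

lemma IsCadlagPath.integral_jumpMeasure (hf : IsCadlagPath f) (ℓ : E →L[ℝ] ℝ) {k : ℝ → ℝ}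
    (hk : Measurable k) (hv : ∀ᶠ x in 𝓝 0, k (ℓ x) = 0) (t : ℝ≥0) :
    ∫ y, k y ∂(jumpMeasure (fun s => ℓ (f s)) t) = jumpSum (fun x => k (ℓ x)) f 0 t := by
  have hi := hf.integrable_jumpMeasure ℓ hk hv t
  rw [jumpMeasure] at hi ⊢
  rw [integral_sum_measure hi, jumpSum,
    ← hf.indicator_comp_jump ℓ (by simpa only [map_zero] using hv.self_of_nhds)]
  simp only [integral_dirac]
  exact tsum_subtype {s : ℝ≥0 | s ≤ t ∧ jump (fun r => ℓ (f r)) s ≠ 0}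
    fun s => k (jump (fun r => ℓ (f r)) s)

lemma isOpen_setOf_lt_abs (ε : ℝ) : IsOpen {y : ℝ | ε < |y|} :=
  isOpen_lt continuous_const continuous_abs

lemma measurable_trunc (ε : ℝ) : Measurable (trunc ε) :=
  .ite (isOpen_setOf_lt_abs ε).measurableSet measurable_id measurable_const

lemma setIntegral_eq_integral_trunc (μ : Measure ℝ) (ε : ℝ) :
    ∫ β in {β : ℝ | ε < |β|}, β ∂μ = ∫ β, trunc ε β ∂μ := by
  rw [← integral_indicator (isOpen_setOf_lt_abs ε).measurableSet]
  rfl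

lemma eventually_indicator_one_eq_zero (ℓ : E →L[ℝ] ℝ) {O : Set ℝ} (hε : 0 < ε)
    (hO : ∀ y ∈ O, ε < |y|) : ∀ᶠ x in 𝓝 0, O.indicator (1 : ℝ → ℝ) (ℓ x) = 0 := by
  have hcont : Continuous fun x => |ℓ x| := by fun_prop
  have hsmall : ∀ᶠ x in 𝓝 0, |ℓ x| < ε := hcont.tendsto' 0 0 (by simp) (gt_mem_nhds hε)
  exact hsmall.mono fun x hx => Set.indicator_of_notMem (fun h => (hO _ h).not_gt hx) _

lemma isJumpTest_indicator (ℓ : E →L[ℝ] ℝ) {O : Set ℝ} (hO : IsOpen O) (hε : 0 < ε)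
    (hOε : ∀ y ∈ O, ε < |y|) : IsJumpTest fun x => O.indicator (1 : ℝ → ℝ) (ℓ x) := by
  have hne : (Oᶜ).Nonempty := ⟨0, fun h => (hOε 0 h).not_gt (by rwa [abs_zero])⟩
  have hout {y : ℝ} (hy : y ∉ O) (k : ℕ) : min 1 (k * Metric.infDist y Oᶜ) = 0 := by
    rw [Metric.infDist_zero_of_mem hy, mul_zero, min_eq_right zero_le_one]
  refine ⟨fun k x => min 1 (k * Metric.infDist (ℓ x) Oᶜ), fun k => ?_, ?_, fun x => ?_⟩
  · exact continuous_const.min (continuous_const.mul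
      ((Metric.continuous_infDist_pt _).comp ℓ.continuous))
  · filter_upwards [eventually_indicator_one_eq_zero ℓ hε hOε] with x hx
    exact hout fun h => by simp [h] at hx
  · by_cases hx : ℓ x ∈ O
    · have hpos : 0 < Metric.infDist (ℓ x) Oᶜ :=
        (hO.isClosed_compl.notMem_iff_infDist_pos hne).1 (not_not.2 hx)
      simp only [Set.indicator_of_mem hx]
      refine tendsto_const_nhds.congr' ?_
      filter_upwards [eventually_ge_atTop ⌈1 / Metric.infDist (ℓ x) Oᶜ⌉₊] with k hk
      exact (min_eq_left ((div_le_iff₀ hpos).1 (Nat.ceil_le.1 hk))).symm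
    · simp only [Set.indicator_of_notMem hx, hout hx, tendsto_const_nhds]

lemma IsCadlagPath.jumpMeasure_lt_top (hf : IsCadlagPath f) (ℓ : E →L[ℝ] ℝ) {O : Set ℝ}
    (hO : MeasurableSet O) (hε : 0 < ε) (hOε : ∀ y ∈ O, ε < |y|) (t : ℝ≥0) :
    jumpMeasure (fun s => ℓ (f s)) t O < ∞ := by
  have hi := hf.integrable_jumpMeasure ℓ (measurable_one.indicator hO)
    (eventually_indicator_one_eq_zero ℓ hε hOε) t
  exact ((integrableOn_const_iff (C := (1 : ℝ)) (by simp)).1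
    ((integrable_indicator_iff hO).1 hi)).resolve_left (by simp)

lemma jumpMeasure_singleton_zero (f : ℝ≥0 → ℝ) (t : ℝ≥0) : jumpMeasure f t {0} = 0 := by
  rw [jumpMeasure, Measure.sum_apply _ (measurableSet_singleton 0), ENNReal.tsum_eq_zero]
  intro s
  rw [Measure.dirac_apply' _ (measurableSet_singleton 0)]
  exact Set.indicator_of_notMem (s := {0}) s.2.2 _

end JumpMeasure

section LevyMeasure

variable {Ω : Type*} {mΩ : MeasurableSpace Ω} {P : Measure Ω}
variable {E : Type*} [NormedAddCommGroup E] [NormedSpace ℝ E] [MeasurableSpace E]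
  [OpensMeasurableSpace E] [MeasurableSub₂ E] {Z : ℝ≥0 → Ω → E} {ε : ℝ}

lemma IsRegularLevy.measurable_jumpMeasure_of_isOpen (hZ : IsRegularLevy P Z) (ℓ : E →L[ℝ] ℝ)
    {O : Set ℝ} (hO : IsOpen O) (hε : 0 < ε) (hOε : ∀ y ∈ O, ε < |y|) (t : ℝ≥0) :
    Measurable fun ω => jumpMeasure (fun s => ℓ (Z s ω)) t O := by
  have heq (ω : Ω) : jumpMeasure (fun s => ℓ (Z s ω)) t O =
      ENNReal.ofReal (jumpFunctional Z (fun x => O.indicator 1 (ℓ x)) 0 t ω) := by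
    rw [jumpFunctional, ← (hZ.cadlag ω).integral_jumpMeasure ℓ
      (measurable_one.indicator hO.measurableSet) (eventually_indicator_one_eq_zero ℓ hε hOε),
      integral_indicator_one hO.measurableSet, ofReal_measureReal
      ((hZ.cadlag ω).jumpMeasure_lt_top ℓ hO.measurableSet hε hOε t).ne]
  simp only [heq]
  exact (hZ.measurable_jumpFunctional (isJumpTest_indicator ℓ hO hε hOε) zero_le).ennreal_ofReal

lemma IsRegularLevy.measurable_restrict_jumpMeasure (hZ : IsRegularLevy P Z) (ℓ : E →L[ℝ] ℝ)
    (hε : 0 < ε) (t : ℝ≥0) :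
    Measurable fun ω => (jumpMeasure (fun s => ℓ (Z s ω)) t).restrict {y | ε < |y|} := by
  have hA := isOpen_setOf_lt_abs ε
  have hfin (ω : Ω) :
      IsFiniteMeasure ((jumpMeasure (fun s => ℓ (Z s ω)) t).restrict {y | ε < |y|}) :=
    isFiniteMeasure_restrict.2
      ((hZ.cadlag ω).jumpMeasure_lt_top ℓ hA.measurableSet hε (fun _ hy => hy) t).ne
  have hopen (O : Set ℝ) (hO : IsOpen O) :
      Measurable fun ω => (jumpMeasure (fun s => ℓ (Z s ω)) t).restrict {y | ε < |y|} O := by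
    simp only [Measure.restrict_apply hO.measurableSet]
    exact hZ.measurable_jumpMeasure_of_isOpen ℓ (hO.inter hA) hε (fun _ hy => hy.2) t
  exact .measure_of_isPiSystem BorelSpace.measurable_eq isPiSystem_isOpen hopen
    (hopen _ isOpen_univ)

lemma iUnion_setOf_one_div_lt_abs : ⋃ k : ℕ, {y : ℝ | 1 / (k + 1 : ℝ) < |y|} = {0}ᶜ := by
  ext y
  simp only [Set.mem_iUnion, Set.mem_ofPred_eq, Set.mem_compl_iff, Set.mem_singleton_iff]
  refine ⟨?_, fun hy => exists_nat_one_div_lt (abs_pos.2 hy)⟩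
  rintro ⟨k, hk⟩
  exact abs_pos.1 (Nat.one_div_pos_of_nat.trans hk)

lemma IsRegularLevy.measurable_jumpMeasure (hZ : IsRegularLevy P Z) (ℓ : E →L[ℝ] ℝ) (t : ℝ≥0) :
    Measurable fun ω => jumpMeasure (fun s => ℓ (Z s ω)) t := by
  refine Measure.measurable_of_measurable_coe _ fun B hB => ?_
  have hmono : Monotone fun k : ℕ => B ∩ {y : ℝ | 1 / (k + 1 : ℝ) < |y|} := fun k l hkl =>
    Set.inter_subset_inter_right _ fun y hy =>
      (Nat.one_div_le_one_div hkl : 1 / (l + 1 : ℝ) ≤ 1 / (k + 1)).trans_lt hy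
  have heq (ω : Ω) : jumpMeasure (fun s => ℓ (Z s ω)) t B = ⨆ k : ℕ,
      (jumpMeasure (fun s => ℓ (Z s ω)) t).restrict {y | 1 / (k + 1 : ℝ) < |y|} B := by
    simp only [Measure.restrict_apply hB]
    rw [← hmono.measure_iUnion, ← Set.inter_iUnion, iUnion_setOf_one_div_lt_abs,
      ← Set.sdiff_eq, measure_sdiff_null (jumpMeasure_singleton_zero _ _)]
  simp only [heq]
  exact .iSup fun k => (Measure.measurable_coe hB).comp
    (hZ.measurable_restrict_jumpMeasure ℓ Nat.one_div_pos_of_nat t)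

end LevyMeasure

section CompensatedIntegral

variable {Ω : Type*} {mΩ : MeasurableSpace Ω} {P : Measure Ω}
variable {E : Type*} [NormedAddCommGroup E] [InnerProductSpace ℝ E] [CompleteSpace E]
  [SecondCountableTopology E] [MeasurableSpace E] [BorelSpace E]
variable {Z : ℝ≥0 → Ω → E} {X : ℝ≥0 → Ω → ℝ} {ℓ : E →L[ℝ] ℝ} {k : ℝ → ℝ} {C : ℝ≥0} {ε : ℝ}

lemma IsRegularLevy.integral_levyMeasure (hZ : IsRegularLevy P Z)
    (hX : ∀ᵐ ω ∂P, ∀ t, X t ω = ℓ (Z t ω)) (hk : Measurable k) (ht : IsJumpTest fun x => k (ℓ x))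
    (hC : ∀ x, |k (ℓ x)| ≤ C * ‖x‖ ^ 2) :
    ∫ y, k y ∂(levyMeasure P X) = ∫ ω, jumpFunctional Z (fun x => k (ℓ x)) 0 1 ω ∂P := by
  let κ : Kernel Ω ℝ :=
    ⟨fun ω => jumpMeasure (fun s => ℓ (Z s ω)) 1, hZ.measurable_jumpMeasure ℓ 1⟩
  have hbind : levyMeasure P X = P.bind κ :=
    Measure.bind_congr_right (hX.mono fun ω hω => by simp only [hω]; rfl)
  have ht' : IsJumpTest fun x => ‖k (ℓ x)‖ := ht.comp continuous_norm norm_zero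
  have hi : Integrable k (P.bind κ) := by
    refine (Measure.integrable_comp_iff hk.aestronglyMeasurable).2 ⟨ae_of_all _ fun ω =>
      (hZ.cadlag ω).integrable_jumpMeasure ℓ hk ht.eventually_eq_zero 1, ?_⟩
    refine (hZ.integrable_jumpFunctional (s := 0) (t := 1) zero_le ht' fun x =>
      (abs_norm _).trans_le (hC x)).congr (ae_of_all _ fun ω => ?_)
    exact ((hZ.cadlag ω).integral_jumpMeasure ℓ hk.norm ht'.eventually_eq_zero 1).symm
  rw [hbind]
  rw [Measure.comp_eq_comp_const_apply] at hi ⊢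
  rw [Kernel.integral_comp hi, Kernel.const_apply]
  exact integral_congr_ae (ae_of_all _ fun ω =>
    (hZ.cadlag ω).integral_jumpMeasure ℓ hk ht.eventually_eq_zero 1)

variable [IsProbabilityMeasure P]

lemma IsRegularLevy.truncatedJumpIntegral_ae_eq (hZ : IsRegularLevy P Z)
    (hX : ∀ᵐ ω ∂P, ∀ t, X t ω = ℓ (Z t ω)) (hε : 0 < ε) (t : ℝ≥0) :
    truncatedJumpIntegral P X ε t =ᵐ[P] compensatedSum P Z (fun x => trunc ε (ℓ x)) 0 t := by
  obtain ⟨htest, C, hC⟩ := isLinearTest_trunc ℓ hε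
  obtain ⟨K, hK⟩ := exists_abs_le_mul_sq_norm (G := fun (_ : Unit) x => trunc ε (ℓ x))
    (htest.eventually_eq_zero.mono fun _ hx _ => hx) fun _ => hC
  filter_upwards [hX] with ω hω
  rw [truncatedJumpIntegral, compensatedSum, setIntegral_eq_integral_trunc,
    setIntegral_eq_integral_trunc, hZ.integral_levyMeasure hX (measurable_trunc ε) htest (hK ()),
    hZ.integral_jumpFunctional htest (hK ()) t]
  simp only [hω]
  rw [(hZ.cadlag ω).integral_jumpMeasure ℓ (measurable_trunc ε) htest.eventually_eq_zero t]
  rfl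

lemma IsRegularLevy.isCompensatedJumpIntegral_iff (hZ : IsRegularLevy P Z)
    (hX : ∀ᵐ ω ∂P, ∀ t, X t ω = ℓ (Z t ω)) {t : ℝ≥0} {Y : Lp ℝ 2 P} :
    IsCompensatedJumpIntegral P X t Y ↔
      Tendsto (fun ε => compensatedSumLp P Z (fun x => trunc ε (ℓ x)) 0 t) (𝓝[>] 0) (𝓝 Y) := by
  rw [IsCompensatedJumpIntegral, tendsto_iff_edist_tendsto_0]
  refine tendsto_congr' ?_
  filter_upwards [self_mem_nhdsWithin] with ε hε
  rw [Lp.edist_def]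
  refine eLpNorm_congr_ae ?_
  filter_upwards [hZ.truncatedJumpIntegral_ae_eq hX hε t,
    hZ.coeFn_compensatedSumLp zero_le (isLinearTest_trunc ℓ hε)] with ω h1 h2
  rw [h1, Pi.sub_apply, h2]

lemma IsRegularLevy.isCompensatedJumpIntegral (hZ : IsRegularLevy P Z)
    (hX : ∀ᵐ ω ∂P, ∀ t, X t ω = ℓ (Z t ω)) (t : ℝ≥0) :
    IsCompensatedJumpIntegral P X t (compensatedJumpIntegral P X t) := by
  obtain ⟨M, hM⟩ := hZ.exists_isJumpLimit ℓ
  have h : ∃ Y, IsCompensatedJumpIntegral P X t Y :=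
    ⟨M t, (hZ.isCompensatedJumpIntegral_iff hX).2 (hM t)⟩
  rw [compensatedJumpIntegral, dif_pos h]
  exact h.choose_spec

lemma IsRegularLevy.isJumpLimit_compensatedJumpIntegral (hZ : IsRegularLevy P Z)
    (hX : ∀ᵐ ω ∂P, ∀ t, X t ω = ℓ (Z t ω)) :
    IsJumpLimit P Z ℓ (compensatedJumpIntegral P X) :=
  fun t => (hZ.isCompensatedJumpIntegral_iff hX).1 (hZ.isCompensatedJumpIntegral hX t)

end CompensatedIntegral

/-! ### Regular versions -/

section ConvergenceInMeasure

variable {Ω : Type*} {mΩ : MeasurableSpace Ω} {P : Measure Ω}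
variable {E F ι : Type*} [PseudoEMetricSpace E] [PseudoEMetricSpace F]

lemma tendstoInMeasure_comp_of_uniformContinuous {φ : E → F} (hφ : UniformContinuous φ)
    {l : Filter ι} {X : ι → Ω → E} {Y : Ω → E} (h : TendstoInMeasure P X l Y) :
    TendstoInMeasure P (fun i ω => φ (X i ω)) l fun ω => φ (Y ω) := by
  intro ε hε
  obtain ⟨δ, hδ, hφδ⟩ := EMetric.uniformContinuous_iff.1 hφ ε hε
  exact tendsto_of_tendsto_of_tendsto_of_le_of_le tendsto_const_nhds (h δ hδ) (fun _ => zero_le)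
    fun i => measure_mono fun ω hω => le_of_not_gt fun hlt => (hφδ hlt).not_ge hω

end ConvergenceInMeasure

section CadlagVersions

variable {Ω : Type*} {mΩ : MeasurableSpace Ω} {P : Measure Ω}
variable {E : Type*} [NormedAddCommGroup E] {f g : ℝ≥0 → E} {D : Set ℝ≥0}

lemma exists_seq_mem_tendsto_nhdsGE (hD : Dense D) (t : ℝ≥0) :
    ∃ u : ℕ → ℝ≥0, (∀ n, u n ∈ D) ∧ Tendsto u atTop (𝓝[≥] t) := by
  have ht : t ∈ closure (Set.Ioi t ∩ D) :=
    closure_minimal (hD.open_subset_closure_inter isOpen_Ioi) isClosed_closure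
      (closure_Ioi t ▸ Set.self_mem_Ici)
  obtain ⟨u, hu, hlim⟩ := mem_closure_iff_seq_limit.1 ht
  exact ⟨u, fun n => (hu n).2, tendsto_nhdsWithin_iff.2
    ⟨hlim, .of_forall fun n => Set.mem_Ici.2 (hu n).1.le⟩⟩

lemma IsCadlagPath.eq_of_eqOn_dense (hf : IsCadlagPath f) (hg : IsCadlagPath g) (hD : Dense D)
    (h : D.EqOn f g) : f = g := by
  funext t
  obtain ⟨u, hu, hlim⟩ := exists_seq_mem_tendsto_nhdsGE hD t
  refine tendsto_nhds_unique ((hf.tendsto_nhdsGE t).comp hlim) ?_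
  exact ((hg.tendsto_nhdsGE t).comp hlim).congr fun n => (h (hu n)).symm

lemma IsCadlagPath.linear [NormedSpace ℝ E] (hf : IsCadlagPath f) (hg : IsCadlagPath g)
    (a b : ℝ) : IsCadlagPath fun t => a • f t + b • g t := fun t =>
  ⟨((hf t).1.const_smul a).add ((hg t).1.const_smul b), _,
    ((hf.tendsto_nhdsLT t).const_smul a).add ((hg.tendsto_nhdsLT t).const_smul b)⟩

lemma exists_measurable_cadlag [MeasurableSpace E] [BorelSpace E] {X : ℝ≥0 → Ω → E}
    (hX : ∀ t, AEMeasurable (X t) P) (hcad : ∀ᵐ ω ∂P, IsCadlagPath fun t => X t ω) :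
    ∃ Y : ℝ≥0 → Ω → E, (∀ t, Measurable (Y t)) ∧ (∀ ω, IsCadlagPath fun t => Y t ω) ∧
      ∀ᵐ ω ∂P, ∀ t, Y t ω = X t ω := by
  obtain ⟨D, hDc, hD⟩ := TopologicalSpace.exists_countable_dense ℝ≥0
  have hae : ∀ᵐ ω ∂P, (IsCadlagPath fun t => X t ω) ∧ ∀ t ∈ D, X t ω = (hX t).mk _ ω :=
    hcad.and ((ae_ball_iff hDc).2 fun t _ => (hX t).ae_eq_mk)
  obtain ⟨G, hGae, hG, hGs⟩ := IsMeasurablyGenerated.exists_measurable_subset hae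
  have hcadG (ω : Ω) : IsCadlagPath fun t => G.indicator (X t) ω := by
    by_cases hω : ω ∈ G
    · simpa only [Set.indicator_of_mem hω] using (hGs hω).1
    · simpa only [Set.indicator_of_notMem hω] using isCadlagPath_of_continuous continuous_const
  have hmeasD : ∀ t ∈ D, Measurable (G.indicator (X t)) := fun t ht => by
    rw [Set.indicator_congr fun ω hω => (hGs hω).2 t ht]
    exact (hX t).measurable_mk.indicator hG
  refine ⟨fun t => G.indicator (X t), fun t => ?_, hcadG, ?_⟩
  · obtain ⟨u, hu, hlim⟩ := exists_seq_mem_tendsto_nhdsGE hD t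
    exact measurable_of_tendsto_metrizable (fun n => hmeasD _ (hu n))
      (tendsto_pi_nhds.2 fun ω => ((hcadG ω).tendsto_nhdsGE t).comp hlim)
  · filter_upwards [hGae] with ω hω t
    exact Set.indicator_of_mem hω _

end CadlagVersions

section RegularVersions

variable {Ω : Type*} {mΩ : MeasurableSpace Ω} {P : Measure Ω}
variable {E : Type*} [NormedAddCommGroup E] [MeasurableSpace E] {X Y : ℝ≥0 → Ω → E}

lemma IsLevyProcess.congr_ae (hX : IsLevyProcess P X) (h : ∀ t, X t =ᵐ[P] Y t) :
    IsLevyProcess P Y where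
  aemeasurable t := (hX.aemeasurable t).congr (h t)
  zero := (h 0).symm.trans hX.zero
  indep n t ht := (hX.indep n t ht).congr fun i => (h _).sub (h _)
  stationary s r := by
    obtain ⟨hleft, hright, hmap⟩ := hX.stationary s r
    refine ⟨hleft.congr ((h _).sub (h _)), hright.congr ((h _).sub (h _)), ?_⟩
    rwa [← Measure.map_congr ((h (s + r)).sub (h s)), ← Measure.map_congr ((h r).sub (h 0))]
  stochCont t := (hX.stochCont t).congr (fun s => h s) (h t)

lemma IsLevyProcess.clm_comp {F : Type*} [NormedAddCommGroup F] [MeasurableSpace F]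
    [NormedSpace ℝ E] [NormedSpace ℝ F] [OpensMeasurableSpace E] [BorelSpace F]
    (hX : IsLevyProcess P X) (A : E →L[ℝ] F) : IsLevyProcess P fun t ω => A (X t ω) where
  aemeasurable t := A.measurable.comp_aemeasurable (hX.aemeasurable t)
  zero := hX.zero.mono fun ω hω => (congrArg A hω).trans (map_zero A)
  indep := hX.indep.map A
  stationary s h := by
    simpa only [Function.comp_def, Pi.sub_def, map_sub] using (hX.stationary s h).comp A.measurable
  stochCont t := tendstoInMeasure_comp_of_uniformContinuous A.uniformContinuous (hX.stochCont t)

lemma IsLevyProcess.exists_isRegularLevy [BorelSpace E] (hX : IsLevyProcess P X)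
    (hcad : ∀ᵐ ω ∂P, IsCadlagPath fun t => X t ω) (hmemLp : ∀ t, MemLp (X t) 2 P) :
    ∃ Z : ℝ≥0 → Ω → E, IsRegularLevy P Z ∧ ∀ᵐ ω ∂P, ∀ t, Z t ω = X t ω := by
  obtain ⟨Z, hZ, hZcad, hZX⟩ := exists_measurable_cadlag hX.aemeasurable hcad
  have hae (t : ℝ≥0) : X t =ᵐ[P] Z t := hZX.mono fun ω hω => (hω t).symm
  exact ⟨Z, ⟨hX.congr_ae hae, hZ, hZcad, fun t => (hmemLp t).ae_eq (hae t)⟩, hZX⟩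

end RegularVersions

section EuclideanVersions

variable {Ω : Type*} {mΩ : MeasurableSpace Ω} {P : Measure Ω} {ι : Type*} [Fintype ι]

lemma isCadlagPath_toLp {f : ι → ℝ≥0 → ℝ} (hf : ∀ i, IsCadlag (f i)) :
    IsCadlagPath fun t => WithLp.toLp 2 fun i => f i t := by
  have hcont := PiLp.continuous_toLp 2 fun _ : ι => ℝ
  choose l hl using fun t i => (hf i t).2
  exact fun t => ⟨(hcont.tendsto _).comp (tendsto_pi_nhds.2 fun i => (hf i t).1), _,
    (hcont.tendsto _).comp (tendsto_pi_nhds.2 (hl t))⟩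

lemma exists_isRegularLevy_euclidean {X : ι → ℝ≥0 → Ω → ℝ}
    (hX : IsLevyProcess P fun t ω i => X i t ω)
    (hcad : ∀ i, ∀ᵐ ω ∂P, IsCadlag fun t => X i t ω) (hmemLp : ∀ i t, MemLp (X i t) 2 P) :
    ∃ Z : ℝ≥0 → Ω → EuclideanSpace ℝ ι, IsRegularLevy P Z ∧
      ∀ i, ∀ᵐ ω ∂P, ∀ t, X i t ω = EuclideanSpace.proj i (Z t ω) := by
  obtain ⟨Z, hZ, hZX⟩ := (hX.clm_comp
    (EuclideanSpace.equiv ι ℝ).symm.toContinuousLinearMap).exists_isRegularLevy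
    ((ae_all_iff.2 hcad).mono fun ω hω => isCadlagPath_toLp hω)
    fun t => .of_eval_piLp fun i => hmemLp i t
  exact ⟨Z, hZ, fun i => hZX.mono fun ω hω t => by rw [hω]; rfl⟩

end EuclideanVersions

/-! ### The cylindrical process `M₂` -/

section CylindricalJumps

variable {Ω : Type v} {mΩ : MeasurableSpace Ω} {P : Measure Ω}
  {𝓕 : Filtration ℝ≥0 mΩ} {U : Type u} [NormedAddCommGroup U] [NormedSpace ℝ U]
  {L : ℝ≥0 → StrongDual ℝ U → Ω → ℝ}

/-- A weakly cylindrical Lévy process that is weakly càdlàg and of weak order `2`, i.e. one whose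
finite-dimensional projections all have regular versions. -/
structure IsRegularCylindricalLevy (P : Measure Ω) (𝓕 : Filtration ℝ≥0 mΩ)
    (L : ℝ≥0 → StrongDual ℝ U → Ω → ℝ) : Prop extends
    IsWeaklyCylindricalLevyProcess P 𝓕 L where
  cadlag : IsWeaklyCadlag P L
  memLp : IsWeakOrderTwo P L

namespace IsRegularCylindricalLevy

lemma exists_isRegularLevy (hL : IsRegularCylindricalLevy P 𝓕 L) {n : ℕ}
    (a : Fin n → StrongDual ℝ U) :
    ∃ Z : ℝ≥0 → Ω → EuclideanSpace ℝ (Fin n), IsRegularLevy P Z ∧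
      ∀ i, ∀ᵐ ω ∂P, ∀ t, L t (a i) ω = EuclideanSpace.proj i (Z t ω) :=
  exists_isRegularLevy_euclidean (hL.levy n a) (fun i => hL.cadlag (a i))
    fun i t => hL.memLp t (a i)

lemma ae_forall_map_linear (hL : IsRegularCylindricalLevy P 𝓕 L) (α β : ℝ)
    (a b : StrongDual ℝ U) :
    ∀ᵐ ω ∂P, ∀ t, L t (α • a + β • b) ω = α * L t a ω + β * L t b ω := by
  obtain ⟨D, hDc, hD⟩ := TopologicalSpace.exists_countable_dense ℝ≥0
  have hae : ∀ᵐ ω ∂P, ∀ t ∈ D, L t (α • a + β • b) ω = α * L t a ω + β * L t b ω := by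
    refine (ae_ball_iff hDc).2 fun t _ => ?_
    filter_upwards [hL.map_add t (α • a) (β • b), hL.map_smul t α a, hL.map_smul t β b]
      with ω hadd ha hb
    rw [hadd, Pi.add_apply, ha, hb, Pi.smul_apply, Pi.smul_apply, smul_eq_mul, smul_eq_mul]
  filter_upwards [hae, hL.cadlag a, hL.cadlag b, hL.cadlag (α • a + β • b)] with ω hω ha hb hab
  exact congrFun (IsCadlagPath.eq_of_eqOn_dense hab (IsCadlagPath.linear ha hb α β) hD hω)

variable [IsProbabilityMeasure P]

lemma isCompensatedJumpIntegral_M₂ (hL : IsRegularCylindricalLevy P 𝓕 L) (t : ℝ≥0)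
    (a : StrongDual ℝ U) :
    IsCompensatedJumpIntegral P (fun s => L s a) t (M₂ P L t a) := by
  obtain ⟨Z, hZ, hZL⟩ := hL.exists_isRegularLevy fun _ : Fin 1 => a
  exact hZ.isCompensatedJumpIntegral (hZL 0) t

lemma exists_isJumpLimit (hL : IsRegularCylindricalLevy P 𝓕 L) (a b : StrongDual ℝ U) :
    ∃ (Z : ℝ≥0 → Ω → EuclideanSpace ℝ (Fin 2)) (ℓ ℓ' : EuclideanSpace ℝ (Fin 2) →L[ℝ] ℝ),
      IsRegularLevy P Z ∧ IsJumpLimit P Z ℓ (fun t => M₂ P L t a) ∧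
        IsJumpLimit P Z ℓ' (fun t => M₂ P L t b) ∧
          ∀ α β : ℝ, IsJumpLimit P Z (α • ℓ + β • ℓ') fun t => M₂ P L t (α • a + β • b) := by
  obtain ⟨Z, hZ, hZL⟩ := hL.exists_isRegularLevy ![a, b]
  refine ⟨Z, EuclideanSpace.proj 0, EuclideanSpace.proj 1, hZ,
    hZ.isJumpLimit_compensatedJumpIntegral (hZL 0),
    hZ.isJumpLimit_compensatedJumpIntegral (hZL 1), fun α β =>
    hZ.isJumpLimit_compensatedJumpIntegral ?_⟩
  filter_upwards [hZL 0, hZL 1, hL.ae_forall_map_linear α β a b] with ω ha hb hlin t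
  rw [hlin, add_apply, smul_apply, smul_apply, ← ha, ← hb]
  rfl

/-- `M₂(t)` as a linear map from the dual of `U` to `L²(Ω, P)`. -/
noncomputable def linearMapM₂ (hL : IsRegularCylindricalLevy P 𝓕 L) (t : ℝ≥0) :
    StrongDual ℝ U →ₗ[ℝ] Lp ℝ 2 P :=
  have hlin (α β : ℝ) (a b : StrongDual ℝ U) :
      M₂ P L t (α • a + β • b) = α • M₂ P L t a + β • M₂ P L t b := by
    obtain ⟨Z, ℓ, ℓ', hZ, ha, hb, hab⟩ := hL.exists_isJumpLimit a b
    exact ha.linear hZ hb α β (hab α β) t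
  { toFun := M₂ P L t
    map_add' := fun a b => by simpa only [one_smul] using hlin 1 1 a b
    map_smul' := fun α a => by
      simpa only [zero_smul, add_zero, RingHom.id_apply] using hlin α 0 a 0 }

lemma linearMapM₂_apply (hL : IsRegularCylindricalLevy P 𝓕 L) (t : ℝ≥0) (a : StrongDual ℝ U) :
    hL.linearMapM₂ t a = M₂ P L t a :=
  rfl

lemma norm_sq_M₂ (hL : IsRegularCylindricalLevy P 𝓕 L) (t : ℝ≥0) (a : StrongDual ℝ U) :
    ‖M₂ P L t a‖ ^ 2 = t * ‖M₂ P L 1 a‖ ^ 2 := by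
  obtain ⟨Z, ℓ, -, hZ, ha, -⟩ := hL.exists_isJumpLimit a a
  exact ha.norm_sq hZ t

lemma inner_M₂_self (hL : IsRegularCylindricalLevy P 𝓕 L) (t : ℝ≥0) (a b : StrongDual ℝ U) :
    inner ℝ (M₂ P L t a) (M₂ P L t b) = t * inner ℝ (M₂ P L 1 a) (M₂ P L 1 b) := by
  rw [real_inner_eq_norm_add_mul_self_sub_norm_mul_self_sub_norm_mul_self_div_two,
    real_inner_eq_norm_add_mul_self_sub_norm_mul_self_sub_norm_mul_self_div_two]
  simp only [← hL.linearMapM₂_apply, ← map_add, ← sq]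
  simp only [linearMapM₂_apply, hL.norm_sq_M₂ t]
  ring

lemma inner_M₂ (hL : IsRegularCylindricalLevy P 𝓕 L) (s t : ℝ≥0) (a b : StrongDual ℝ U) :
    inner ℝ (M₂ P L s a) (M₂ P L t b) =
      (min s t : ℝ≥0) * inner ℝ (M₂ P L 1 a) (M₂ P L 1 b) := by
  wlog hst : s ≤ t generalizing s t a b
  · rw [real_inner_comm, min_comm, this t s b a (le_of_not_ge hst), real_inner_comm]
  obtain ⟨Z, ℓ, ℓ', hZ, ha, hb, -⟩ := hL.exists_isJumpLimit a b
  have horth := ha.inner_sub hZ hb hst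
  rw [inner_sub_right, sub_eq_zero] at horth
  rw [horth, min_eq_left hst, hL.inner_M₂_self]

lemma integral_M₂ (hL : IsRegularCylindricalLevy P 𝓕 L) (t : ℝ≥0) (a : StrongDual ℝ U) :
    ∫ ω, M₂ P L t a ω ∂P = 0 := by
  obtain ⟨Z, ℓ, -, hZ, ha, -⟩ := hL.exists_isJumpLimit a a
  exact ha.integral_eq_zero hZ t

lemma exists_cadlag_version_M₂ (hL : IsRegularCylindricalLevy P 𝓕 L) (a : StrongDual ℝ U) :
    ∃ m : ℝ≥0 → Ω → ℝ, IsLevyProcess P m ∧ (∀ ω, IsCadlag fun t => m t ω) ∧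
      ∀ t, m t =ᵐ[P] M₂ P L t a := by
  obtain ⟨Z, ℓ, -, hZ, ha, -⟩ := hL.exists_isJumpLimit a a
  exact ha.exists_cadlag_version hZ

end IsRegularCylindricalLevy

end CylindricalJumps

/-! ### Factorizations of a covariance operator -/

section HilbertBases

variable {H : Type*} [NormedAddCommGroup H] [InnerProductSpace ℝ H]

/-- An orthogonal family in which every vector has its Fourier expansion with coefficients
`⟪v k, x⟫`, without normalization: an orthonormal basis padded with zero vectors. The padding allows
an index set that is infinite even if `H` is finite-dimensional. -/
structure IsPaddedHilbertBasis {ι : Type*} (v : ι → H) : Prop where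
  orthogonal : ∀ k l, k ≠ l → inner ℝ (v k) (v l) = 0
  hasSum : ∀ x, HasSum (fun k => inner ℝ (v k) x • v k) x

lemma isPaddedHilbertBasis_of_hilbertBasis {ι : Type*} (b : HilbertBasis ι ℝ H) :
    IsPaddedHilbertBasis b where
  orthogonal _ _ hkl := b.orthonormal.2 hkl
  hasSum x := by simpa only [b.repr_apply_apply] using b.hasSum_repr x

namespace IsPaddedHilbertBasis

variable {ι : Type*} {v : ι → H}

lemma of_ne_zero (hv : IsPaddedHilbertBasis fun k : {k // v k ≠ 0} => v k) :
    IsPaddedHilbertBasis v where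
  orthogonal k l hkl := by
    by_cases hk : v k = 0
    · rw [hk, inner_zero_left]
    by_cases hl : v l = 0
    · rw [hl, inner_zero_right]
    exact hv.orthogonal ⟨k, hk⟩ ⟨l, hl⟩ fun h => hkl (congrArg Subtype.val h)
  hasSum x := by
    have hsupp : (Function.support fun k => inner ℝ (v k) x • v k) ⊆ {k | v k ≠ 0} := fun k =>
      right_ne_zero_of_smul
    exact (hasSum_subtype_iff_of_support_subset hsupp).1 (hv.hasSum x)

lemma hasSum_inner_sq (hv : IsPaddedHilbertBasis v) (x : H) :
    HasSum (fun k => inner ℝ (v k) x ^ 2) (‖x‖ ^ 2) := by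
  have h := (hv.hasSum x).mapL (innerSL ℝ x)
  simp only [innerSL_apply_apply, inner_smul_right, real_inner_self_eq_norm_sq] at h
  simpa only [sq (inner ℝ _ _), real_inner_comm] using h

/-- The synthesis operator is the adjoint of the analysis operator `x ↦ (⟪v k, x⟫)ₖ`, which is
isometric by Parseval's identity. -/
lemma exists_synthesis [CompleteSpace H] (hv : IsPaddedHilbertBasis v) {H' : Type*}
    [NormedAddCommGroup H'] [InnerProductSpace ℝ H'] [CompleteSpace H']
    (e : HilbertBasis ι ℝ H') : ∃ S : H' →L[ℝ] H, ∀ k, S (e k) = v k := by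
  have hmem (x : H) : Memℓp (fun k => inner ℝ (v k) x) 2 :=
    memℓp_gen (by simpa using (hv.hasSum_inner_sq x).summable)
  let analysis : H →ₗᵢ[ℝ] lp (fun _ : ι => ℝ) 2 :=
    { toFun := fun x => ⟨fun k => inner ℝ (v k) x, hmem x⟩
      map_add' := fun x y => by ext k; exact inner_add_right _ _ _
      map_smul' := fun c x => by ext k; exact inner_smul_right _ _ _
      norm_map' := fun x => by
        rw [← sq_eq_sq₀ (norm_nonneg _) (norm_nonneg _), ← (hv.hasSum_inner_sq x).tsum_eq,
          ← real_inner_self_eq_norm_sq, lp.inner_eq_tsum]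
        exact tsum_congr fun k => (sq _).symm }
  let R : H →L[ℝ] H' := (e.repr.symm.toLinearIsometry.comp analysis).toContinuousLinearMap
  refine ⟨R.adjoint, fun k => ext_inner_right ℝ fun x => ?_⟩
  rw [ContinuousLinearMap.adjoint_inner_left, ← e.repr_apply_apply]
  exact congrArg (· k) (e.repr.apply_symm_apply (analysis x))

end IsPaddedHilbertBasis

lemma exists_linearIsometryEquiv_of_hilbertBasis [CompleteSpace H] {ι : Type}
    (b : HilbertBasis ι ℝ H) :
    ∃ (H' : Type u) (_ : NormedAddCommGroup H') (_ : InnerProductSpace ℝ H') (_ : CompleteSpace H'),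
      Nonempty (H ≃ₗᵢ[ℝ] H') := by
  have hrange : Set.range (fun k : ULift.{u} ι => b k.down) = Set.range b :=
    ULift.down_surjective.range_comp b
  let b' : HilbertBasis (ULift.{u} ι) ℝ H :=
    HilbertBasis.mk (b.orthonormal.comp ULift.down ULift.down_injective) <| by
      simp only [Function.comp_def, hrange, b.dense_span, le_refl]
  exact ⟨lp (fun _ : ULift.{u} ι => ℝ) 2, inferInstance, inferInstance, inferInstance, ⟨b'.repr⟩⟩

end HilbertBases

lemma exists_separating_sequence {U : Type*} [NormedAddCommGroup U] [NormedSpace ℝ U]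
    [TopologicalSpace.SeparableSpace U] :
    ∃ b : ℕ → StrongDual ℝ U, ∀ u, (∀ n, b n u = 0) → u = 0 := by
  choose b hb_norm hb using fun n : ℕ =>
    exists_dual_vector'' ℝ (TopologicalSpace.denseSeq U n)
  refine ⟨b, fun u hu => norm_le_zero_iff.1 (le_of_forall_pos_le_add fun ε hε => ?_)⟩
  obtain ⟨n, hn⟩ := (TopologicalSpace.denseRange_denseSeq U).exists_dist_lt u (half_pos hε)
  set w := TopologicalSpace.denseSeq U n
  rw [dist_eq_norm] at hn
  have hw : ‖w‖ ≤ ‖u - w‖ := by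
    have h := (b n).le_of_opNorm_le (hb_norm n) (u - w)
    rw [map_sub, hu n, zero_sub, hb n, one_mul] at h
    simpa using h
  have htri : ‖u‖ ≤ ‖u - w‖ + ‖w‖ := by simpa using norm_add_le (u - w) w
  linarith

section Factorization

variable {U : Type*} [NormedAddCommGroup U] [NormedSpace ℝ U]
  {H : Type*} [NormedAddCommGroup H] [InnerProductSpace ℝ H]

/-- `R : U* → H` factorizes the covariance operator `Q` as `Q = R* R` and has dense range, so that
`H` is a model of the reproducing kernel Hilbert space of `Q` that is not yet embedded in `U`. -/
structure IsCovarianceFactor (Q : StrongDual ℝ U → U) (R : StrongDual ℝ U →ₗ[ℝ] H) : Prop where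
  denseRange : DenseRange R
  apply_eq_inner : ∀ a b : StrongDual ℝ U, b (Q a) = inner ℝ (R a) (R b)

variable {Q : StrongDual ℝ U → U} {R : StrongDual ℝ U →ₗ[ℝ] H}

lemma isCovarianceFactor_codRestrict {E : Type*} [NormedAddCommGroup E] [InnerProductSpace ℝ E]
    {T : StrongDual ℝ U →ₗ[ℝ] E} (hT : ∀ a b : StrongDual ℝ U, b (Q a) = inner ℝ (T a) (T b)) :
    IsCovarianceFactor Q (T.codRestrict (LinearMap.range T).topologicalClosure fun a =>
      Submodule.le_topologicalClosure _ (LinearMap.mem_range_self T a)) where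
  denseRange x := by
    rw [closure_subtype]
    refine closure_mono ?_ x.2
    rintro _ ⟨a, rfl⟩
    exact ⟨_, Set.mem_range_self a, rfl⟩
  apply_eq_inner := hT

namespace IsCovarianceFactor

lemma comp_linearIsometryEquiv (hR : IsCovarianceFactor Q R) {H' : Type*} [NormedAddCommGroup H']
    [InnerProductSpace ℝ H'] (J : H ≃ₗᵢ[ℝ] H') :
    IsCovarianceFactor Q (J.toLinearEquiv.toLinearMap ∘ₗ R) where
  denseRange := J.surjective.denseRange.comp hR.denseRange J.continuous
  apply_eq_inner a b := (hR.apply_eq_inner a b).trans (J.inner_map_map _ _).symm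

variable {i : H →L[ℝ] U}

lemma embedding_injective (hR : IsCovarianceFactor Q R)
    (hi : ∀ x (b : StrongDual ℝ U), b (i x) = inner ℝ x (R b)) : Function.Injective i := by
  refine fun x y hxy => hR.denseRange.eq_of_inner_left ℝ fun b => ?_
  rw [← hi, ← hi, hxy]

lemma embedding_apply (hR : IsCovarianceFactor Q R)
    (hi : ∀ x (b : StrongDual ℝ U), b (i x) = inner ℝ x (R b)) (a : StrongDual ℝ U) :
    i (R a) = Q a :=
  (SeparatingDual.eq_iff_forall_dual_eq (R := ℝ)).2 fun b => by rw [hi, hR.apply_eq_inner]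

variable [CompleteSpace H]

lemma continuous (hR : IsCovarianceFactor Q R) : Continuous R := by
  refine R.continuous_of_seq_closed_graph fun a x y ha hy => ?_
  refine hR.denseRange.eq_of_inner_left ℝ fun b => ?_
  have hx : Tendsto (fun n => inner ℝ (R (a n)) (R b)) atTop (𝓝 (inner ℝ (R x) (R b))) := by
    have heval : Tendsto (fun n => a n (Q b)) atTop (𝓝 (x (Q b))) :=
      ((ContinuousLinearMap.apply ℝ ℝ (Q b)).continuous.tendsto x).comp ha
    simpa only [hR.apply_eq_inner, real_inner_comm] using heval
  exact tendsto_nhds_unique (hy.inner tendsto_const_nhds) hx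

/-- The embedding is the adjoint of `R`. A priori it maps `H` into the bidual of `U`; but it maps
the dense subspace `R(U*)` into `U`, which is closed in its bidual. -/
lemma exists_embedding [CompleteSpace U] (hR : IsCovarianceFactor Q R) :
    ∃ i : H →L[ℝ] U, ∀ x (b : StrongDual ℝ U), b (i x) = inner ℝ x (R b) := by
  let ι := NormedSpace.inclusionInDoubleDualLi ℝ (E := U)
  let A : H →L[ℝ] StrongDual ℝ (StrongDual ℝ U) :=
    (ContinuousLinearMap.compL ℝ (StrongDual ℝ U) H ℝ).flip ⟨R, hR.continuous⟩ ∘L innerSL ℝ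
  have hA_factor (a : StrongDual ℝ U) : A (R a) = ι (Q a) := by
    ext b
    exact (hR.apply_eq_inner a b).symm
  have hA_mem (x : H) : A x ∈ LinearMap.range ι.toLinearMap := by
    have hrange : IsClosed (Set.range ι) :=
      ι.isometry.isUniformInducing.isComplete_range.isClosed
    exact (hrange.preimage A.continuous).closure_subset_iff.2
      (Set.range_subset_iff.2 fun a => ⟨Q a, (hA_factor a).symm⟩) (hR.denseRange x)
  refine ⟨ι.equivRange.symm.toContinuousLinearEquiv.toContinuousLinearMap ∘L
    A.codRestrict _ hA_mem, fun x b => ?_⟩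
  have hι : ι (ι.equivRange.symm ⟨A x, hA_mem x⟩) = A x :=
    congrArg Subtype.val (ι.equivRange.apply_symm_apply ⟨A x, hA_mem x⟩)
  exact congrArg (· b) hι

lemma isReproducingKernelHilbertSpace (hR : IsCovarianceFactor Q R)
    (hi : ∀ x (b : StrongDual ℝ U), b (i x) = inner ℝ x (R b)) :
    IsReproducingKernelHilbertSpace Q i where
  injective := hR.embedding_injective hi
  range_subset a := ⟨R a, hR.embedding_apply hi a⟩
  dense := hR.denseRange.mono (Set.range_subset_iff.2 fun a => ⟨a, hR.embedding_apply hi a⟩)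
  inner_eq a b x y hx hy := by
    rw [← hR.embedding_apply hi] at hx hy
    rw [hR.embedding_injective hi hx, hR.embedding_injective hi hy, hR.apply_eq_inner]

/-- Gram–Schmidt is applied to the image under `R` of a sequence that separates the points of `U`;
this image is total because `H` embeds in `U`. -/
lemma exists_hilbertBasis [CompleteSpace U] [TopologicalSpace.SeparableSpace U]
    (hR : IsCovarianceFactor Q R) :
    ∃ (a : ℕ → StrongDual ℝ U) (b : HilbertBasis {n // R (a n) ≠ 0} ℝ H), ∀ n, b n = R (a n) := by
  obtain ⟨i, hi⟩ := hR.exists_embedding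
  obtain ⟨b, hb⟩ := exists_separating_sequence (U := U)
  let g := InnerProductSpace.gramSchmidtNormed ℝ fun n => R (b n)
  have hspan : Submodule.span ℝ (Set.range g) = Submodule.span ℝ (Set.range fun n => R (b n)) := by
    rw [InnerProductSpace.span_gramSchmidtNormed_range, InnerProductSpace.span_gramSchmidt]
  have hg_mem (n : ℕ) : g n ∈ LinearMap.range R := by
    have hle : Submodule.span ℝ (Set.range g) ≤ LinearMap.range R :=
      hspan.trans_le (Submodule.span_le.2 (Set.range_subset_iff.2 fun n => ⟨b n, rfl⟩))
    exact hle (Submodule.subset_span (Set.mem_range_self n))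
  choose a ha using hg_mem
  have horth : Orthonormal ℝ fun n : {n // R (a n) ≠ 0} => R (a n) := by
    have hg : Orthonormal ℝ fun n : {n // g n ≠ 0} => g n :=
      InnerProductSpace.gramSchmidtNormed_orthonormal' _
    rw [← funext ha] at hg
    exact hg
  refine ⟨a, HilbertBasis.mkOfOrthogonalEqBot horth ?_, fun n => by
    rw [HilbertBasis.coe_mkOfOrthogonalEqBot]⟩
  rw [Submodule.eq_bot_iff]
  intro x hx
  have hxg (n : ℕ) : inner ℝ x (g n) = 0 := by
    by_cases hn : R (a n) = 0
    · rw [← ha, hn, inner_zero_right]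
    · rw [← ha]
      exact (Submodule.mem_orthogonal' _ _).1 hx _ (Submodule.subset_span ⟨⟨n, hn⟩, rfl⟩)
  have hxb (n : ℕ) : inner ℝ x (R (b n)) = 0 := by
    have hle : Submodule.span ℝ (Set.range g) ≤ LinearMap.ker (innerSL ℝ x).toLinearMap :=
      Submodule.span_le.2 (Set.range_subset_iff.2 hxg)
    exact hle (hspan ▸ Submodule.subset_span ⟨n, rfl⟩)
  refine hR.embedding_injective hi ?_
  rw [map_zero]
  exact hb _ fun n => by rw [hi, hxb]

end IsCovarianceFactor

/-- The closure of the range of `T` is such an `H`, except for its universe: it is replaced by an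
isometric copy in the universe `u`. -/
lemma exists_isCovarianceFactor [CompleteSpace U] [TopologicalSpace.SeparableSpace U]
    {E : Type*} [NormedAddCommGroup E] [InnerProductSpace ℝ E] [CompleteSpace E]
    {T : StrongDual ℝ U →ₗ[ℝ] E} (hT : ∀ a b : StrongDual ℝ U, b (Q a) = inner ℝ (T a) (T b)) :
    ∃ (H : Type u) (_ : NormedAddCommGroup H) (_ : InnerProductSpace ℝ H) (_ : CompleteSpace H)
      (R : StrongDual ℝ U →ₗ[ℝ] H), IsCovarianceFactor Q R := by
  have hR := isCovarianceFactor_codRestrict hT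
  obtain ⟨_, b, -⟩ := hR.exists_hilbertBasis
  obtain ⟨H, _, _, _, ⟨J⟩⟩ := exists_linearIsometryEquiv_of_hilbertBasis.{u} b
  exact ⟨H, _, _, inferInstance, _, hR.comp_linearIsometryEquiv J⟩

end Factorization

/-! ### Series representations of `M₂` -/

section SeriesRepresentation

variable {Ω : Type v} {mΩ : MeasurableSpace Ω} {P : Measure Ω}

lemma covariance_eq_inner {X Y : Ω → ℝ} {F G : Lp ℝ 2 P} (hX : X =ᵐ[P] F) (hY : Y =ᵐ[P] G)
    (hF : ∫ ω, F ω ∂P = 0) (hG : ∫ ω, G ω ∂P = 0) : cov[X, Y; P] = inner ℝ F G := by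
  rw [covariance, integral_congr_ae hX, integral_congr_ae hY, hF, hG, real_inner_comm,
    L2.inner_def]
  refine integral_congr_ae ?_
  filter_upwards [hX, hY] with ω hωX hωY
  simp [hωX, hωY]

variable {U : Type u} [NormedAddCommGroup U] [NormedSpace ℝ U]
  {L : ℝ≥0 → StrongDual ℝ U → Ω → ℝ} {Q : StrongDual ℝ U → U}

lemma IsCovarianceOperator.apply_eq_inner (hQ : IsCovarianceOperator P L Q)
    (a b : StrongDual ℝ U) : b (Q a) = inner ℝ (M₂ P L 1 a) (M₂ P L 1 b) := by
  rw [hQ a b, L2.inner_def]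
  exact integral_congr_ae (Eventually.of_forall fun ω => mul_comm _ _)

namespace IsRegularCylindricalLevy

variable [IsProbabilityMeasure P] {𝓕 : Filtration ℝ≥0 mΩ}

lemma exists_isCovarianceFactor [CompleteSpace U] [TopologicalSpace.SeparableSpace U]
    (hL : IsRegularCylindricalLevy P 𝓕 L) (hQ : IsCovarianceOperator P L Q) :
    ∃ (H : Type u) (_ : NormedAddCommGroup H) (_ : InnerProductSpace ℝ H) (_ : CompleteSpace H)
      (R : StrongDual ℝ U →ₗ[ℝ] H), IsCovarianceFactor Q R :=
  CylLevy.exists_isCovarianceFactor (T := hL.linearMapM₂ 1) hQ.apply_eq_inner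

variable {H : Type*} [NormedAddCommGroup H] [InnerProductSpace ℝ H] {R : StrongDual ℝ U →ₗ[ℝ] H}

lemma norm_M₂_eq_sqrt_mul (hL : IsRegularCylindricalLevy P 𝓕 L) (hQ : IsCovarianceOperator P L Q)
    (hR : IsCovarianceFactor Q R) (t : ℝ≥0) (a : StrongDual ℝ U) :
    ‖M₂ P L t a‖ = √t * ‖R a‖ := by
  rw [← sq_eq_sq₀ (norm_nonneg _) (by positivity), hL.norm_sq_M₂, mul_pow,
    Real.sq_sqrt t.coe_nonneg,
    ← real_inner_self_eq_norm_sq (R a), ← hR.apply_eq_inner, hQ.apply_eq_inner,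
    real_inner_self_eq_norm_sq]

lemma hasSum_M₂ (hL : IsRegularCylindricalLevy P 𝓕 L) (hQ : IsCovarianceOperator P L Q)
    (hR : IsCovarianceFactor Q R) {ι : Type*} {a : ι → StrongDual ℝ U} {c : ι → ℝ}
    {b : StrongDual ℝ U} (hsum : HasSum (fun k => c k • R (a k)) (R b)) (t : ℝ≥0) :
    HasSum (fun k => c k • M₂ P L t (a k)) (M₂ P L t b) := by
  have herr (s : Finset ι) : ‖∑ k ∈ s, c k • M₂ P L t (a k) - M₂ P L t b‖ =
      √t * ‖∑ k ∈ s, c k • R (a k) - R b‖ := by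
    have h := hL.norm_M₂_eq_sqrt_mul hQ hR t (∑ k ∈ s, c k • a k - b)
    rw [← hL.linearMapM₂_apply] at h
    simpa only [map_sub, map_sum, map_smul, linearMapM₂_apply] using h
  rw [HasSum, tendsto_iff_norm_sub_tendsto_zero] at hsum ⊢
  simpa only [herr, mul_zero] using hsum.const_mul √(t : ℝ)

variable {ι H' : Type*} [NormedAddCommGroup H'] [InnerProductSpace ℝ H']

lemma isSeriesRepresentation_of_isPaddedHilbertBasis (hL : IsRegularCylindricalLevy P 𝓕 L)
    (hQ : IsCovarianceOperator P L Q) (hR : IsCovarianceFactor Q R) {a : ι → StrongDual ℝ U}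
    (ha : IsPaddedHilbertBasis fun k => R (a k)) {m : ι → ℝ≥0 → Ω → ℝ}
    (hm : ∀ k, IsLevyProcess P (m k)) (hm_cadlag : ∀ k ω, IsCadlag fun t => m k t ω)
    (hm_version : ∀ k t, m k t =ᵐ[P] M₂ P L t (a k)) {e : HilbertBasis ι ℝ H'} {F : H' →L[ℝ] U}
    (hF : ∀ k, F (e k) = Q (a k)) : IsSeriesRepresentation P L e F m where
  levy := hm
  cadlag := hm_cadlag
  memLp k t := (Lp.memLp (M₂ P L t (a k))).ae_eq (hm_version k t).symm
  uncorrelated k l hkl s t := by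
    rw [covariance_eq_inner (hm_version k s) (hm_version l t) (hL.integral_M₂ s _)
      (hL.integral_M₂ t _), hL.inner_M₂, ← hQ.apply_eq_inner, hR.apply_eq_inner,
      ha.orthogonal k l hkl, mul_zero]
  hasSum t b := by
    refine (hL.hasSum_M₂ hQ hR (ha.hasSum (R b)) t).congr_fun fun k => ?_
    rw [hF, hR.apply_eq_inner]
    congr 1
    exact Lp.ext ((MemLp.coeFn_toLp _).trans (hm_version k t))

lemma exists_isSeriesRepresentation (hL : IsRegularCylindricalLevy P 𝓕 L)
    (hQ : IsCovarianceOperator P L Q) (hR : IsCovarianceFactor Q R) {a : ι → StrongDual ℝ U}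
    (ha : IsPaddedHilbertBasis fun k => R (a k)) {e : HilbertBasis ι ℝ H'} {F : H' →L[ℝ] U}
    (hF : ∀ k, F (e k) = Q (a k)) :
    ∃ m : ι → ℝ≥0 → Ω → ℝ,
      IsSeriesRepresentation P L e F m ∧ ∀ k t, m k t =ᵐ[P] M₂ P L t (a k) := by
  choose m hm hm_cadlag hm_version using fun k => hL.exists_cadlag_version_M₂ (a k)
  exact ⟨m, hL.isSeriesRepresentation_of_isPaddedHilbertBasis hQ hR ha hm hm_cadlag hm_version hF,
    hm_version⟩

end IsRegularCylindricalLevy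

end SeriesRepresentation

end CylLevy

theorem mainTheorem4 {Ω : Type v} {mΩ : MeasurableSpace Ω} (P : Measure Ω)
    [IsProbabilityMeasure P] (𝓕 : Filtration ℝ≥0 mΩ)
    {U : Type u} [NormedAddCommGroup U] [NormedSpace ℝ U] [CompleteSpace U]
    [TopologicalSpace.SeparableSpace U]
    (L : ℝ≥0 → StrongDual ℝ U → Ω → ℝ)
    (hL : IsWeaklyCylindricalLevyProcess P 𝓕 L)
    (hcadlag : IsWeaklyCadlag P L)
    (hL2 : IsWeakOrderTwo P L)
    (hstrong : IsStrong P L) :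
    -- the `L²`-limit that defines `M₂(t)a` exists
    (∀ t a, IsCompensatedJumpIntegral P (fun s => L s a) t (M₂ P L t a)) ∧
    -- a series representation with an orthonormal basis indexed by `ℕ`
    (∃ (H : Type) (_ : NormedAddCommGroup H) (_ : InnerProductSpace ℝ H) (_ : CompleteSpace H)
      (e : HilbertBasis ℕ ℝ H) (F : H →L[ℝ] U) (m : ℕ → ℝ≥0 → Ω → ℝ),
      IsSeriesRepresentation P L e F m) ∧
    -- the representation in the reproducing kernel Hilbert space of the covariance operator `Q`,
    -- embedded by `i`, with `m k = M₂(·)(a k)`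
    (∃ (Q : StrongDual ℝ U → U) (H : Type u) (_ : NormedAddCommGroup H)
      (_ : InnerProductSpace ℝ H) (_ : CompleteSpace H) (i : H →L[ℝ] U)
      (ι : Type) (_ : Countable ι) (e : HilbertBasis ι ℝ H) (m : ι → ℝ≥0 → Ω → ℝ)
      (a : ι → StrongDual ℝ U),
      IsCovarianceOperator P L Q ∧
      IsReproducingKernelHilbertSpace Q i ∧
      IsSeriesRepresentation P L e i m ∧
      (∀ k, i (e k) = Q (a k)) ∧
      ∀ k t, m k t =ᵐ[P] M₂ P L t (a k)) := by
  have hM : IsRegularCylindricalLevy P 𝓕 L := ⟨hL, hcadlag, hL2⟩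
  obtain ⟨Q, hQ⟩ := hstrong
  obtain ⟨H, _, _, _, R, hR⟩ := hM.exists_isCovarianceFactor hQ
  obtain ⟨i, hi⟩ := hR.exists_embedding
  obtain ⟨a, b, hb⟩ := hR.exists_hilbertBasis
  have hbasis : IsPaddedHilbertBasis fun n : {n // R (a n) ≠ 0} => R (a n) := by
    simpa only [← hb] using isPaddedHilbertBasis_of_hilbertBasis b
  refine ⟨hM.isCompensatedJumpIntegral_M₂, ?_, ?_⟩
  · let e : HilbertBasis ℕ ℝ (lp (fun _ : ℕ => ℝ) 2) := .ofRepr (.refl ℝ _)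
    obtain ⟨S, hS⟩ := hbasis.of_ne_zero.exists_synthesis e
    have hF (n : ℕ) : (i ∘L S) (e n) = Q (a n) :=
      (congrArg i (hS n)).trans (hR.embedding_apply hi _)
    obtain ⟨m, hm, -⟩ := hM.exists_isSeriesRepresentation hQ hR hbasis.of_ne_zero hF
    exact ⟨_, _, _, inferInstance, e, i ∘L S, m, hm⟩
  · have hF (n : {n // R (a n) ≠ 0}) : i (b n) = Q (a n) := by rw [hb, hR.embedding_apply hi]
    obtain ⟨m, hm, hm_version⟩ := hM.exists_isSeriesRepresentation hQ hR hbasis hF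
    exact ⟨Q, H, _, _, _, i, _, inferInstance, b, m, fun n => a n, hQ,
      hR.isReproducingKernelHilbertSpace hi, hm, hF, hm_version⟩
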